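/- A directed network is a simple directed graph $G=(V,E)$ on $n\ge 1$ vertices (no loops or parallel edges; antiparallel pairs are allowed) whose underlying undirected graph is connected; $D$ (the hop-diameter) is the diameter of that undirected graph. The girth $g(G)\in\mathbb N\cup\{\infty\}$ is the length of a shortest directed cycle, with $g(G)=\infty$ if there is none. In the CONGEST model each vertex is a processor. Computation proceeds in synchronous rounds, in each of which every vertex can send a (possibly different) message of $O(\log n)$ bits to each neighbour in the underlying undirected graph, in both directions of every edge; local computation is free and every vertex has private fair coins. Initially a vertex knows $n$, its own unique $O(\log n)$-bit identifier, the directions of its incident edges, and a value (the same for all vertices) that approximates $D$ within a constant factor. **Theorem.** There is an absolute constant $k$ such that for all constants in the assumptions on the identifiers and on the approximation of $D$ there is a message-size bound $O(\log n)$ for which the following holds. For every constant $c\ge 1$ there are a constant $K$ and a randomized CONGEST algorithm such that on every directed unweighted network, with probability at least $1-n^{-c}$, all vertices terminate within $$K\,\bigl(n^{2/3}+D\bigr)\,(1+\log_2 n)^{k}\;=\;\tilde O\bigl(n^{2/3}+D\bigr)$$ rounds and output a common value $M\in\mathbb N\cup\{\infty\}$ that is a $2$-approximation of the girth, $$g(G)\;\le\;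 M\;\le\; 2\,g(G),$$ and that is moreover exact, $M=g(G)$, whenever $g(G)\ge n^{2/3}$. -/

import Mathlib

/-! ## Directed girth -/

/-- The length of a shortest directed cycle of `G`, and `⊤` if `G` is acyclic. A directed cycle is a
nonempty cyclic sequence of distinct vertices in which each vertex has an edge to the next one (and
the last one to the first one); its number of edges is its length. In a loopless digraph the
shortest possible cycles are pairs of antiparallel edges. -/
noncomputable def directedGirth {V : Type*} (G : Digraph V) : ℕ∞ :=
  ⨅ c ∈ {c : Cycle V | c ≠ Cycle.nil ∧ c.Nodup ∧ c.Chain G.Adj}, (c.length : ℕ∞)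

/-! ## Networks -/

/-- A directed unweighted communication network, together with the data through which its nodes
see it: identifiers, port numbers, and an estimate of the hop-diameter. -/
structure DirectedNetwork (V : Type*) where
  /-- The directed input graph. -/
  graph : Digraph V
  loopless : ∀ v, ¬ graph.Adj v v
  /-- The communication graph (edges are bidirectional channels) is connected. -/
  connected : graph.toSimpleGraphInclusive.Connected
  /-- The identifier of each node. -/
  ident : V → ℕ
  ident_injective : Function.Injective ident
  /-- The node at the other end of each of the ports `0, 1, …, deg v - 1` of `v`. -/
  port : ∀ v, Fin (Nat.card (graph.toSimpleGraphInclusive.neighborSet v)) ≃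
    graph.toSimpleGraphInclusive.neighborSet v
  /-- The estimate of the hop-diameter that is known to all nodes. -/
  diamEstimate : ℕ

namespace DirectedNetwork

variable {V : Type*} (N : DirectedNetwork V)

/-- The underlying undirected graph, along whose edges messages travel in both directions. -/
def comm : SimpleGraph V := N.graph.toSimpleGraphInclusive

/-- The hop-diameter: the diameter of the underlying undirected graph. -/
noncomputable def hopDiam : ℕ := N.comm.diam

/-- The number of ports (neighbours in the communication graph) of `v`. -/
noncomputable def deg (v : V) : ℕ := Nat.card (N.comm.neighborSet v)

/-- The neighbour of `v` behind its port `p`. -/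
noncomputable def neighbor (v : V) (p : Fin (N.deg v)) : V := (N.port v p).1

theorem adj_neighbor (v : V) (p : Fin (N.deg v)) : N.comm.Adj v (N.neighbor v p) :=
  (N.port v p).2

/-- The port of `neighbor v p` that belongs to the same channel as the port `p` of `v`. -/
noncomputable def oppositePort (v : V) (p : Fin (N.deg v)) : Fin (N.deg (N.neighbor v p)) :=
  (N.port (N.neighbor v p)).symm ⟨v, (N.adj_neighbor v p).symm⟩

end DirectedNetwork

/-! ## Randomized algorithms in the CONGEST model -/

/-- What a node knows before the first round. -/
structure LocalInput where
  /-- The number of nodes of the network. -/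
  size : ℕ
  /-- The estimate of the hop-diameter. -/
  diamEstimate : ℕ
  /-- The node's own identifier. -/
  ident : ℕ
  /-- The node's number of ports. -/
  deg : ℕ
  /-- Whether there is an edge leaving the node through the given port. -/
  isOut : ℕ → Bool
  /-- Whether there is an edge entering the node through the given port. -/
  isIn : ℕ → Bool

open Classical in
/-- The initial knowledge of the node `v` of the network `N`. -/
noncomputable def DirectedNetwork.localInput {V : Type*} [Fintype V] (N : DirectedNetwork V)
    (v : V) : LocalInput where
  size := Fintype.card V
  diamEstimate := N.diamEstimate
  ident := N.ident v
  deg := N.deg v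
  isOut p := if h : p < N.deg v then decide (N.graph.Adj v (N.neighbor v ⟨p, h⟩)) else false
  isIn p := if h : p < N.deg v then decide (N.graph.Adj (N.neighbor v ⟨p, h⟩) v) else false

/-- A randomized synchronous message-passing algorithm whose outputs are values in `ℕ∞`. All nodes
run the same program, and local computation is unrestricted. A node in a state with an output has
terminated. -/
structure CongestAlgorithm where
  /-- The states of a node. -/
  State : Type
  /-- The number of private fair coins of each node, in networks with a given number of nodes. -/
  coins : ℕ → ℕ
  /-- The initial state, given the initial knowledge of the node and its coin flips. -/
  init : (I : LocalInput) → (Fin (coins I.size) → Bool) → State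
  /-- The bit string that a node sends through each of its ports. -/
  send : State → ℕ → List Bool
  /-- The new state, given the bit strings that arrived through the ports. -/
  receive : State → (ℕ → List Bool) → State
  /-- The output of a node, once it has terminated. -/
  output : State → Option ℕ∞

namespace CongestAlgorithm

variable (A : CongestAlgorithm) {V : Type*} [Fintype V]

/-- The outcomes of all private coin flips of all nodes. -/
abbrev Coins (V : Type*) [Fintype V] : Type _ := V → Fin (A.coins (Fintype.card V)) → Bool

/-- The global configuration before the first round. -/
noncomputable def initial (N : DirectedNetwork V) (ω : A.Coins V) : V → A.State :=
  fun v => A.init (N.localInput v) (ω v)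

/-- The bit string sent through the port `p` by a node in state `s`, when every channel carries at
most `L` bits per round in each direction. Nodes that have terminated are silent. -/
def message (L : ℕ) (s : A.State) (p : ℕ) : List Bool :=
  if (A.output s).isSome then [] else (A.send s p).take L

/-- One synchronous round. -/
noncomputable def round (L : ℕ) (N : DirectedNetwork V) (σ : V → A.State) : V → A.State :=
  fun v => if (A.output (σ v)).isSome then σ v else
    A.receive (σ v) fun p =>
      if h : p < N.deg v then
        A.message L (σ (N.neighbor v ⟨p, h⟩)) (N.oppositePort v ⟨p, h⟩)
      else []

/-- The global configuration after `t` rounds. -/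
noncomputable def run (L : ℕ) (N : DirectedNetwork V) (ω : A.Coins V) (t : ℕ) : V → A.State :=
  (A.round L N)^[t] (A.initial N ω)

/-- Within `t` rounds, all nodes terminate with the common output `M`. -/
def Computes (L : ℕ) (N : DirectedNetwork V) (ω : A.Coins V) (t : ℕ) (M : ℕ∞) : Prop :=
  ∀ v, A.output (A.run L N ω t v) = some M

open Classical in
/-- The probability of an event over independent fair coin flips of all nodes. -/
noncomputable def prob (V : Type*) [Fintype V] (E : Set (A.Coins V)) : ENNReal :=
  (PMF.uniformOfFintype (A.Coins V)).toOuterMeasure E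

end CongestAlgorithm

/-- `M` is a `2`-approximation of the girth of the directed graph `G` on `n` vertices, and it is
exact if no directed cycle is shorter than `n ^ (2/3)`. -/
def IsGirthApprox {V : Type*} [Fintype V] (G : Digraph V) (M : ℕ∞) : Prop :=
  directedGirth G ≤ M ∧ M ≤ 2 * directedGirth G ∧
    ((∀ g : ℕ, directedGirth G = g → (Fintype.card V : ℝ) ^ (2 / 3 : ℝ) ≤ g) →
      M = directedGirth G)

/-! Write l for the rounded-up binary logarithm of n and r for a power of two with n ≤ r³ ≤ 8n. Up
to constants, a set S of l·r nodes is sampled at rate l/r². Explorations from S of depth 2r² in both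
directions, followed by a broadcast of the distances inside S (at most |S|² rows, about n^(2/3) up
to logarithms), give every node its truncated distances to and from S and the whole table of
distances between sampled nodes. Every candidate for the output is the length of a closed walk, so
the output is never below the girth (`directedGirth_le_of_reaches`).

Long cycles. If g ≥ n^(2/3), then with high probability S meets every window of r²/4 consecutive
vertices of a shortest cycle. The cycle is then a closed chain of entries of the table, and the
table yields g exactly (`tableGirth_le_of_windows`).

Short cycles. Every node v explores to depth r², but y is cut off when some pivot t in S satisfies
2d(v,t) + d(t,y) ≤ d(y,t) + 2d(v,y). If this happens on a shortest cycle through v, the closed walk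
t → y → v → t has length at most 2g, and the table contains one through t that is no longer; if it
never happens, the exploration returns to v (`exists_visits_of_cycle`). For fixed v the pruning
relation between sampled nodes compares two numbers and is therefore total, so l + 1 pivots prune
all sampled nodes near v (`exists_dominating`). Thus no sampled node survives; since a random sample
hits every large survivor set, each exploration stays below a size β of order r²·l
(`GoodSample.ncard_survivors_lt`).

Crowded nodes. Many small explorations may still meet at one node. In each iteration every active
node is selected with probability 1/M, where M ≥ 4β. The selected nodes explore first; they and the
nodes they visit become the next active set and block the explorations of the remaining active
nodes. With high probability every node wanted by many active explorations gets blocked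
(`rare_not_hitsHeavy`), and the active set halves up to an additive term (`FewSelected.fewActive`).
A short cycle either avoids the blocked nodes and is handled now, or still contains an active vertex
(`girthOutput_le_of_cycle`). After l iterations so few nodes are active that all of them can explore
at once.

Scheduling. Every source waits for a random delay below M. The expected number of tokens that a node
accepts per step is then O(l), and so is the actual number with high probability
(`rare_not_loadBounded`); under this bound simultaneous explorations behave as if each were alone
(`runs_explore`). Each batch costs r² + D rounds up to logarithmic factors. -/

/-! ## Lockstep node programs -/

/-- A node program that sends at most one natural number per port and round, and returns a value
of type `α` after some number of rounds. -/
inductive Proto (α : Type) : Type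
  | ret (a : α) : Proto α
  | step (send : ℕ → Option ℕ) (next : (ℕ → Option ℕ) → Proto α) : Proto α

namespace Proto

/-- Sequential composition. -/
def bind {α β : Type} : Proto α → (α → Proto β) → Proto β
  | ret a, f => f a
  | step s k, f => step s fun x => (k x).bind f

/-- Encoding of an optional number; the absent number is the empty string. -/
def encode : Option ℕ → List Bool
  | none => []
  | some x => true :: x.bits

open Classical in
/-- The inverse of `encode`. -/
noncomputable def decode (l : List Bool) : Option ℕ :=
  if h : ∃ x, encode x = l then h.choose else none

theorem bits_injective : Function.Injective Nat.bits := by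
  intro a b h
  refine Nat.eq_of_testBit_eq fun i => ?_
  rw [Nat.testBit_eq_inth, Nat.testBit_eq_inth, h]

theorem encode_injective : Function.Injective encode := by
  intro x y h
  cases x <;> cases y <;> simp_all [encode, bits_injective.eq_iff]

theorem decode_encode (x : Option ℕ) : decode (encode x) = x := by
  have h : ∃ y, encode y = encode x := ⟨x, rfl⟩
  rw [decode, dif_pos h]
  exact encode_injective h.choose_spec

theorem length_encode_le {x : Option ℕ} {w : ℕ} (h : ∀ y, x = some y → y < 2 ^ w) :
    (encode x).length ≤ w + 1 := by
  cases x with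
  | none => simp [encode]
  | some y => simpa [encode, Nat.size_eq_bits_len, Nat.size_le] using h y rfl

end Proto

/-- What a node receives through its ports when every node `v` sends `s v p` through port `p`. -/
noncomputable def DirectedNetwork.deliver {V : Type*} (N : DirectedNetwork V) {μ : Type}
    [Inhabited μ] (s : V → ℕ → μ) (v : V) (p : ℕ) : μ :=
  if h : p < N.deg v then s (N.neighbor v ⟨p, h⟩) (N.oppositePort v ⟨p, h⟩) else default

/-- The node programs `p` terminate after exactly `t` rounds with the results `r`, and all numbers
sent are smaller than `2 ^ w`. -/
inductive Runs {V : Type*} (N : DirectedNetwork V) (w : ℕ) {α : Type} :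
    (V → Proto α) → ℕ → (V → α) → Prop
  | ret (r : V → α) : Runs N w (fun v => .ret (r v)) 0 r
  | step (s : V → ℕ → Option ℕ) (k : V → (ℕ → Option ℕ) → Proto α) (t : ℕ) (r : V → α)
      (hs : ∀ v p x, s v p = some x → x < 2 ^ w)
      (h : Runs N w (fun v => k v (N.deliver s v)) t r) :
      Runs N w (fun v => .step (s v) (k v)) (t + 1) r

theorem Runs.congr {V : Type*} {N : DirectedNetwork V} {w : ℕ} {α : Type} {p p' : V → Proto α}
    {t t' : ℕ} {r r' : V → α} (h : Runs N w p t r) (hp : ∀ v, p v = p' v) (ht : t = t')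
    (hr : ∀ v, r v = r' v) : Runs N w p' t' r' := by
  obtain rfl : p = p' := funext hp
  obtain rfl : r = r' := funext hr
  rwa [← ht]

theorem Runs.bind {V : Type*} {N : DirectedNetwork V} {w : ℕ} {α β : Type} {p : V → Proto α}
    {t : ℕ} {r : V → α} (h : Runs N w p t r) {f : V → α → Proto β} {t' : ℕ} {r' : V → β}
    (h' : Runs N w (fun v => f v (r v)) t' r') :
    Runs N w (fun v => (p v).bind (f v)) (t + t') r' := by
  induction h with
  | ret r => simpa [Proto.bind] using h'
  | step s k t r hs _ ih =>
    rw [Nat.add_right_comm]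
    exact Runs.step s _ _ _ hs (ih h')

/-- Iteration of a node program, with a state that is passed on and a counter. -/
def Proto.loop {α : Type} (body : ℕ → α → Proto α) : ℕ → ℕ → α → Proto α
  | 0, _, a => .ret a
  | m + 1, i, a => (body i a).bind (Proto.loop body m (i + 1))

theorem Runs.loop {V : Type*} {N : DirectedNetwork V} {w : ℕ} {α : Type}
    {body : V → ℕ → α → Proto α} (S : ℕ → V → α) {t : ℕ} (m i : ℕ)
    (h : ∀ j, i ≤ j → j < i + m → Runs N w (fun v => body v j (S j v)) t (S (j + 1))) :
    Runs N w (fun v => Proto.loop (body v) m i (S i v)) (m * t) (S (i + m)) := by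
  induction m generalizing i with
  | zero => simpa [Proto.loop] using Runs.ret (N := N) (w := w) (S i)
  | succ m ih =>
    have h1 := ih (i + 1) fun j hj hj' => h j (by omega) (by omega)
    rw [show i + 1 + m = i + (m + 1) by omega] at h1
    have := (h i le_rfl (by omega)).bind (f := fun v => Proto.loop (body v) m (i + 1)) h1
    rwa [show t + m * t = (m + 1) * t by ring] at this

/-- The CONGEST algorithm that is given by a node program. -/
noncomputable def Proto.toAlgorithm (coins : ℕ → ℕ)
    (prog : (I : LocalInput) → (Fin (coins I.size) → Bool) → Proto ℕ∞) : CongestAlgorithm where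
  State := Proto ℕ∞
  coins := coins
  init := prog
  send s p := match s with
    | .ret _ => []
    | .step s _ => encode (s p)
  receive s x := match s with
    | .ret a => .ret a
    | .step _ k => k fun p => decode (x p)
  output s := match s with
    | .ret a => some a
    | .step _ _ => none

/-- A number below 2 ^ w is encoded by at most w + 1 bits, so the truncation to L bits changes
nothing and decoding recovers what was sent. -/
theorem Runs.iterate_round {V : Type*} [Fintype V] {N : DirectedNetwork V} {w L : ℕ}
    (hL : w + 1 ≤ L) {p : V → Proto ℕ∞} {t : ℕ} {r : V → ℕ∞} (h : Runs N w p t r)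
    (coins : ℕ → ℕ) (prog : (I : LocalInput) → (Fin (coins I.size) → Bool) → Proto ℕ∞) :
    ((Proto.toAlgorithm coins prog).round L N)^[t] p = fun v => Proto.ret (r v) := by
  induction h with
  | ret r => rfl
  | step s k t r hs _ ih =>
    refine (congrArg ((Proto.toAlgorithm coins prog).round L N)^[t] ?_).trans ih
    funext v
    simp only [CongestAlgorithm.round, Proto.toAlgorithm, Option.isSome_none, Bool.false_eq_true,
      if_false, CongestAlgorithm.message]
    congr 1
    funext q
    simp only [DirectedNetwork.deliver]
    split_ifs with hq
    · rw [List.take_of_length_le, Proto.decode_encode]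
      exact (Proto.length_encode_le (hs _ _)).trans hL
    · exact Proto.decode_encode none

theorem Runs.computes {V : Type*} [Fintype V] {N : DirectedNetwork V} {w L : ℕ}
    (hL : w + 1 ≤ L) (coins : ℕ → ℕ)
    (prog : (I : LocalInput) → (Fin (coins I.size) → Bool) → Proto ℕ∞)
    (ω : (Proto.toAlgorithm coins prog).Coins V) {t : ℕ} {M : ℕ∞}
    (h : Runs N w (fun v => prog (N.localInput v) (ω v)) t fun _ => M) :
    (Proto.toAlgorithm coins prog).Computes L N ω t M := by
  intro v
  have := congrFun (h.iterate_round hL coins prog) v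
  unfold CongestAlgorithm.run
  erw [this]
  rfl

/-! ## Exchanging longer messages -/

namespace Proto

/-- One round in which a node sends and receives single numbers. -/
def exchangeWord (s : ℕ → Option ℕ) : Proto (ℕ → Option ℕ) := .step s .ret

/-- Exchange of lists of at most `q` numbers, in `q` rounds. -/
def exchangeWords (q : ℕ) (s : ℕ → List ℕ) : Proto (ℕ → List ℕ) :=
  loop (fun i acc => (exchangeWord fun p => (s p)[i]?).bind fun x =>
    .ret fun p => acc p ++ (x p).toList) q 0 fun _ => []

/-- Exchange of lists of at most `m` nonempty lists of at most `q` numbers, in `m * q` rounds. -/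
def exchangeLists (m q : ℕ) (s : ℕ → List (List ℕ)) : Proto (ℕ → List (List ℕ)) :=
  loop (fun i acc => (exchangeWords q fun p => (s p).getD i []).bind fun x =>
    .ret fun p => if x p = [] then acc p else acc p ++ [x p]) m 0 fun _ => []

end Proto

section Exchange

variable {V : Type*} {N : DirectedNetwork V} {w : ℕ}

theorem DirectedNetwork.deliver_map {μ ν : Type} [Inhabited μ] [Inhabited ν] (s : V → ℕ → μ)
    (f : μ → ν) (hf : f default = default) (v : V) (p : ℕ) :
    N.deliver (fun v p => f (s v p)) v p = f (N.deliver s v p) := by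
  unfold DirectedNetwork.deliver
  split_ifs <;> simp [hf]

theorem DirectedNetwork.deliver_induction {μ : Type} [Inhabited μ] {s : V → ℕ → μ} {P : μ → Prop}
    (h : ∀ v p, P (s v p)) (hd : P default) (v : V) (p : ℕ) : P (N.deliver s v p) := by
  unfold DirectedNetwork.deliver
  split_ifs
  · exact h _ _
  · exact hd

theorem runs_exchangeWord (s : V → ℕ → Option ℕ) (hs : ∀ v p x, s v p = some x → x < 2 ^ w) :
    Runs N w (fun v => Proto.exchangeWord (s v)) 1 (fun v => N.deliver s v) :=
  Runs.step s _ 0 _ hs (Runs.ret _)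

theorem runs_exchangeWords (q : ℕ) (s : V → ℕ → List ℕ) (hq : ∀ v p, (s v p).length ≤ q)
    (hs : ∀ v p, ∀ x ∈ s v p, x < 2 ^ w) :
    Runs N w (fun v => Proto.exchangeWords q (s v)) q (fun v => N.deliver s v) := by
  have key := Runs.loop (N := N) (w := w) (t := 1)
    (body := fun v i acc => (Proto.exchangeWord fun p => (s v p)[i]?).bind fun x =>
      .ret fun p => acc p ++ (x p).toList) (fun j v p => (N.deliver s v p).take j) q 0 ?_
  · refine key.congr (fun v => rfl) (by simp) fun v => funext fun p => ?_
    rw [zero_add]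
    rw [List.take_of_length_le]
    exact N.deliver_induction (P := fun l => List.length l ≤ q) hq (Nat.zero_le _) v p
  · intro j _ _
    refine (runs_exchangeWord (fun v p => (s v p)[j]?) ?_).bind (t' := 0) ?_
    · intro v p x hx
      exact hs v p x (List.mem_of_getElem? hx)
    · refine (Runs.ret _).congr (fun v => rfl) rfl fun v => funext fun p => Eq.symm ?_
      rw [List.take_add_one]
      congr 2
      exact (N.deliver_map s (fun l => l[j]?) rfl v p).symm

theorem runs_exchangeLists (m q : ℕ) (s : V → ℕ → List (List ℕ))
    (hm : ∀ v p, (s v p).length ≤ m) (hq : ∀ v p, ∀ l ∈ s v p, l ≠ [] ∧ l.length ≤ q)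
    (hs : ∀ v p, ∀ l ∈ s v p, ∀ x ∈ l, x < 2 ^ w) :
    Runs N w (fun v => Proto.exchangeLists m q (s v)) (m * q) (fun v => N.deliver s v) := by
  have key := Runs.loop (N := N) (w := w) (t := q)
    (body := fun v i acc => (Proto.exchangeWords q fun p => (s v p).getD i []).bind fun x =>
      .ret fun p => if x p = [] then acc p else acc p ++ [x p])
    (fun j v p => (N.deliver s v p).take j) m 0 ?_
  · refine key.congr (fun v => rfl) rfl fun v => funext fun p => ?_
    rw [zero_add]
    rw [List.take_of_length_le]
    exact N.deliver_induction (P := fun l => List.length l ≤ m) hm (Nat.zero_le _) v p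
  · intro j _ _
    have hmem : ∀ v p, (s v p).getD j [] = [] ∨ (s v p).getD j [] ∈ s v p := by
      intro v p
      rw [List.getD_eq_getElem?_getD]
      cases h : (s v p)[j]? with
      | none => simp
      | some l => exact Or.inr (List.mem_of_getElem? h)
    refine (runs_exchangeWords q (fun v p => (s v p).getD j []) ?_ ?_).bind (t' := 0) ?_
    · intro v p
      rcases hmem v p with h | h
      · rw [h]; exact Nat.zero_le _
      · exact (hq v p _ h).2
    · intro v p x hx
      rcases hmem v p with h | h
      · rw [h] at hx; cases hx
      · exact hs v p _ h x hx
    · refine (Runs.ret _).congr (fun v => rfl) rfl fun v => funext fun p => Eq.symm ?_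
      rw [List.take_add_one]
      have h1 : N.deliver (fun v p => (s v p).getD j []) v p = (N.deliver s v p).getD j [] :=
        N.deliver_map s (fun l => l.getD j []) (by simp; rfl) v p
      rw [h1, List.getD_eq_getElem?_getD]
      -- The empty list is the filler of unused slots, so it must not occur as a genuine message.
      have h2 : ∀ l ∈ N.deliver s v p, l ≠ [] :=
        N.deliver_induction (P := fun l => ∀ x ∈ l, x ≠ []) (fun v p l hl => (hq v p l hl).1)
          (by intro l hl; cases hl) v p
      cases h : (N.deliver s v p)[j]? with
      | none => simp
      | some l => simp [h2 l (List.mem_of_getElem? h)]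

end Exchange

/-! ## Walks, truncated distances, directed cycles -/

section Walks

variable {V : Type*} {E : V → V → Prop}

/-- There is a walk of length `d` from `u` to `v`. -/
def Reaches (E : V → V → Prop) : ℕ → V → V → Prop
  | 0, u, v => u = v
  | d + 1, u, v => ∃ z, Reaches E d u z ∧ E z v

theorem Reaches.trans {d e : ℕ} {u v x : V} (h : Reaches E d u v) (h' : Reaches E e v x) :
    Reaches E (d + e) u x := by
  induction e generalizing x with
  | zero => cases h'; exact h
  | succ e ih =>
    obtain ⟨z, hz, hzx⟩ := h'
    exact ⟨z, ih hz, hzx⟩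

theorem reaches_of_path {p : ℕ → V} (hp : ∀ i, E (p i) (p (i + 1))) (i d : ℕ) :
    Reaches E d (p i) (p (i + d)) := by
  induction d with
  | zero => rfl
  | succ d ih => exact ⟨_, ih, hp _⟩

theorem exists_path_of_reaches {d : ℕ} {u v : V} (h : Reaches E d u v) :
    ∃ p : ℕ → V, p 0 = u ∧ p d = v ∧ ∀ i < d, E (p i) (p (i + 1)) := by
  classical
  induction d generalizing v with
  | zero => exact ⟨fun _ => u, rfl, h, by simp⟩
  | succ d ih =>
    obtain ⟨z, hz, hzv⟩ := h
    obtain ⟨p, h0, hd, hp⟩ := ih hz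
    refine ⟨Function.update p (d + 1) v, ?_, by simp, fun i hi => ?_⟩
    · rw [Function.update_of_ne (by omega), h0]
    · rw [Function.update_of_ne (by omega)]
      rcases Nat.lt_succ_iff_lt_or_eq.1 hi with h | rfl
      · rw [Function.update_of_ne (by omega)]
        exact hp i h
      · simpa [hd] using hzv

theorem reaches_flip {d : ℕ} {u v : V} : Reaches (fun x y => E y x) d u v ↔ Reaches E d v u := by
  have one : ∀ {E : V → V → Prop} {x y : V}, E x y → Reaches E 1 x y := fun h => ⟨_, rfl, h⟩
  have key : ∀ {E : V → V → Prop} {d : ℕ} {u v : V},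
      Reaches (fun x y => E y x) d u v → Reaches E d v u := by
    intro E d
    induction d with
    | zero => intro u v h; exact Eq.symm h
    | succ d ih =>
      rintro u v ⟨z, hz, hzv⟩
      have := (one hzv).trans (ih hz)
      rwa [Nat.add_comm] at this
  exact ⟨key, key⟩

/-- The distance from `u` to `v`, truncated at `H`. -/
noncomputable def truncDist (E : V → V → Prop) (H : ℕ) (u v : V) : ℕ :=
  sInf {d | Reaches E d u v ∨ d = H}

variable {H : ℕ}

theorem truncDist_le (u v : V) : truncDist E H u v ≤ H := Nat.sInf_le (Or.inr rfl)

theorem truncDist_le_of_reaches {d : ℕ} {u v : V} (h : Reaches E d u v) : truncDist E H u v ≤ d :=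
  Nat.sInf_le (Or.inl h)

theorem reaches_truncDist {u v : V} (h : truncDist E H u v < H) :
    Reaches E (truncDist E H u v) u v :=
  (Nat.sInf_mem (s := {d | Reaches E d u v ∨ d = H}) ⟨H, Or.inr rfl⟩).resolve_right h.ne

theorem truncDist_self (u : V) : truncDist E H u u = 0 :=
  Nat.le_zero.1 (truncDist_le_of_reaches (d := 0) rfl)

/-- Truncation is harmless: if a summand on the right has reached the cutoff, it already dominates
the left side. -/
theorem truncDist_triangle (u v x : V) :
    truncDist E H u x ≤ truncDist E H u v + truncDist E H v x := by
  by_cases h1 : truncDist E H u v < H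
  · by_cases h2 : truncDist E H v x < H
    · exact truncDist_le_of_reaches ((reaches_truncDist h1).trans (reaches_truncDist h2))
    · exact (truncDist_le u x).trans (by omega)
  · exact (truncDist_le u x).trans (by omega)

/-- If a vertex repeats along the closed walk, the part between the two occurrences is a shorter
closed walk; otherwise the walk is itself a directed cycle. This makes every closed walk found by
the algorithm a valid upper bound for the girth. -/
theorem directedGirth_le_of_reaches (G : Digraph V) {d : ℕ} (hd : 1 ≤ d) {v : V}
    (h : Reaches G.Adj d v v) : directedGirth G ≤ d := by
  classical
  induction d using Nat.strong_induction_on generalizing v with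
  | _ d ih =>
  obtain ⟨p, h0, hpd, hp⟩ := exists_path_of_reaches h
  by_cases hinj : ∀ i < d, ∀ j < d, p i = p j → i = j
  · let l : List V := (List.range d).map p
    have hl : l.length = d := by simp [l]
    have hne : l ≠ [] := by
      intro h
      rw [h] at hl
      simp only [List.length_nil] at hl
      omega
    refine (iInf₂_le (l : Cycle V) ⟨?_, ?_, ?_⟩).trans (by simp [hl])
    · simpa using hne
    · rw [Cycle.nodup_coe_iff]
      refine List.Nodup.map_on ?_ List.nodup_range
      intro i hi j hj hij
      exact hinj i (List.mem_range.1 hi) j (List.mem_range.1 hj) hij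
    · have hc : l = p 0 :: (List.range (d - 1)).map (fun i => p (i + 1)) := by
        obtain ⟨e, rfl⟩ : ∃ e, d = e + 1 := ⟨d - 1, by omega⟩
        simp [l, List.range_succ_eq_map, Function.comp_def]
      rw [hc, Cycle.chain_coe_cons, ← List.cons_append, ← hc,
        show l ++ [p 0] = (List.range (d + 1)).map p by simp [l, List.range_succ, hpd, h0]]
      rw [List.isChain_iff_getElem]
      intro i hi
      simp only [List.length_map, List.length_range] at hi
      simpa using hp i (by omega)
  · push Not at hinj
    obtain ⟨i, hi, j, hj, hij, hne⟩ := hinj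
    wlog hlt : i < j generalizing i j
    · exact this j hj i hi hij.symm hne.symm (by omega)
    refine (ih (j - i) (by omega) (by omega) (v := p i) ?_).trans (by exact_mod_cast (by omega))
    have : ∀ e, i + e ≤ d → Reaches G.Adj e (p i) (p (i + e)) := by
      intro e
      induction e with
      | zero => intro _; rfl
      | succ e ihe => exact fun he => ⟨_, ihe (by omega), hp _ (by omega)⟩
    have h2 := this (j - i) (by omega)
    rwa [show i + (j - i) = j by omega, ← hij] at h2

/-- A shortest directed cycle, as a periodic sequence of vertices that starts at a given place. -/
theorem exists_shortest_cycle (G : Digraph V) {g : ℕ} (hg : directedGirth G = g) :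
    1 ≤ g ∧ ∃ c : ℕ → V, (∀ i, G.Adj (c i) (c (i + 1))) ∧ (∀ i, c (i + g) = c i) ∧
      ∀ i j, i ≤ j → j < i + g → c i = c j → i = j := by
  classical
  have hne : ∃ c : Cycle V, (c ≠ Cycle.nil ∧ c.Nodup ∧ c.Chain G.Adj) ∧ c.length = g := by
    by_contra hcon
    push Not at hcon
    have h1 : ((g + 1 : ℕ) : ℕ∞) ≤ directedGirth G := by
      refine le_iInf₂ fun c hc => ?_
      have h2 : directedGirth G ≤ c.length := iInf₂_le c hc
      have h3 := hcon c hc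
      rw [hg] at h2
      have h4 : g ≤ c.length := by exact_mod_cast h2
      exact_mod_cast (by omega : g + 1 ≤ c.length)
    rw [hg] at h1
    have : g + 1 ≤ g := by exact_mod_cast h1
    omega
  obtain ⟨c, ⟨hc0, hc1, hc2⟩, hlen⟩ := hne
  induction c using Quotient.inductionOn' with
  | _ l =>
  change (l : Cycle V) ≠ _ at hc0
  change (l : Cycle V).Nodup at hc1
  change (l : Cycle V).Chain _ at hc2
  change (l : Cycle V).length = g at hlen
  rw [Cycle.length_coe] at hlen
  rw [Cycle.nodup_coe_iff] at hc1
  have hl0 : l ≠ [] := by simpa using hc0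
  have hg1 : 1 ≤ g := by
    rw [← hlen]
    exact List.length_pos_iff.2 hl0
  have hmod : ∀ i, i % g < l.length := fun i => by rw [hlen]; exact Nat.mod_lt _ hg1
  refine ⟨hg1, fun i => l[i % g]'(hmod i), fun i => ?_, fun i => by simp, fun i j hij hj h => ?_⟩
  · obtain ⟨a, m, rfl⟩ := List.exists_cons_of_ne_nil hl0
    rw [Cycle.chain_coe_cons, List.isChain_iff_getElem] at hc2
    have h1 := hc2 (i % g) (by have := hmod i; simp at this ⊢; omega)
    have hm := hmod i
    simp only [List.length_cons] at hlen hm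
    have e1 : (a :: (m ++ [a]))[i % g]'(by simp; omega) = (a :: m)[i % g]'(hmod i) := by
      simp only [← List.cons_append]
      rw [List.getElem_append_left]
    rw [e1] at h1
    convert h1 using 1
    rcases Nat.lt_or_ge (i % g + 1) g with h2 | h2
    · have h3 : (i + 1) % g = i % g + 1 := by
        rw [Nat.add_mod, Nat.mod_eq_of_lt (a := i % g + 1 % g)]
        · rw [Nat.mod_eq_of_lt (by omega : 1 < g)]
        · rw [Nat.mod_eq_of_lt (by omega : 1 < g)]; exact h2
      simp only [h3, ← List.cons_append]
      rw [List.getElem_append_left]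
    · have h4 : i % g + 1 = g := by have := Nat.mod_lt i hg1; omega
      have h3 : (i + 1) % g = 0 := by
        rw [← Nat.mod_add_mod, h4, Nat.mod_self]
      simp only [h3, h4, ← List.cons_append]
      rw [List.getElem_append_right (by simp; omega)]
      simp
  · have h1 := (List.Nodup.getElem_inj_iff hc1).1 h
    have h2 : (j - i) % g = 0 := Nat.sub_mod_eq_zero_of_mod_eq h1.symm
    rw [Nat.mod_eq_of_lt (by omega)] at h2
    omega

end Walks

/-! ## Breadth-first exploration with acceptance tests -/

section Spread

variable {V : Type*} {E : V → V → Prop} {v : V} {ok ok' : V → ℕ → Prop}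

/-- The nodes that are visited for the first time in step `d` of an exploration from `v`, and those
visited in steps `1, …, d`. A node that is reached in step `d` counts as visited if it passes the
test `ok`. -/
def spread (E : V → V → Prop) (v : V) (ok : V → ℕ → Prop) : ℕ → Set V × Set V
  -- The source lies on the frontier but does not count as visited. The exploration may therefore
  -- return to it, which is how closed walks through `v` are detected.
  | 0 => ({v}, ∅)
  | d + 1 =>
    let f := {y | (∃ z ∈ (spread E v ok d).1, E z y) ∧ ok y (d + 1) ∧ y ∉ (spread E v ok d).2}
    (f, (spread E v ok d).2 ∪ f)

/-- The node `y` is visited for the first time in step `d ≥ 1`. -/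
def Visits (E : V → V → Prop) (v : V) (ok : V → ℕ → Prop) (d : ℕ) (y : V) : Prop :=
  1 ≤ d ∧ y ∈ (spread E v ok d).1

theorem mem_spread_snd {d : ℕ} {y : V} :
    y ∈ (spread E v ok d).2 ↔ ∃ d' ≤ d, Visits E v ok d' y := by
  induction d with
  | zero =>
    simp only [spread, Set.mem_empty_iff_false, Visits, false_iff]
    rintro ⟨d', h, h', _⟩
    omega
  | succ d ih =>
    rw [spread, Set.mem_union, ih]
    constructor
    · rintro (⟨d', h, h'⟩ | h)
      · exact ⟨d', by omega, h'⟩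
      · exact ⟨d + 1, le_rfl, by omega, h⟩
    · rintro ⟨d', h, h'⟩
      rcases Nat.lt_or_ge d d' with h2 | h2
      · obtain rfl : d' = d + 1 := by omega
        exact Or.inr h'.2
      · exact Or.inl ⟨d', h2, h'⟩

theorem visits_succ {d : ℕ} {y : V} : Visits E v ok (d + 1) y ↔
    (∃ z, (Visits E v ok d z ∨ d = 0 ∧ z = v) ∧ E z y) ∧ ok y (d + 1) ∧
      ∀ d' ≤ d, ¬ Visits E v ok d' y := by
  have h : ∀ z, z ∈ (spread E v ok d).1 ↔ (Visits E v ok d z ∨ d = 0 ∧ z = v) := by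
    intro z
    rcases Nat.eq_zero_or_pos d with rfl | hd
    · simp [Visits, spread]
    · simp only [Visits]
      constructor
      · exact fun h => Or.inl ⟨hd, h⟩
      · rintro (h | h)
        · exact h.2
        · omega
  rw [Visits, spread]
  simp only [Set.mem_ofPred_eq, mem_spread_snd, h]
  simp

theorem Visits.unique {d d' : ℕ} {y : V} (h : Visits E v ok d y) (h' : Visits E v ok d' y) :
    d = d' := by
  wlog hlt : d < d' generalizing d d'
  · rcases Nat.lt_or_ge d' d with h2 | h2
    · exact (this h' h h2).symm
    · omega
  obtain ⟨e, rfl⟩ : ∃ e, d' = e + 1 := ⟨d' - 1, by omega⟩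
  exact absurd h ((visits_succ.1 h').2.2 d (by omega))

theorem Visits.accepted {d : ℕ} {y : V} (h : Visits E v ok d y) : ok y d := by
  obtain ⟨e, rfl⟩ : ∃ e, d = e + 1 := ⟨d - 1, by have := h.1; omega⟩
  exact (visits_succ.1 h).2.1

theorem Visits.exists_path {d : ℕ} {y : V} (h : Visits E v ok d y) :
    ∃ p : ℕ → V, p 0 = v ∧ p d = y ∧ (∀ i < d, E (p i) (p (i + 1))) ∧
      ∀ i, 1 ≤ i → i ≤ d → ok (p i) i := by
  classical
  induction d generalizing y with
  | zero => exact absurd h.1 (by omega)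
  | succ d ih =>
    obtain ⟨⟨z, hz, hzy⟩, hok, -⟩ := visits_succ.1 h
    have : ∃ p : ℕ → V, p 0 = v ∧ p d = z ∧ (∀ i < d, E (p i) (p (i + 1))) ∧
        ∀ i, 1 ≤ i → i ≤ d → ok (p i) i := by
      rcases hz with hz | ⟨rfl, rfl⟩
      · exact ih hz
      · exact ⟨fun _ => z, rfl, rfl, by simp, fun i h1 h2 => by omega⟩
    obtain ⟨p, h0, hd, hp, hpo⟩ := this
    refine ⟨Function.update p (d + 1) y, ?_, by simp, fun i hi => ?_, fun i h1 h2 => ?_⟩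
    · rw [Function.update_of_ne (by omega), h0]
    · rw [Function.update_of_ne (by omega)]
      rcases Nat.lt_succ_iff_lt_or_eq.1 hi with h | rfl
      · rw [Function.update_of_ne (by omega)]
        exact hp i h
      · simpa [hd] using hzy
    · rcases Nat.lt_or_ge d i with h | h
      · obtain rfl : i = d + 1 := by omega
        simpa using hok
      · rw [Function.update_of_ne (by omega)]
        exact hpo i h1 h

theorem Visits.reaches {d : ℕ} {y : V} (h : Visits E v ok d y) : Reaches E d v y := by
  obtain ⟨p, rfl, rfl, hp, -⟩ := h.exists_path
  have : ∀ e ≤ d, Reaches E e (p 0) (p e) := by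
    intro e
    induction e with
    | zero => intro _; rfl
    | succ e ih => exact fun he => ⟨_, ih (by omega), hp _ (by omega)⟩
  exact this d le_rfl

/-- Along a path all of whose nodes pass a test that is monotone in the distance, the exploration
arrives no later than the path does. -/
theorem exists_visits_of_path (hmono : ∀ y d d', d' ≤ d → ok y d → ok y d') {p : ℕ → V} {m : ℕ}
    (h0 : p 0 = v) (hE : ∀ i < m, E (p i) (p (i + 1))) (hok : ∀ i, 1 ≤ i → i ≤ m → ok (p i) i)
    (hm : 1 ≤ m) : ∃ d ≤ m, Visits E v ok d (p m) := by
  induction m with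
  | zero => omega
  | succ m ih =>
    have : ∃ d ≤ m, Visits E v ok d (p m) ∨ d = 0 ∧ p m = v := by
      rcases Nat.eq_zero_or_pos m with rfl | hpos
      · exact ⟨0, le_rfl, Or.inr ⟨rfl, h0⟩⟩
      · obtain ⟨d, hd, h⟩ := ih (fun i hi => hE i (by omega)) (fun i h1 h2 => hok i h1 (by omega))
          hpos
        exact ⟨d, hd, Or.inl h⟩
    obtain ⟨d, hd, h⟩ := this
    by_cases hv : ∃ d' ≤ d, Visits E v ok d' (p (m + 1))
    · obtain ⟨d', hd', h'⟩ := hv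
      exact ⟨d', by omega, h'⟩
    · push Not at hv
      exact ⟨d + 1, by omega, visits_succ.2 ⟨⟨p m, h, hE m (by omega)⟩,
        hmono _ _ _ (by omega) (hok (m + 1) (by omega) le_rfl), hv⟩⟩

theorem exists_visits_of_reaches {H d : ℕ} (hd : 1 ≤ d) (hH : d ≤ H) {y : V}
    (h : Reaches E d v y) : ∃ d' ≤ d, Visits E v (fun _ e => e ≤ H) d' y := by
  obtain ⟨p, h0, rfl, hp⟩ := exists_path_of_reaches h
  exact exists_visits_of_path (fun _ _ _ h1 h2 => h1.trans h2) h0 hp (fun i _ hi => hi.trans hH) hd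

/-- A path accepted by the stricter test is accepted by the weaker one. The first visit may come
earlier under the weaker test, which is why that test has to be monotone in the distance. -/
theorem Visits.mono (hmono : ∀ y d d', d' ≤ d → ok' y d → ok' y d') (hle : ∀ y d, ok y d → ok' y d)
    {d : ℕ} {y : V} (h : Visits E v ok d y) : ∃ d' ≤ d, Visits E v ok' d' y := by
  obtain ⟨p, h0, rfl, hp, hpo⟩ := h.exists_path
  exact exists_visits_of_path hmono h0 hp (fun i h1 h2 => hle _ _ (hpo i h1 h2)) h.1

end Spread

/-! ## Simultaneous explorations with delays -/

namespace Proto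

/-- The token that a node with the given items emits in step `τ`: its `i`-th item is emitted `i`
steps after its delay, and is preceded by the time of its emission. -/
def emission (items : List (List ℕ)) (delay τ : ℕ) : List (List ℕ) :=
  if delay ≤ τ then (items[τ - delay]?.map fun x => τ :: x).toList else []

open Classical in
/-- One step of the exploration: the tokens that have just been accepted are forwarded, and incoming
tokens that are new and pass the test are accepted. -/
noncomputable def exploreStep (deg : ℕ) (dir : ℕ → Prop) (items : List (List ℕ)) (delay : ℕ)
    (ok : List ℕ → ℕ → Prop) (L q τ : ℕ) (s : Finset (List ℕ) × Set (List ℕ × ℕ)) :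
    Proto (Finset (List ℕ) × Set (List ℕ × ℕ)) :=
  -- One slot for the token that the node itself emits, and `L` slots for forwarded tokens.
  (exchangeLists (L + 1) q fun p =>
    if dir p then emission items delay τ ++ s.1.toList else []).bind fun x =>
  -- The head of a token is its time of emission, so the receiver finds the length of its way by
  -- subtraction.
  let f := ((List.range deg).flatMap x).toFinset.filter fun tk =>
    ok tk.tail (τ + 1 - tk.headI) ∧ ∀ d, (tk, d) ∉ s.2
  .ret (f, s.2 ∪ {a | a.1 ∈ f ∧ a.2 = τ + 1 - a.1.headI})

/-- Items are spread along the ports selected by `dir`, by breadth-first explorations that are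
restricted by the test `ok`. The result consists of the items received and of the lengths of their
ways. -/
noncomputable def explore (deg : ℕ) (dir : ℕ → Prop) (items : List (List ℕ)) (delay : ℕ)
    (ok : List ℕ → ℕ → Prop) (L q T : ℕ) : Proto (Set (List ℕ × ℕ)) :=
  (loop (exploreStep deg dir items delay ok L q) T 0 (∅, ∅)).bind fun s =>
  .ret {a | ∃ t, (t :: a.1, a.2) ∈ s.2}

end Proto

namespace DirectedNetwork

variable {V : Type*} (N : DirectedNetwork V)

theorem neighbor_oppositePort (v : V) (p : Fin (N.deg v)) :
    N.neighbor (N.neighbor v p) (N.oppositePort v p) = v :=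
  congrArg Subtype.val ((N.port (N.neighbor v p)).apply_symm_apply ⟨v, (N.adj_neighbor v p).symm⟩)

theorem exists_neighbor_eq {v z : V} (h : N.comm.Adj v z) : ∃ p, N.neighbor v p = z :=
  ⟨(N.port v).symm ⟨z, h⟩, congrArg Subtype.val ((N.port v).apply_symm_apply ⟨z, h⟩)⟩

/-- The sender decides at the port opposite to that of the receiver, and `neighbor_oppositePort`
turns its decision into an edge from sender to receiver. This replaces ports by the relation `E`. -/
theorem mem_deliver_iff {E : V → V → Prop} (hE : ∀ u v, E u v → N.comm.Adj u v)
    {dir : V → ℕ → Prop} (hdir : ∀ v (p : Fin (N.deg v)), dir v p ↔ E v (N.neighbor v p))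
    {out : V → List (List ℕ)} {s : V → ℕ → List (List ℕ)}
    (hs : ∀ v p, dir v p → s v p = out v) (hs' : ∀ v p, ¬ dir v p → s v p = []) (y : V)
    (x : List ℕ) :
    (∃ p < N.deg y, x ∈ N.deliver s y p) ↔ ∃ z, E z y ∧ x ∈ out z := by
  constructor
  · rintro ⟨p, hp, hx⟩
    rw [deliver, dif_pos hp] at hx
    by_cases hd : dir (N.neighbor y ⟨p, hp⟩) (N.oppositePort y ⟨p, hp⟩)
    · rw [hs _ _ hd] at hx
      rw [hdir, neighbor_oppositePort] at hd
      exact ⟨_, hd, hx⟩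
    · rw [hs' _ _ hd] at hx
      cases hx
  · rintro ⟨z, hz, hx⟩
    obtain ⟨p, rfl⟩ := N.exists_neighbor_eq (hE _ _ hz).symm
    refine ⟨p, p.2, ?_⟩
    rw [deliver, dif_pos p.2]
    rwa [hs]
    rw [hdir, neighbor_oppositePort]
    exact hz

end DirectedNetwork

section Explore

variable {V : Type*} {N : DirectedNetwork V} {w : ℕ} {E : V → V → Prop}
  {items : V → List (List ℕ)} {delay : V → ℕ} {ok : V → V → ℕ → Prop}

/-- The tokens accepted by `y` in step `τ`. -/
def freshTokens (E : V → V → Prop) (items : V → List (List ℕ)) (delay : V → ℕ)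
    (ok : V → V → ℕ → Prop) (τ : ℕ) (y : V) : Set (List ℕ) :=
  {tk | ∃ v i x d, (items v)[i]? = some x ∧ tk = (delay v + i) :: x ∧ Visits E v (ok v) d y ∧
    delay v + i + d = τ}

/-- The tokens accepted by `y` up to step `τ`. -/
def seenTokens (E : V → V → Prop) (items : V → List (List ℕ)) (delay : V → ℕ)
    (ok : V → V → ℕ → Prop) (τ : ℕ) (y : V) : Set (List ℕ × ℕ) :=
  {a | ∃ v i x d, (items v)[i]? = some x ∧ a = ((delay v + i) :: x, d) ∧ Visits E v (ok v) d y ∧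
    delay v + i + d ≤ τ}

theorem finite_freshTokens [Finite V] (τ : ℕ) (y : V) :
    (freshTokens E items delay ok τ y).Finite := by
  refine (Set.finite_iUnion fun v => (((items v).finite_toSet).prod
    (Set.finite_Iic τ)).image fun a : List ℕ × ℕ => a.2 :: a.1).subset ?_
  rintro _ ⟨v, i, x, d, hi, rfl, -, h⟩
  exact Set.mem_iUnion.2 ⟨v, ⟨(x, delay v + i), ⟨List.mem_of_getElem? hi, by
    simp only [Set.mem_Iic]; omega⟩, rfl⟩⟩

/-- The tokens accepted by `y` in step `τ`, as a finite set. -/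
noncomputable def freshFinset [Finite V] (E : V → V → Prop) (items : V → List (List ℕ))
    (delay : V → ℕ) (ok : V → V → ℕ → Prop) (τ : ℕ) (y : V) : Finset (List ℕ) :=
  (finite_freshTokens (E := E) (items := items) (delay := delay) (ok := ok) τ y).toFinset

theorem mem_freshFinset [Finite V] {τ : ℕ} {y : V} {tk : List ℕ} :
    tk ∈ freshFinset E items delay ok τ y ↔ tk ∈ freshTokens E items delay ok τ y :=
  Set.Finite.mem_toFinset _

open Classical in
/-- The sources one of whose tokens is accepted by `y` in step `τ`. -/
noncomputable def loadSet [Fintype V] (E : V → V → Prop) (len : V → ℕ) (delay : V → ℕ)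
    (ok : V → V → ℕ → Prop) (τ : ℕ) (y : V) : Finset V :=
  Finset.univ.filter fun v => ∃ i < len v, ∃ d, Visits E v (ok v) d y ∧ delay v + i + d = τ

/-- The distance at which a source first visits `y` is unique, so the step determines which of its
items arrives. Each source thus contributes at most one token per step, even if it emits many items.
-/
theorem card_freshFinset_le [Fintype V] (τ : ℕ) (y : V) :
    (freshFinset E items delay ok τ y).card ≤
      (loadSet E (fun v => (items v).length) delay ok τ y).card := by
  classical
  have hsrc : ∀ tk ∈ freshTokens E items delay ok τ y, ∃ v, ∃ i x d, (items v)[i]? = some x ∧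
    tk = (delay v + i) :: x ∧ Visits E v (ok v) d y ∧ delay v + i + d = τ := fun tk h => h
  have : Nonempty V := ⟨y⟩
  choose! f hf using hsrc
  refine Finset.card_le_card_of_injOn f ?_ ?_
  · intro tk htk
    obtain ⟨i, x, d, h1, -, h3, h4⟩ := hf tk (mem_freshFinset.1 htk)
    simp only [loadSet, Finset.coe_filter, Finset.mem_univ, true_and, Set.mem_ofPred_eq]
    exact ⟨i, (List.getElem?_eq_some_iff.1 h1).1, d, h3, h4⟩
  · intro tk htk tk' htk' heq
    obtain ⟨i, x, d, h1, h2, h3, h4⟩ := hf tk (mem_freshFinset.1 htk)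
    obtain ⟨i', x', d', h1', h2', h3', h4'⟩ := hf tk' (mem_freshFinset.1 htk')
    rw [← heq] at h1' h2' h3' h4'
    obtain rfl := h3.unique h3'
    obtain rfl : i = i' := by omega
    rw [h1] at h1'
    cases h1'
    rw [h2, h2']

/-- The invariant of the exploration loop. `hload` guarantees that the available slots suffice for
all accepted tokens; `hinj` keeps items of different sources apart, so that a token seen before
really belongs to the same exploration. -/
theorem runs_exploreStep [Fintype V] (hE : ∀ u v, E u v → N.comm.Adj u v)
    {dir : V → ℕ → Prop} (hdir : ∀ v (p : Fin (N.deg v)), dir v p ↔ E v (N.neighbor v p))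
    {okw : V → List ℕ → ℕ → Prop} (hok : ∀ v y, ∀ x ∈ items v, ∀ d, okw y x d ↔ ok v y d)
    (hinj : ∀ v v', ∀ x ∈ items v, x ∈ items v' → v = v')
    {L q : ℕ} (hw : ∀ v, ∀ x ∈ items v, ∀ a ∈ x, a < 2 ^ w)
    (hq : ∀ v, ∀ x ∈ items v, x.length + 1 ≤ q)
    (hdelay : ∀ v, ∀ i < (items v).length, delay v + i < 2 ^ w)
    (hload : ∀ τ y, (loadSet E (fun v => (items v).length) delay ok τ y).card ≤ L) (τ : ℕ) :
    Runs N w (fun v => Proto.exploreStep (N.deg v) (dir v) (items v) (delay v) (okw v) L q τ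
        (freshFinset E items delay ok τ v, seenTokens E items delay ok τ v))
      ((L + 1) * q)
      (fun v => (freshFinset E items delay ok (τ + 1) v, seenTokens E items delay ok (τ + 1) v)) := by
  classical
  set out : V → List (List ℕ) := fun v => Proto.emission (items v) (delay v) τ ++
    (freshFinset E items delay ok τ v).toList
    with hout
  have hem : ∀ v tk, tk ∈ Proto.emission (items v) (delay v) τ ↔
      ∃ i x, (items v)[i]? = some x ∧ tk = (delay v + i) :: x ∧ delay v + i = τ := by
    intro v tk
    unfold Proto.emission
    split_ifs with h
    · simp only [Option.mem_toList, Option.map_eq_some_iff]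
      constructor
      · rintro ⟨x, hx, rfl⟩
        exact ⟨_, x, hx, by congr 1; omega, by omega⟩
      · rintro ⟨i, x, hx, rfl, rfl⟩
        exact ⟨x, by simpa using hx, rfl⟩
    · simp only [List.not_mem_nil, false_iff]
      rintro ⟨i, x, -, -, rfl⟩
      omega
  have hmem : ∀ v tk, tk ∈ out v ↔ ∃ u i x d, (items u)[i]? = some x ∧ tk = (delay u + i) :: x ∧
      (Visits E u (ok u) d v ∨ d = 0 ∧ v = u) ∧ delay u + i + d = τ := by
    intro v tk
    rw [hout, List.mem_append, hem, Finset.mem_toList, mem_freshFinset]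
    constructor
    · rintro (⟨i, x, h1, h2, h3⟩ | ⟨u, i, x, d, h1, h2, h3, h4⟩)
      · exact ⟨v, i, x, 0, h1, h2, Or.inr ⟨rfl, rfl⟩, h3⟩
      · exact ⟨u, i, x, d, h1, h2, Or.inl h3, h4⟩
    · rintro ⟨u, i, x, d, h1, h2, h3 | ⟨rfl, rfl⟩, h4⟩
      · exact Or.inr ⟨u, i, x, d, h1, h2, h3, h4⟩
      · exact Or.inl ⟨i, x, h1, h2, h4⟩
  have hlen : ∀ v, (out v).length ≤ L + 1 := by
    intro v
    rw [hout, List.length_append, Finset.length_toList, Nat.add_comm L]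
    refine Nat.add_le_add ?_ ?_
    · unfold Proto.emission
      split_ifs
      · exact Option.length_toList_le
      · simp
    · exact (card_freshFinset_le τ v).trans (hload τ v)
  have hsub : ∀ (v : V) (p : ℕ) (l : List ℕ),
      l ∈ (if dir v p then out v else []) → l ∈ out v := by
    intro v p l hl
    split_ifs at hl
    · exact hl
    · cases hl
  refine (runs_exchangeLists (L + 1) q (fun v p => if dir v p then out v else []) ?_ ?_ ?_).bind
    (t' := 0) ?_
  · intro v p
    split_ifs
    · exact hlen v
    · simp
  · intro v p l hl
    obtain ⟨u, i, x, d, h1, rfl, -, -⟩ := (hmem v l).1 (hsub v p l hl)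
    exact ⟨by simp, by simpa using hq u x (List.mem_of_getElem? h1)⟩
  · intro v p l hl a ha
    obtain ⟨u, i, x, d, h1, rfl, -, -⟩ := (hmem v l).1 (hsub v p l hl)
    rcases List.mem_cons.1 ha with rfl | ha
    · exact hdelay u i (List.getElem?_eq_some_iff.1 h1).1
    · exact hw u x (List.mem_of_getElem? h1) a ha
  · have hf : ∀ y, (((List.range (N.deg y)).flatMap
        (N.deliver (fun v p => if dir v p then out v else []) y)).toFinset.filter fun tk =>
        okw y tk.tail (τ + 1 - tk.headI) ∧ ∀ d, (tk, d) ∉ seenTokens E items delay ok τ y) =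
        freshFinset E items delay ok (τ + 1) y := by
      intro y
      ext tk
      rw [Finset.mem_filter, List.mem_toFinset, List.mem_flatMap, mem_freshFinset]
      simp only [List.mem_range]
      rw [N.mem_deliver_iff hE hdir (out := out) (fun v p h => if_pos h) (fun v p h => if_neg h)]
      constructor
      · rintro ⟨⟨z, hz, htk⟩, hokw, hns⟩
        obtain ⟨u, i, x, d, h1, rfl, h3, h4⟩ := (hmem _ _).1 htk
        refine ⟨u, i, x, d + 1, h1, rfl, visits_succ.2 ⟨⟨z, h3, hz⟩, ?_, ?_⟩, by omega⟩
        · simp only [List.tail_cons, List.headI_cons] at hokw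
          rw [hok u y x (List.mem_of_getElem? h1)] at hokw
          rwa [show τ + 1 - (delay u + i) = d + 1 by omega] at hokw
        · intro d' hd' hv
          exact hns d' ⟨u, i, x, d', h1, rfl, hv, by omega⟩
      · rintro ⟨u, i, x, d, h1, rfl, h3, h4⟩
        obtain ⟨e, rfl⟩ : ∃ e, d = e + 1 := ⟨d - 1, by have := h3.1; omega⟩
        obtain ⟨⟨z, hz, hzy⟩, ho, hnv⟩ := visits_succ.1 h3
        refine ⟨⟨z, hzy, (hmem _ _).2 ⟨u, i, x, e, h1, rfl, hz, by omega⟩⟩, ?_, ?_⟩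
        · simp only [List.tail_cons, List.headI_cons]
          rw [hok u y x (List.mem_of_getElem? h1)]
          rwa [show τ + 1 - (delay u + i) = e + 1 by omega]
        · rintro d' ⟨u', i', x', d'', h1', heq, h3', h4'⟩
          simp only [Prod.mk.injEq, List.cons.injEq] at heq
          obtain ⟨⟨heq, rfl⟩, rfl⟩ := heq
          obtain rfl := hinj _ _ _ (List.mem_of_getElem? h1) (List.mem_of_getElem? h1')
          exact hnv d' (by omega) h3'
    refine (Runs.ret _).congr (fun v => rfl) rfl fun y => ?_
    rw [hf y]
    refine Prod.ext rfl ?_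
    ext ⟨tk, d⟩
    simp only [Set.mem_union, Set.mem_ofPred_eq, mem_freshFinset]
    constructor
    · rintro (⟨u, i, x, d', h1, heq, h3, h4⟩ | ⟨⟨u, i, x, d', h1, rfl, h3, h4⟩, rfl⟩)
      · exact ⟨u, i, x, d', h1, heq, h3, by omega⟩
      · refine ⟨u, i, x, d', h1, ?_, h3, by omega⟩
        simp only [List.headI_cons, Prod.mk.injEq, true_and]
        omega
    · rintro ⟨u, i, x, d', h1, heq, h3, h4⟩
      simp only [Prod.mk.injEq] at heq
      obtain ⟨rfl, rfl⟩ := heq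
      rcases Nat.lt_or_ge τ (delay u + i + d) with h5 | h5
      · right
        refine ⟨⟨u, i, x, d, h1, rfl, h3, by omega⟩, ?_⟩
        simp only [List.headI_cons]
        omega
      · exact Or.inl ⟨u, i, x, d, h1, rfl, h3, h5⟩

/-- The items that arrive at `y`, with the lengths of their ways. -/
def exploreResult (E : V → V → Prop) (items : V → List (List ℕ)) (ok : V → V → ℕ → Prop) (y : V) :
    Set (List ℕ × ℕ) :=
  {a | ∃ v, a.1 ∈ items v ∧ Visits E v (ok v) a.2 y}

/-- If no node is ever overloaded, the simultaneous explorations behave as if each of them were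
alone. -/
theorem runs_explore [Fintype V] (hE : ∀ u v, E u v → N.comm.Adj u v)
    {dir : V → ℕ → Prop} (hdir : ∀ v (p : Fin (N.deg v)), dir v p ↔ E v (N.neighbor v p))
    {okw : V → List ℕ → ℕ → Prop} (hok : ∀ v y, ∀ x ∈ items v, ∀ d, okw y x d ↔ ok v y d)
    (hinj : ∀ v v', ∀ x ∈ items v, x ∈ items v' → v = v')
    {L q T : ℕ} (hw : ∀ v, ∀ x ∈ items v, ∀ a ∈ x, a < 2 ^ w)
    (hq : ∀ v, ∀ x ∈ items v, x.length + 1 ≤ q)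
    (hdelay : ∀ v, ∀ i < (items v).length, delay v + i < 2 ^ w)
    (hT : ∀ v, ∀ i < (items v).length, ∀ d y, ok v y d → delay v + i + d ≤ T)
    (hload : ∀ τ y, (loadSet E (fun v => (items v).length) delay ok τ y).card ≤ L) :
    Runs N w (fun v => Proto.explore (N.deg v) (dir v) (items v) (delay v) (okw v) L q T)
      (T * ((L + 1) * q))
      (exploreResult E items ok) := by
  have key := Runs.loop (N := N) (w := w)
    (body := fun v => Proto.exploreStep (N.deg v) (dir v) (items v) (delay v) (okw v) L q)
    (fun τ v => (freshFinset E items delay ok τ v, seenTokens E items delay ok τ v)) T 0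
    (fun τ _ _ => runs_exploreStep hE hdir hok hinj hw hq hdelay hload τ)
  have h0 : ∀ v, (freshFinset E items delay ok 0 v, seenTokens E items delay ok 0 v) = (∅, ∅) := by
    intro v
    refine Prod.ext ?_ ?_
    · ext tk
      simp only [mem_freshFinset, Finset.notMem_empty, iff_false]
      rintro ⟨u, i, x, d, -, -, h, h'⟩
      have := h.1
      omega
    · ext tk
      simp only [Set.mem_empty_iff_false, iff_false]
      rintro ⟨u, i, x, d, -, -, h, h'⟩
      have := h.1
      omega
  simp only [h0, zero_add] at key
  refine (key.bind (t' := 0) (f := fun _ s => .ret {a | ∃ t, (t :: a.1, a.2) ∈ s.2})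
    (Runs.ret _)).congr (fun v => rfl) rfl fun y => ?_
  ext ⟨x, d⟩
  simp only [exploreResult, Set.mem_ofPred_eq]
  constructor
  · rintro ⟨t, v, i, x', d', h1, heq, h3, h4⟩
    simp only [Prod.mk.injEq, List.cons.injEq] at heq
    obtain ⟨⟨-, rfl⟩, rfl⟩ := heq
    exact ⟨v, List.mem_of_getElem? h1, h3⟩
  · rintro ⟨v, hx, h⟩
    obtain ⟨i, hi, rfl⟩ := List.getElem_of_mem hx
    exact ⟨delay v + i, v, i, _, d, by simp [hi], rfl, h, hT v i hi d y h.accepted⟩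

end Explore

/-! ## Minimum of the values of all nodes -/

/-- The value that an optional number stands for; the absent number stands for infinity. -/
def Option.toENatTop (o : Option ℕ) : ℕ∞ := o.elim ⊤ fun m => m

/-- The nodes repeatedly replace their values by the minimum over the neighbourhood. -/
noncomputable def Proto.minFlood (deg T : ℕ) (x : ℕ∞) : Proto ℕ∞ :=
  Proto.loop (fun _ m =>
    (Proto.exchangeWord fun _ => if m = ⊤ then none else some m.toNat).bind fun r =>
      .ret (min m (⨅ p : Fin deg, (r p).toENatTop))) T 0 x

namespace DirectedNetwork

variable {V : Type*} (N : DirectedNetwork V)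

/-- The values of the nodes after `τ` rounds of `Proto.minFlood`. -/
noncomputable def flood (x : V → ℕ∞) : ℕ → V → ℕ∞
  | 0 => x
  | τ + 1 => fun v => min (flood x τ v) (⨅ p : Fin (N.deg v), flood x τ (N.neighbor v p))

variable {N}

theorem flood_eq_or (x : V → ℕ∞) (τ : ℕ) (v : V) :
    N.flood x τ v = ⊤ ∨ ∃ u, N.flood x τ v = x u := by
  induction τ generalizing v with
  | zero => exact Or.inr ⟨v, rfl⟩
  | succ τ ih =>
    simp only [flood]
    rcases min_choice (N.flood x τ v) (⨅ p : Fin (N.deg v), N.flood x τ (N.neighbor v p)) with h | h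
    · rw [h]; exact ih v
    · rw [h]
      rcases isEmpty_or_nonempty (Fin (N.deg v)) with he | he
      · left; exact iInf_of_empty _
      · obtain ⟨p, hp⟩ := exists_eq_ciInf_of_finite (f := fun p => N.flood x τ (N.neighbor v p))
        rw [← hp]
        exact ih _

theorem iInf_le_flood (x : V → ℕ∞) (τ : ℕ) (v : V) : ⨅ u, x u ≤ N.flood x τ v := by
  rcases N.flood_eq_or x τ v with h | ⟨u, h⟩
  · rw [h]; exact le_top
  · rw [h]; exact iInf_le x u

theorem flood_le (x : V → ℕ∞) {τ d : ℕ} (hd : d ≤ τ) {u v : V} (h : Reaches N.comm.Adj d u v) :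
    N.flood x τ v ≤ x u := by
  induction τ generalizing d v with
  | zero =>
    obtain rfl : d = 0 := by omega
    cases h
    exact le_rfl
  | succ τ ih =>
    rw [flood]
    cases d with
    | zero => exact (min_le_left _ _).trans (ih (Nat.zero_le _) h)
    | succ d =>
      obtain ⟨z, hz, hzv⟩ := h
      obtain ⟨p, rfl⟩ := N.exists_neighbor_eq hzv.symm
      exact ((min_le_right _ _).trans (iInf_le _ p)).trans (ih (by omega) hz)

theorem _root_.runs_minFlood {w : ℕ} (x : V → ℕ∞) (hx : ∀ v, ∀ m : ℕ, x v = m → m < 2 ^ w) (T : ℕ)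
    (hT : ∀ u v, ∃ d ≤ T, Reaches N.comm.Adj d u v) :
    Runs N w (fun v => Proto.minFlood (N.deg v) T (x v)) T (fun _ => ⨅ u, x u) := by
  have key := Runs.loop (N := N) (w := w) (t := 1) (body := fun v _ m =>
    (Proto.exchangeWord fun _ => if m = ⊤ then none else some m.toNat).bind fun r =>
      .ret (min m (⨅ p : Fin (N.deg v), (r p).toENatTop))) (N.flood x) T 0 ?_
  · refine key.congr (fun v => rfl) (by simp) fun v => ?_
    rw [zero_add]
    refine le_antisymm (le_iInf fun u => ?_) (iInf_le_flood x T v)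
    obtain ⟨d, hd, h⟩ := hT u v
    exact flood_le x hd h
  · intro τ _ _
    refine (runs_exchangeWord (fun v _ => if N.flood x τ v = ⊤ then none else
      some (N.flood x τ v).toNat) ?_).bind (t' := 0) ?_
    · intro v _ m hm
      split_ifs at hm with h
      obtain ⟨u, hu⟩ := (N.flood_eq_or x τ v).resolve_left h
      cases hm
      exact hx u _ (by rw [← hu, ENat.natCast_toNat h])
    · refine (Runs.ret _).congr (fun v => rfl) rfl fun v => ?_
      rw [flood]
      congr 1
      refine iInf_congr fun (p : Fin (N.deg v)) => ?_
      rw [DirectedNetwork.deliver, dif_pos p.2]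
      split_ifs with h
      · rw [h]; rfl
      · exact ENat.natCast_toNat h

theorem exists_reaches_comm [Finite V] (u v : V) :
    ∃ d ≤ N.hopDiam, Reaches N.comm.Adj d u v := by
  have hc : N.comm.Connected := N.connected
  have : Nonempty V := ⟨u⟩
  refine ⟨N.comm.dist u v, SimpleGraph.dist_le_diam
    (SimpleGraph.connected_iff_ediam_ne_top.1 hc), ?_⟩
  obtain ⟨p, hp⟩ := hc.exists_walk_length_eq_dist v u
  rw [SimpleGraph.dist_comm, ← hp]
  clear hp
  induction p with
  | nil => rfl
  | cons h p ih => exact ⟨_, ih, h.symm⟩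

end DirectedNetwork

/-! ## Rare events on finite product spaces -/

section Rare

/-- The event `E` has probability at most `ε` under the uniform distribution. -/
def Rare {Ω : Type*} (E : Ω → Prop) (ε : ℝ) : Prop :=
  ({x | E x}.ncard : ℝ) ≤ ε * Nat.card Ω

theorem rare_iff {Ω : Type*} [Fintype Ω] {E : Ω → Prop} [DecidablePred E] {ε : ℝ} :
    Rare E ε ↔ ((Finset.univ.filter E).card : ℝ) ≤ ε * Fintype.card Ω := by
  rw [Rare, Nat.card_eq_fintype_card, Set.ncard_eq_toFinset_card']
  simp

variable {Ω : Type*} [Finite Ω] {E F : Ω → Prop} {ε δ : ℝ}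

theorem Rare.mono (h : Rare F δ) (hEF : ∀ x, E x → F x) (hδ : δ ≤ ε) : Rare E ε := by
  classical
  have := Fintype.ofFinite Ω
  rw [rare_iff] at *
  refine le_trans ?_ (h.trans (mul_le_mul_of_nonneg_right hδ (Nat.cast_nonneg _)))
  exact_mod_cast Finset.card_le_card (Finset.monotone_filter_right _ fun x _ => hEF x)

theorem rare_false (hε : 0 ≤ ε) (h : ∀ x, ¬ E x) : Rare E ε := by
  classical
  have := Fintype.ofFinite Ω
  rw [rare_iff]
  rw [Finset.filter_false_of_mem (fun x _ => h x)]
  simp only [Finset.card_empty, Nat.cast_zero]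
  positivity

theorem rare_one (hε : 1 ≤ ε) : Rare E ε := by
  classical
  have := Fintype.ofFinite Ω
  rw [rare_iff]
  refine le_trans (b := (Fintype.card Ω : ℝ)) ?_ (le_mul_of_one_le_left (Nat.cast_nonneg _) hε)
  exact_mod_cast Finset.card_le_univ _

theorem Rare.or (h : Rare E ε) (h' : Rare F δ) : Rare (fun x => E x ∨ F x) (ε + δ) := by
  classical
  have := Fintype.ofFinite Ω
  rw [rare_iff] at *
  rw [Finset.filter_or, add_mul]
  refine le_trans ?_ (add_le_add h h')
  exact_mod_cast Finset.card_union_le _ _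

theorem Rare.exists {ι : Type*} [Fintype ι] {E : ι → Ω → Prop} (h : ∀ i, Rare (E i) ε) :
    Rare (fun x => ∃ i, E i x) (Fintype.card ι * ε) := by
  classical
  have := Fintype.ofFinite Ω
  simp only [rare_iff] at *
  have : Finset.univ.filter (fun x => ∃ i, E i x) =
      Finset.univ.biUnion fun i => Finset.univ.filter (E i) := by
    ext x; simp
  rw [this]
  calc ((Finset.univ.biUnion fun i => Finset.univ.filter (E i)).card : ℝ)
      ≤ ∑ i, ((Finset.univ.filter (E i)).card : ℝ) := by exact_mod_cast Finset.card_biUnion_le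
    _ ≤ ∑ _i : ι, ε * Fintype.card Ω := Finset.sum_le_sum fun i _ => h i
    _ = _ := by simp; ring

theorem Rare.comp {Ω' : Type*} (e : Ω' ≃ Ω) (h : Rare E ε) :
    Rare (fun x => E (e x)) ε := by
  classical
  have := Fintype.ofFinite Ω
  have := Fintype.ofEquiv Ω e.symm
  rw [rare_iff] at *
  rw [Fintype.card_congr e]
  refine le_of_eq_of_le ?_ h
  norm_cast
  refine Finset.card_bij (fun x _ => e x) (by simp) (fun _ _ _ _ h => e.injective h) ?_
  intro y hy
  exact ⟨e.symm y, by simpa using hy, by simp⟩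

/-- If an event is rare however all coordinates but one are fixed, then it is rare. -/
theorem Rare.of_update {ι : Type*} [Fintype ι] [DecidableEq ι] (i : ι) {E : (ι → Ω) → Prop}
    (h : ∀ u, Rare (fun x => E (Function.update u i x)) ε) : Rare E ε := by
  classical
  have := Fintype.ofFinite Ω
  rcases isEmpty_or_nonempty Ω with hΩ | hΩ
  · have : IsEmpty (ι → Ω) := ⟨fun u => hΩ.elim (u i)⟩
    simp [rare_iff]
  simp only [rare_iff] at *
  -- Swapping the i-th coordinate with the additional value is an involution of the pairs, so
  -- resampling that coordinate preserves the count.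
  have h1 : ∑ a : (ι → Ω) × Ω, (if E (Function.update a.1 i a.2) then (1 : ℝ) else 0) =
      ∑ a : (ι → Ω) × Ω, (if E a.1 then (1 : ℝ) else 0) := by
    refine Finset.sum_bij' (fun a _ => (Function.update a.1 i a.2, a.1 i))
      (fun a _ => (Function.update a.1 i a.2, a.1 i)) (by simp) (by simp) ?_ ?_ ?_ <;> simp
  rw [Fintype.sum_prod_type, Fintype.sum_prod_type] at h1
  have h0 : ∑ u : ι → Ω, ∑ _x : Ω, (if E u then (1 : ℝ) else 0) =
      Fintype.card Ω * (Finset.univ.filter E).card := by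
    rw [Finset.sum_comm]
    simp
  rw [h0] at h1
  simp only [Finset.sum_boole] at h1
  have h2 : (Fintype.card Ω : ℝ) * ((Finset.univ.filter E).card : ℝ) ≤
      Fintype.card (ι → Ω) * (ε * Fintype.card Ω) := by
    rw [← h1]
    refine (Finset.sum_le_sum fun u _ => h u).trans (le_of_eq ?_)
    simp
  have h3 : (0 : ℝ) < Fintype.card Ω := by exact_mod_cast Fintype.card_pos
  refine le_of_mul_le_mul_left (h2.trans (le_of_eq ?_)) h3
  ring

theorem sum_pi_prod {V Ω : Type*} [Fintype V] [DecidableEq V] [Fintype Ω] (f : V → Ω → ℝ) :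
    ∑ ω : V → Ω, ∏ v, f v (ω v) = ∏ v, ∑ a, f v a := by
  rw [Finset.prod_univ_sum, Fintype.piFinset_univ]

open Classical in
/-- An upper tail bound for the number of successes in independent trials. -/
theorem rare_card_ge {V Ω : Type*} [Fintype V] [Fintype Ω] [Nonempty Ω] (P : V → Ω → Prop) {μ : ℝ}
    (hμ : ∑ v, ((Finset.univ.filter (P v)).card : ℝ) ≤ μ * Fintype.card Ω) (K : ℕ) :
    Rare (fun ω : V → Ω => K ≤ (Finset.univ.filter fun v => P v (ω v)).card)
      (Real.exp μ / 2 ^ K) := by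
  have h0 : (0 : ℝ) < Fintype.card Ω := by exact_mod_cast Fintype.card_pos
  -- Exponential moment with base 2: the mean of 2 ^ X is the product of the factors 1 + p_v, hence
  -- at most exp μ. Markov's inequality then gives the tail.
  have h1 : ∑ ω : V → Ω, (2 : ℝ) ^ (Finset.univ.filter fun v => P v (ω v)).card ≤
      Real.exp μ * Fintype.card (V → Ω) := by
    have : ∀ ω : V → Ω, (2 : ℝ) ^ (Finset.univ.filter fun v => P v (ω v)).card =
        ∏ v, if P v (ω v) then 2 else 1 := by
      intro ω
      rw [Finset.prod_ite]
      simp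
    simp only [this]
    rw [sum_pi_prod (fun v a => if P v a then (2 : ℝ) else 1), Fintype.card_fun, Nat.cast_pow]
    calc ∏ v, ∑ a, (if P v a then (2 : ℝ) else 1)
        ≤ ∏ v : V, (Fintype.card Ω * Real.exp ((Finset.univ.filter (P v)).card / Fintype.card Ω)) := by
          refine Finset.prod_le_prod (fun v _ => Finset.sum_nonneg fun a _ => by
            split_ifs <;> norm_num) fun v _ => ?_
          have e1 : ∑ a, (if P v a then (2 : ℝ) else 1) =
              Fintype.card Ω + (Finset.univ.filter (P v)).card := by
            have : ∀ a, (if P v a then (2 : ℝ) else 1) = 1 + if P v a then 1 else 0 := by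
              intro a; split_ifs <;> norm_num
            simp only [this, Finset.sum_add_distrib, Finset.sum_boole]
            simp
          rw [e1]
          have := Real.add_one_le_exp (((Finset.univ.filter (P v)).card : ℝ) / Fintype.card Ω)
          calc _ = (Fintype.card Ω : ℝ) * ((Finset.univ.filter (P v)).card / Fintype.card Ω + 1) := by
                field_simp; ring
            _ ≤ _ := mul_le_mul_of_nonneg_left this h0.le
      _ = Fintype.card Ω ^ Fintype.card V *
            Real.exp (∑ v, ((Finset.univ.filter (P v)).card : ℝ) / Fintype.card Ω) := by
          rw [Finset.prod_mul_distrib, Real.exp_sum]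
          simp
      _ ≤ Fintype.card Ω ^ Fintype.card V * Real.exp μ := by
          gcongr
          rw [← Finset.sum_div, div_le_iff₀ h0]
          exact hμ
      _ = _ := mul_comm _ _
  rw [rare_iff, div_mul_eq_mul_div, le_div_iff₀ (by positivity)]
  refine le_trans ?_ h1
  rw [← Finset.sum_filter_add_sum_filter_not Finset.univ
    (fun ω : V → Ω => K ≤ (Finset.univ.filter fun v => P v (ω v)).card)]
  refine le_add_of_le_of_nonneg ?_ (Finset.sum_nonneg fun _ _ => by positivity)
  rw [← nsmul_eq_mul]
  refine Finset.card_nsmul_le_sum _ _ _ fun ω hω => ?_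
  exact pow_le_pow_right₀ (by norm_num) (Finset.mem_filter.1 hω).2

/-- A version of `rare_card_ge` for sets. -/
theorem rare_ncard_ge {V Ω : Type*} [Fintype V] [Fintype Ω] [Nonempty Ω] (P : V → Ω → Prop) {μ : ℝ}
    (hμ : ∑ v, ({a | P v a}.ncard : ℝ) ≤ μ * Fintype.card Ω) (K : ℕ) :
    Rare (fun ω : V → Ω => K ≤ {v | P v (ω v)}.ncard) (Real.exp μ / 2 ^ K) := by
  classical
  simp only [Set.ncard_eq_toFinset_card', Set.toFinset_ofPred] at hμ ⊢
  convert rare_card_ge P (by convert hμ) K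

/-- The probability that a random sample misses a set. -/
theorem rare_miss {V : Type*} [Fintype V] {M : ℕ} (hM : 0 < M) (m : ℕ) (W : Finset V) :
    Rare (fun ω : V → Fin M => ∀ v ∈ W, m ≤ (ω v : ℕ)) (Real.exp (-(m * W.card / M : ℝ))) := by
  classical
  rcases W.eq_empty_or_nonempty with rfl | ⟨v₀, hv₀⟩
  · exact rare_one (by simp)
  rcases Nat.lt_or_ge M m with hm | hm
  · refine rare_false (Real.exp_pos _).le fun ω h => ?_
    have := h v₀ hv₀
    have := (ω v₀).2
    omega
  have h0 : (0 : ℝ) < M := by exact_mod_cast hM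
  rw [rare_iff]
  have h1 : ((Finset.univ.filter fun ω : V → Fin M => ∀ v ∈ W, m ≤ (ω v : ℕ)).card : ℝ) =
      ∑ ω : V → Fin M, ∏ v, if v ∈ W → m ≤ (ω v : ℕ) then (1 : ℝ) else 0 := by
    rw [← Finset.sum_boole]
    refine Finset.sum_congr rfl fun ω _ => ?_
    rw [Finset.prod_boole]
    simp
  rw [h1, sum_pi_prod (fun v (a : Fin M) => if v ∈ W → m ≤ (a : ℕ) then (1 : ℝ) else 0)]
  have h2 : ∀ v, ∑ a : Fin M, (if v ∈ W → m ≤ (a : ℕ) then (1 : ℝ) else 0) ≤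
      M * if v ∈ W then Real.exp (-(m / M)) else 1 := by
    intro v
    by_cases hv : v ∈ W
    · simp only [hv, true_imp_iff, Finset.sum_boole, if_true]
      have hc : (Finset.univ.filter fun a : Fin M => m ≤ (a : ℕ)).card = M - m := by
        have := Fin.card_filter_val_lt (n := M) (m := m)
        have h3 := Finset.card_filter_add_card_filter_not (s := (Finset.univ : Finset (Fin M)))
          (fun a : Fin M => (a : ℕ) < m)
        simp only [not_lt, Finset.card_univ, Fintype.card_fin] at h3
        omega
      rw [hc, Nat.cast_sub hm]
      have := Real.add_one_le_exp (-(m / M : ℝ))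
      calc (M : ℝ) - m = M * (-(m / M) + 1) := by field_simp; ring
        _ ≤ _ := mul_le_mul_of_nonneg_left this h0.le
    · simp [hv]
  calc _ ≤ ∏ v, ((M : ℝ) * if v ∈ W then Real.exp (-(m / M)) else 1) :=
        Finset.prod_le_prod (fun v _ => Finset.sum_nonneg fun a _ => by
            split_ifs <;> norm_num) fun v _ => h2 v
    _ = _ := by
        rw [Finset.prod_mul_distrib, Finset.prod_ite_mem, Finset.univ_inter, Finset.prod_const,
          Finset.prod_const, ← Real.exp_nat_mul, Fintype.card_fun, Fintype.card_fin, mul_comm]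
        simp only [Finset.card_univ, Nat.cast_pow]
        congr 2
        ring

end Rare

/-! ## Coins -/

/-- A sequence of `P * b` coins, read as `P` numbers with `b` bits. -/
noncomputable def coinEquiv (P b : ℕ) : (Fin (P * b) → Bool) ≃ (Fin P → Fin (2 ^ b)) :=
  ((finProdFinEquiv.arrowCongr (Equiv.refl Bool)).symm.trans (Equiv.curry _ _ _)).trans
    ((Equiv.refl (Fin P)).arrowCongr (Fintype.equivFinOfCardEq (by simp)))

/-- Regrouping the coins by stage instead of by node is a bijection, so counting bounds for the
stages are bounds for the probability in the model. -/
theorem prob_le_of_rare {V : Type*} [Fintype V] (A : CongestAlgorithm) {P b : ℕ}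
    (hc : A.coins (Fintype.card V) = P * b) {F : (Fin P → V → Fin (2 ^ b)) → Prop} {ε : ℝ}
    (hF : Rare F ε) (hε : 0 ≤ ε) (E : Set (A.Coins V))
    (h : ∀ ω ∈ E, F fun i v => coinEquiv P b (fun a => ω v (Fin.cast hc.symm a)) i) :
    A.prob V E ≤ ENNReal.ofReal ε := by
  classical
  let e : A.Coins V ≃ (Fin P → V → Fin (2 ^ b)) :=
    (((Equiv.refl V).arrowCongr (((finCongr hc).arrowCongr (Equiv.refl Bool)).trans
      (coinEquiv P b)))).trans (Equiv.piComm _)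
  have h1 : Rare (fun ω => ω ∈ E) ε := (hF.comp e).mono (fun ω hω => h ω hω) le_rfl
  rw [rare_iff] at h1
  unfold CongestAlgorithm.prob
  rw [PMF.toOuterMeasure_uniformOfFintype_apply, ENNReal.div_le_iff (by simp) (by simp)]
  have h2 : (Fintype.card E : ℝ) ≤ ε * Fintype.card (A.Coins V) := by
    refine le_of_eq_of_le ?_ h1
    rw [Fintype.card_subtype]
  calc (Fintype.card E : ENNReal) = ENNReal.ofReal (Fintype.card E : ℝ) := by simp
    _ ≤ ENNReal.ofReal (ε * Fintype.card (A.Coins V)) := ENNReal.ofReal_le_ofReal h2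
    _ = _ := by rw [ENNReal.ofReal_mul hε, ENNReal.ofReal_natCast]

/-! ## Pruned explorations -/

/-- A total relation on a finite set has a dominating set of logarithmic size. -/
theorem exists_dominating {α : Type*} [DecidableEq α] (R : α → α → Prop)
    (hR : ∀ x y, R x y ∨ R y x) (k : ℕ) (A : Finset α) (hA : A.card < 2 ^ k) :
    ∃ B : List α, B.length ≤ k ∧ (∀ x ∈ B, x ∈ A) ∧ ∀ y ∈ A, ∃ x ∈ B, R x y := by
  classical
  induction k generalizing A with
  | zero =>
    obtain rfl : A = ∅ := by simpa using hA
    exact ⟨[], by simp⟩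
  | succ k ih =>
    rcases A.eq_empty_or_nonempty with rfl | hne
    · exact ⟨[], by simp⟩
    -- By totality, at most one orientation of each pair of distinct elements fails and no diagonal
    -- pair does. Fewer than half of all ordered pairs fail, so some x leaves fewer than half of A
    -- undominated.
    have hex : ∃ x ∈ A, 2 * (A.filter fun y => ¬ R x y).card < A.card := by
      by_contra hcon
      push Not at hcon
      let T := (A ×ˢ A).filter fun p : α × α => ¬ R p.1 p.2
      have h1 : T.card = ∑ x ∈ A, (A.filter fun y => ¬ R x y).card := by
        simp only [T, Finset.card_filter, Finset.sum_product]
      have h2 : A.card * A.card ≤ 2 * T.card := by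
        rw [h1, Finset.mul_sum, ← smul_eq_mul]
        exact Finset.card_nsmul_le_sum _ _ _ hcon
      have h3 : Disjoint T (T.image Prod.swap) := by
        rw [Finset.disjoint_left]
        rintro ⟨x, y⟩ hx hy
        simp only [T, Finset.mem_image, Finset.mem_filter, Prod.exists, Prod.swap_prod_mk,
          Prod.mk.injEq] at hx hy
        obtain ⟨a, b, ⟨-, h⟩, rfl, rfl⟩ := hy
        exact (hR a b).elim h hx.2
      have h4 : T ∪ T.image Prod.swap ⊆ A.offDiag := by
        intro p hp
        simp only [T, Finset.mem_union, Finset.mem_image, Finset.mem_filter, Finset.mem_product,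
          Finset.mem_offDiag] at hp ⊢
        rcases hp with ⟨⟨h, h'⟩, hn⟩ | ⟨q, ⟨⟨h, h'⟩, hn⟩, rfl⟩
        · exact ⟨h, h', fun e => by rw [e] at hn; exact hn ((hR _ _).elim id id)⟩
        · exact ⟨h', h, fun e => by
            simp only [Prod.fst_swap, Prod.snd_swap] at e
            rw [e] at hn; exact hn ((hR _ _).elim id id)⟩
      have h5 := Finset.card_le_card h4
      rw [Finset.card_union_of_disjoint h3, Finset.card_image_of_injective _ Prod.swap_injective,
        Finset.offDiag_card] at h5
      have h6 := hne.card_pos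
      have h7 : 0 < A.card * A.card := Nat.mul_pos h6 h6
      omega
    obtain ⟨x, hx, hlt⟩ := hex
    obtain ⟨B, hB, hBA, hdom⟩ := ih (A.filter fun y => ¬ R x y) (by rw [pow_succ] at hA; omega)
    refine ⟨x :: B, by simpa using hB, ?_, fun y hy => ?_⟩
    · intro z hz
      rcases List.mem_cons.1 hz with rfl | hz
      · exact hx
      · exact Finset.mem_of_mem_filter _ (hBA z hz)
    · by_cases hxy : R x y
      · exact ⟨x, List.mem_cons_self, hxy⟩
      · obtain ⟨z, hz, hzy⟩ := hdom y (Finset.mem_filter.2 ⟨hy, hxy⟩)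
        exact ⟨z, List.mem_cons_of_mem _ hz, hzy⟩

section Prune

variable {V : Type*} {E : V → V → Prop} {H h : ℕ}

/-- The pivot `t` prunes `y` from the exploration from `v`: if `v` and `y` lie on a common short
cycle, then there is a closed walk through `t` that is at most twice as long. -/
def Prunes (E : V → V → Prop) (H : ℕ) (v t y : V) : Prop :=
  2 * truncDist E H v t + truncDist E H t y ≤ truncDist E H y t + 2 * truncDist E H v y

/-- The nodes close to `v` that are not pruned by any of the pivots `R`. -/
def survivors (E : V → V → Prop) (H : ℕ) (v : V) (R : List V) : Set V :=
  {y | y ≠ v ∧ truncDist E H v y < H ∧ ∀ t ∈ R, ¬ Prunes E H v t y}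

/-- The test by which the node `y` accepts the exploration from `v` at distance `d`. -/
def exploreTest (E : V → V → Prop) (H h : ℕ) (piv : V → List V) (blk : Set V) (v y : V) (d : ℕ) :
    Prop :=
  d ≤ h ∧ (y = v ∨ y ∉ blk ∧ ∀ t ∈ piv v,
    truncDist E H y t + 2 * d < 2 * truncDist E H v t + truncDist E H t y)

variable {piv : V → List V} {blk : Set V} {v y : V} {d : ℕ}

theorem exploreTest_mono (v y : V) (d d' : ℕ) (hd : d' ≤ d)
    (ht : exploreTest E H h piv blk v y d) : exploreTest E H h piv blk v y d' := by
  refine ⟨hd.trans ht.1, ht.2.imp_right fun h => ⟨h.1, fun t ht => ?_⟩⟩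
  have := h.2 t ht
  omega

/-- The test uses the step of arrival in place of the true distance. As the former is never smaller,
passing the test at a late arrival still implies that no pivot prunes `y`. -/
theorem Visits.eq_or_mem_survivors (hhH : h < H)
    (hv : Visits E v (exploreTest E H h piv blk v) d y) :
    y = v ∨ y ∈ survivors E H v (piv v) := by
  by_cases hyv : y = v
  · exact Or.inl hyv
  have h1 := hv.accepted
  have h2 : truncDist E H v y ≤ d := truncDist_le_of_reaches hv.reaches
  refine Or.inr ⟨hyv, h2.trans_lt (h1.1.trans_lt hhH), fun t ht => ?_⟩
  have := (h1.2.resolve_left hyv).2 t ht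
  unfold Prunes
  omega

/-- Together with the fact that a sample hits all large survivor sets, this forces the survivor set
to be small. -/
theorem disjoint_survivors {S : Set V}
    (hpiv : ∀ s ∈ S, s ≠ v → truncDist E H v s < H → ∃ t ∈ piv v, Prunes E H v t s) :
    ∀ s ∈ S, s ∉ survivors E H v (piv v) := by
  rintro s hs ⟨h1, h2, h3⟩
  obtain ⟨t, ht, htp⟩ := hpiv s hs h1 h2
  exact h3 t ht htp

/-- If the exploration from a node of a shortest cycle is not blocked on the cycle, then it finds
the cycle, or a pivot lies on a closed walk that is at most twice as long. -/
theorem exists_visits_of_cycle {g : ℕ} {c : ℕ → V} (hg : 1 ≤ g) (hgh : g < h) (hH : 2 * h ≤ H)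
    (hc : ∀ i, E (c i) (c (i + 1))) (hper : ∀ i, c (i + g) = c i) {i : ℕ}
    (hblk : ∀ j, c j ∉ blk) :
    (∃ d ≤ g, Visits E (c i) (exploreTest E H h piv blk (c i)) d (c i)) ∨
      ∃ t ∈ piv (c i), ∃ d ≤ 2 * g, Visits E t (fun _ e => e ≤ H) d t := by
  by_cases hall : ∀ k, 1 ≤ k → k < g → ∀ t ∈ piv (c i),
      truncDist E H (c (i + k)) t + 2 * k <
        2 * truncDist E H (c i) t + truncDist E H t (c (i + k))
  · left
    have := exists_visits_of_path (E := E) (v := c i) (ok := exploreTest E H h piv blk (c i))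
      (fun y d d' => exploreTest_mono (c i) y d d') (p := fun k => c (i + k)) (m := g) rfl
      (fun k _ => hc _) ?_ hg
    · simpa only [hper] using this
    · intro k hk1 hkg
      refine ⟨by omega, ?_⟩
      rcases Nat.lt_or_ge k g with hk | hk
      · exact Or.inr ⟨hblk _, hall k hk1 hk⟩
      -- The path ends at the source itself, which accepts its own exploration without any test of
      -- pivots or blocking.
      · obtain rfl : k = g := by omega
        exact Or.inl (hper i)
  · right
    push Not at hall
    obtain ⟨k, hk1, hkg, t, ht, hle⟩ := hall
    refine ⟨t, ht, ?_⟩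
    have hback : Reaches E (g - k) (c (i + k)) (c i) := by
      have := reaches_of_path hc (i + k) (g - k)
      rwa [show i + k + (g - k) = i + g by omega, hper] at this
    have h1 := truncDist_le_of_reaches (H := H) hback
    -- Put v = c i and y = c (i + k). The failed test says d(t,y) + 2d(v,t) ≤ d(y,t) + 2k, and
    -- d(y,t) ≤ (g - k) + d(v,t); hence d(t,y) + d(v,t) ≤ g + k. Closing up by the g - k edges from
    -- y to v gives length at most 2g, and the same bound keeps both distances below the cutoff, so
    -- they belong to actual walks.
    have h2 := truncDist_triangle (E := E) (H := H) (c (i + k)) (c i) t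
    have h3 : Reaches E _ (c i) t := reaches_truncDist (H := H) (by omega)
    have h4 : Reaches E _ t (c (i + k)) := reaches_truncDist (H := H) (by omega)
    have h5 := (h4.trans hback).trans h3
    obtain ⟨d, hd, hv⟩ := exists_visits_of_reaches (H := H) (by omega) (by omega) h5
    exact ⟨d, by omega, hv⟩

end Prune

/-! ## Closed chains of walks between sampled nodes -/

/-- In the table `X` of triples `[i, j, d]`, which stand for walks of length `d` from `i` to `j`,
there is a chain of total length `d` from `i` to `j`. -/
inductive TableReaches (X : Set (List ℕ)) : ℕ → ℕ → ℕ → Prop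
  | single {i j d : ℕ} : [i, j, d] ∈ X → TableReaches X d i j
  | trans {i j k d e : ℕ} : TableReaches X d i j → TableReaches X e j k → TableReaches X (d + e) i k

/-- The minimum length of a closed chain of the table. -/
noncomputable def tableGirth (X : Set (List ℕ)) : ℕ∞ :=
  ⨅ d ∈ {d : ℕ | ∃ i, TableReaches X d i i}, (d : ℕ∞)

section Table

variable {V : Type*} {E : V → V → Prop} {H : ℕ} {ident : V → ℕ} {S : Set V}

/-- The table of the truncated distances between the nodes of `S`. -/
def walkTable (E : V → V → Prop) (H : ℕ) (ident : V → ℕ) (S : Set V) : Set (List ℕ) :=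
  {x | ∃ t ∈ S, ∃ t' ∈ S, ∃ d, Visits E t (fun _ e => e ≤ H) d t' ∧ x = [ident t, ident t', d]}

theorem TableReaches.exists_reaches (hinj : Function.Injective ident) {d i j : ℕ}
    (h : TableReaches (walkTable E H ident S) d i j) :
    ∃ t t', ident t = i ∧ ident t' = j ∧ 1 ≤ d ∧ Reaches E d t t' := by
  induction h with
  | single h =>
    obtain ⟨t, -, t', -, d, hv, heq⟩ := h
    simp only [List.cons.injEq, and_true] at heq
    obtain ⟨rfl, rfl, rfl⟩ := heq
    exact ⟨t, t', rfl, rfl, hv.1, hv.reaches⟩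
  | trans _ _ ih1 ih2 =>
    obtain ⟨t, t', rfl, h2, h3, h4⟩ := ih1
    obtain ⟨u, u', h1', rfl, h3', h4'⟩ := ih2
    obtain rfl := hinj (h1'.trans h2.symm)
    exact ⟨t, u', rfl, rfl, by omega, h4.trans h4'⟩

theorem le_tableGirth (G : Digraph V) (hinj : Function.Injective ident) :
    directedGirth G ≤ tableGirth (walkTable G.Adj H ident S) := by
  refine le_iInf₂ fun d hd => ?_
  obtain ⟨i, hi⟩ := hd
  obtain ⟨t, t', h1, h2, h3, h4⟩ := hi.exists_reaches hinj
  obtain rfl := hinj (h2.trans h1.symm)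
  exact directedGirth_le_of_reaches G h3 h4

theorem tableGirth_le_of_visits {t : V} (ht : t ∈ S) {d : ℕ}
    (hv : Visits E t (fun _ e => e ≤ H) d t) : tableGirth (walkTable E H ident S) ≤ d :=
  iInf₂_le d ⟨ident t, .single ⟨t, ht, t, ht, d, hv, rfl⟩⟩

/-- If the sample hits every window of a closed walk, then it determines its length. -/
theorem tableGirth_le_of_windows {g w : ℕ} {c : ℕ → V} (hg : 1 ≤ g) (hwH : w ≤ H)
    (hc : ∀ i, E (c i) (c (i + 1))) (hper : ∀ i, c (i + g) = c i)
    (hwin : ∀ i, ∃ j, i < j ∧ j ≤ i + w ∧ c j ∈ S) :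
    tableGirth (walkTable E H ident S) ≤ g := by
  -- Induction on the stretch between two sampled positions. If the next sampled position lies
  -- strictly inside, the stretch splits there; otherwise the stretch is no longer than a window and
  -- is covered by a single entry.
  have key : ∀ e, 1 ≤ e → ∀ i, c i ∈ S → c (i + e) ∈ S →
      ∃ d ≤ e, TableReaches (walkTable E H ident S) d (ident (c i)) (ident (c (i + e))) := by
    intro e
    induction e using Nat.strong_induction_on with
    | _ e ih =>
    intro he i hi hie
    have hsingle : ∀ m, 1 ≤ m → m ≤ w → c (i + m) ∈ S → ∃ d ≤ m,
        TableReaches (walkTable E H ident S) d (ident (c i)) (ident (c (i + m))) := by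
      intro m hm1 hmw hm
      obtain ⟨d, hd, hv⟩ := exists_visits_of_reaches (H := H) hm1 (hmw.trans hwH)
        (reaches_of_path hc i m)
      exact ⟨d, hd, .single ⟨_, hi, _, hm, d, hv, rfl⟩⟩
    obtain ⟨j, hij, hjw, hj⟩ := hwin i
    rcases Nat.lt_or_ge j (i + e) with hlt | hge
    · obtain ⟨m, rfl⟩ : ∃ m, j = i + m := ⟨j - i, by omega⟩
      obtain ⟨d, hd, h1⟩ := hsingle m (by omega) (by omega) hj
      obtain ⟨d', hd', h2⟩ := ih (e - m) (by omega) (by omega) (i + m) hj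
        (by rwa [show i + m + (e - m) = i + e by omega])
      rw [show i + m + (e - m) = i + e by omega] at h2
      exact ⟨d + d', by omega, h1.trans h2⟩
    · exact hsingle e he (by omega) hie
  obtain ⟨i, -, -, hi⟩ := hwin 0
  obtain ⟨d, hd, h⟩ := key g hg i hi (by rwa [hper])
  rw [hper] at h
  exact (iInf₂_le d ⟨_, h⟩).trans (by exact_mod_cast hd)

end Table

/-! ## The node program -/

/-- The parameters of the algorithm for networks of a given size and diameter estimate. -/
structure GirthParams where
  /-- A node is sampled if its first random number is smaller than this threshold. -/
  threshold : ℕ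
  /-- The number of steps of an exploration. -/
  depth : ℕ
  /-- The maximum number of pivots of a node. -/
  pivots : ℕ
  /-- An upper bound of the hop-diameter. -/
  diam : ℕ
  /-- The number of tokens that a node can handle per step. -/
  load : ℕ
  /-- The number of words of a token. -/
  words : ℕ
  /-- The duration of a simultaneous exploration. -/
  time : ℕ
  /-- The number of iterations of the main loop. -/
  iterations : ℕ

namespace GirthParams

/-- The truncation of distances. -/
def cutoff (P : GirthParams) : ℕ := 2 * P.depth

/-- The number of independent random numbers of a node. -/
def stages (P : GirthParams) : ℕ := 5 + 3 * P.iterations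

/-- The duration of the algorithm. -/
def rounds (P : GirthParams) : ℕ :=
  (4 + 2 * P.iterations) * (P.time * ((P.load + 1) * P.words)) + P.diam

end GirthParams

namespace Proto

/-- The truncated distance between the node `own` and the node `i`, according to the result of an
exploration. -/
noncomputable def lookup (H own : ℕ) (X : Set (List ℕ × ℕ)) (i : ℕ) : ℕ :=
  open Classical in if i = own then 0 else sInf {d | ([i], d) ∈ X ∨ d = H}

/-- The truncated distance from `i` to `j`, according to a table. -/
noncomputable def tableDist (H : ℕ) (X : Set (List ℕ)) (i j : ℕ) : ℕ :=
  open Classical in if i = j then 0 else sInf {d | [i, j, d] ∈ X ∨ d = H}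

/-- `B` is a list of at most `k` pivots that prune all sampled nodes reached from `own`. -/
def IsPivotList (k H own : ℕ) (X : Set (List ℕ × ℕ)) (Y : Set (List ℕ)) (B : List ℕ) : Prop :=
  B.length ≤ k ∧ (∀ i ∈ B, i ≠ own ∧ ∃ d, ([i], d) ∈ X) ∧
    ∀ j, j ≠ own → (∃ d, ([j], d) ∈ X) → ∃ i ∈ B,
      2 * lookup H own X i + tableDist H Y i j ≤ tableDist H Y j i + 2 * lookup H own X j

open Classical in
/-- The pivots of a node. -/
noncomputable def pivotIds (k H own : ℕ) (X : Set (List ℕ × ℕ)) (Y : Set (List ℕ)) : List ℕ :=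
  if h : ∃ B, IsPivotList k H own X Y B then h.choose else []

/-- The message with which a node starts its exploration. -/
noncomputable def pivotItem (k H own : ℕ) (X : Set (List ℕ × ℕ)) (Y : Set (List ℕ)) : List ℕ :=
  own :: (pivotIds k H own X Y).flatMap fun i => [i, lookup H own X i]

/-- The consecutive pairs of a list. -/
def pairs : List ℕ → List (ℕ × ℕ)
  | a :: b :: l => (a, b) :: pairs l
  | _ => []

/-- The acceptance test of an exploration, in terms of the knowledge of a node. -/
def wordTest (h H own : ℕ) (F X : Set (List ℕ × ℕ)) (blk : Prop) (x : List ℕ) (d : ℕ) : Prop :=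
  d ≤ h ∧ (x.headI = own ∨ ¬ blk ∧ ∀ a ∈ pairs x.tail,
    lookup H own X a.1 + 2 * d < 2 * a.2 + lookup H own F a.1)

open Classical in
/-- An enumeration of a finite set. -/
noncomputable def listOf (X : Set (List ℕ)) : List (List ℕ) :=
  if h : X.Finite then h.toFinset.toList else []

open Classical in
/-- The minimum of a set of numbers. -/
noncomputable def minOf (X : Set ℕ) : ℕ∞ := if X.Nonempty then (sInf X : ℕ) else ⊤

open Classical in
/-- `[x]` if the condition `p` is satisfied, and the empty list otherwise. -/
noncomputable def itemIf (p : Prop) (x : List ℕ) : List (List ℕ) := if p then [x] else []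

/-- One iteration of the main loop. The state tells whether the node takes part as a source, and
the lengths of the closed walks found so far. -/
noncomputable def girthStep (P : GirthParams) (deg : ℕ) (out : ℕ → Prop) (u : ℕ → ℕ)
    (item : List ℕ) (test : Prop → List ℕ → ℕ → Prop) (j : ℕ) (s : Prop × Set ℕ) :
    Proto (Prop × Set ℕ) :=
  (explore deg out (itemIf (s.1 ∧ u (4 + 3 * j) = 0) item) (u (5 + 3 * j)) (test False)
    P.load P.words P.time).bind fun Y =>
  -- This flag is at once membership in the next active set and the blocking of the second
  -- exploration. It may become true at a node that was not active before.
  let b := (s.1 ∧ u (4 + 3 * j) = 0) ∨ Y.Nonempty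
  (explore deg out (itemIf (s.1 ∧ ¬ b) item) (u (6 + 3 * j)) (test b)
    P.load P.words P.time).bind fun Z =>
  .ret (b, s.2 ∪ {d | (item, d) ∈ Z})

/-- The part of the algorithm that follows the explorations from the sampled nodes. -/
noncomputable def girthMain (P : GirthParams) (deg own : ℕ) (out : ℕ → Prop) (u : ℕ → ℕ)
    (F X : Set (List ℕ × ℕ)) (Y : Set (List ℕ)) : Proto ℕ∞ :=
  let item := pivotItem P.pivots P.cutoff own X Y
  let test := wordTest P.depth P.cutoff own F X
  (loop (girthStep P deg out u item test) P.iterations 0 (True, ∅)).bind fun s =>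
  (explore deg out (itemIf s.1 item) (u (4 + 3 * P.iterations)) (test False)
    P.load P.words P.time).bind fun Z =>
  (minFlood deg P.diam (minOf (s.2 ∪ {d | (item, d) ∈ Z}))).bind fun m =>
  .ret (min m (tableGirth Y))

open Classical in
/-- The program of a node with the random numbers `u`. -/
noncomputable def girthProgram (P : GirthParams) (I : LocalInput) (u : ℕ → ℕ) : Proto ℕ∞ :=
  (explore I.deg (fun p => I.isOut p) (itemIf (u 0 < P.threshold) [I.ident]) (u 1)
    (fun _ d => d ≤ P.cutoff) P.load P.words P.time).bind fun F =>
  (explore I.deg (fun p => I.isIn p) (itemIf (u 0 < P.threshold) [I.ident]) (u 2)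
    (fun _ d => d ≤ P.cutoff) P.load P.words P.time).bind fun X =>
  let items := if u 0 < P.threshold then
    listOf {x | ∃ i d, ([i], d) ∈ F ∧ x = [i, I.ident, d]} else []
  (explore I.deg (fun _ => True) items (u 3) (fun _ d => d ≤ P.diam)
    P.load P.words P.time).bind fun Y =>
  girthMain P I.deg I.ident (fun p => I.isOut p) u F X {x | x ∈ items ∨ ∃ d, (x, d) ∈ Y}

theorem mem_itemIf {p : Prop} {x y : List ℕ} : y ∈ itemIf p x ↔ p ∧ y = x := by
  unfold itemIf
  split_ifs with h <;> simp [h]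

theorem length_itemIf_le {p : Prop} {x : List ℕ} : (itemIf p x).length ≤ 1 := by
  unfold itemIf
  split_ifs <;> simp

theorem mem_listOf {X : Set (List ℕ)} (h : X.Finite) {x : List ℕ} : x ∈ listOf X ↔ x ∈ X := by
  simp [listOf, h]

theorem length_listOf {X : Set (List ℕ)} (h : X.Finite) : (listOf X).length = X.ncard := by
  rw [listOf, dif_pos h, Finset.length_toList, Set.ncard_eq_toFinset_card _ h]

theorem minOf_le {X : Set ℕ} {d : ℕ} (h : d ∈ X) : minOf X ≤ d := by
  rw [minOf, if_pos ⟨d, h⟩]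
  exact_mod_cast Nat.sInf_le h

theorem mem_of_minOf_eq {X : Set ℕ} {d : ℕ} (h : minOf X = d) : d ∈ X := by
  unfold minOf at h
  split_ifs at h with hX
  · have : sInf X = d := by exact_mod_cast h
    exact this ▸ Nat.sInf_mem hX
  · simp at h

theorem le_minOf {X : Set ℕ} {a : ℕ∞} (h : ∀ d ∈ X, a ≤ d) : a ≤ minOf X := by
  unfold minOf
  split_ifs with hX
  · exact h _ (Nat.sInf_mem hX)
  · exact le_top

theorem pairs_flatMap (l : List ℕ) (f : ℕ → ℕ) :
    pairs (l.flatMap fun i => [i, f i]) = l.map fun i => (i, f i) := by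
  induction l with
  | nil => rfl
  | cons a l ih => simp [pairs, ih]

/-- For fixed v the relation compares 2d(v,i) + d(i,j) with the same quantity after exchanging i and
j. It is therefore total, and `exists_dominating` applies. -/
theorem exists_isPivotList {k H own : ℕ} {X : Set (List ℕ × ℕ)} {Y : Set (List ℕ)} (A : Finset ℕ)
    (hA : A.card < 2 ^ k) (hX : ∀ i d, ([i], d) ∈ X → i ∈ A) : ∃ B, IsPivotList k H own X Y B := by
  classical
  obtain ⟨B, h1, h2, h3⟩ := exists_dominating (fun i j => 2 * lookup H own X i + tableDist H Y i j ≤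
    tableDist H Y j i + 2 * lookup H own X j) (fun i j => by omega) k
    (A.filter fun i => i ≠ own ∧ ∃ d, ([i], d) ∈ X)
    ((Finset.card_le_card (Finset.filter_subset _ _)).trans_lt hA)
  refine ⟨B, h1, fun i hi => (Finset.mem_filter.1 (h2 i hi)).2, fun j hj hd => ?_⟩
  exact h3 j (Finset.mem_filter.2 ⟨hX j _ hd.choose_spec, hj, hd⟩)

theorem isPivotList_pivotIds {k H own : ℕ} {X : Set (List ℕ × ℕ)} {Y : Set (List ℕ)}
    (h : ∃ B, IsPivotList k H own X Y B) : IsPivotList k H own X Y (pivotIds k H own X Y) := by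
  rw [pivotIds, dif_pos h]
  exact h.choose_spec

end Proto

/-! ## The global behaviour of the program -/

section Source

variable {V : Type*} {N : DirectedNetwork V} {w : ℕ} {E : V → V → Prop}

/-- The result of simultaneous explorations from the nodes in `X`. -/
def sourceResult (E : V → V → Prop) (X : Set V) (item : V → List ℕ) (ok : V → V → ℕ → Prop)
    (y : V) : Set (List ℕ × ℕ) :=
  {a | ∃ v ∈ X, a.1 = item v ∧ Visits E v (ok v) a.2 y}

open Classical in
/-- No node ever accepts more than `L` tokens at a time. -/
def LoadBounded [Fintype V] (E : V → V → Prop) (len : V → ℕ) (delay : V → ℕ)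
    (ok : V → V → ℕ → Prop) (L : ℕ) : Prop :=
  ∀ τ y, (loadSet E len delay ok τ y).card ≤ L

open Classical in
/-- The number of items of the nodes when the nodes in `X` have one item each. -/
noncomputable def unitLen (X : Set V) (v : V) : ℕ := if v ∈ X then 1 else 0

theorem runs_explore_source [Fintype V] (hE : ∀ u v, E u v → N.comm.Adj u v)
    {dir : V → ℕ → Prop} (hdir : ∀ v (p : Fin (N.deg v)), dir v p ↔ E v (N.neighbor v p))
    (X : Set V) {item : V → List ℕ} (hinj : Function.Injective item)
    {okw : V → List ℕ → ℕ → Prop} {ok : V → V → ℕ → Prop}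
    (hok : ∀ v y d, okw y (item v) d ↔ ok v y d) {delay : V → ℕ} {L q T : ℕ}
    (hw : ∀ v, ∀ a ∈ item v, a < 2 ^ w) (hq : ∀ v, (item v).length + 1 ≤ q)
    (hdelay : ∀ v, delay v < 2 ^ w) (hT : ∀ v d y, ok v y d → delay v + d ≤ T)
    (hload : LoadBounded E (unitLen X) delay ok L) :
    Runs N w (fun v => Proto.explore (N.deg v) (dir v) (Proto.itemIf (v ∈ X) (item v)) (delay v)
      (okw v) L q T) (T * ((L + 1) * q)) (sourceResult E X item ok) := by
  have hlen : ∀ v, ∀ i < (Proto.itemIf (v ∈ X) (item v)).length, i = 0 := by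
    intro v i hi
    have := Proto.length_itemIf_le (p := v ∈ X) (x := item v)
    omega
  refine (runs_explore (E := E) (items := fun v => Proto.itemIf (v ∈ X) (item v)) (ok := ok)
    hE hdir ?_ ?_ ?_ ?_ ?_ ?_ ?_).congr (fun v => rfl) rfl fun y => ?_
  · intro v y x hx d
    rw [(Proto.mem_itemIf.1 hx).2]
    exact hok v y d
  · intro v v' x hx hx'
    exact hinj ((Proto.mem_itemIf.1 hx).2.symm.trans (Proto.mem_itemIf.1 hx').2)
  · intro v x hx
    rw [(Proto.mem_itemIf.1 hx).2]
    exact hw v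
  · intro v x hx
    rw [(Proto.mem_itemIf.1 hx).2]
    exact hq v
  · intro v i hi
    rw [hlen v i hi]
    exact hdelay v
  · intro v i hi d y h
    rw [hlen v i hi]
    exact hT v d y h
  · intro τ y
    convert hload τ y using 3
    funext v
    unfold Proto.itemIf unitLen
    split_ifs <;> rfl
  · ext a
    simp only [exploreResult, sourceResult, Proto.mem_itemIf, Set.mem_ofPred_eq, and_assoc]

/-- Visits start at distance 1, so a return to the source is not distance 0. This is why the
endpoints must differ and why `Proto.lookup` and `Proto.tableDist` treat equal identifiers
separately. -/
theorem sInf_visits_eq_truncDist {H : ℕ} {t y : V} (h : t ≠ y) :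
    sInf {d | Visits E t (fun _ e => e ≤ H) d y ∨ d = H} = truncDist E H t y := by
  refine le_antisymm ?_ ?_
  · by_cases hlt : truncDist E H t y < H
    · have h1 := reaches_truncDist hlt
      have h2 : 1 ≤ truncDist E H t y := by
        rw [Nat.one_le_iff_ne_zero]
        intro h0
        rw [h0] at h1
        exact h h1
      obtain ⟨d, hd, hv⟩ := exists_visits_of_reaches h2 hlt.le h1
      exact (Nat.sInf_le (Or.inl hv)).trans hd
    · exact (Nat.sInf_le (Or.inr rfl)).trans (by omega)
  · rcases Nat.sInf_mem (s := {d | Visits E t (fun _ e => e ≤ H) d y ∨ d = H}) ⟨H, Or.inr rfl⟩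
      with hv | hv
    · exact truncDist_le_of_reaches hv.reaches
    · rw [hv]; exact truncDist_le t y

end Source

namespace DirectedNetwork

variable {V : Type*} (N : DirectedNetwork V) (P : GirthParams) (S : Set V) (u : ℕ → V → ℕ)

/-- The walks from the nodes in `S`. -/
def fwd : V → Set (List ℕ × ℕ) :=
  sourceResult N.graph.Adj S (fun v => [N.ident v]) fun _ _ d => d ≤ P.cutoff

/-- The walks to the nodes in `S`. -/
def bwd : V → Set (List ℕ × ℕ) :=
  sourceResult (fun x y => N.graph.Adj y x) S (fun v => [N.ident v]) fun _ _ d => d ≤ P.cutoff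

/-- The distances between the nodes in `S`. -/
def table : Set (List ℕ) := walkTable N.graph.Adj P.cutoff N.ident S

/-- The rows of the table that are known to `v`. -/
def rows (v : V) : Set (List ℕ) := {x | ∃ i d, ([i], d) ∈ N.fwd P S v ∧ x = [i, N.ident v, d]}

open Classical in
/-- The rows of the table that `v` sends to all nodes. -/
noncomputable def rowItems (v : V) : List (List ℕ) :=
  if v ∈ S then Proto.listOf (N.rows P S v) else []

/-- The message with which `v` starts its exploration. -/
noncomputable def item (v : V) : List ℕ :=
  Proto.pivotItem P.pivots P.cutoff (N.ident v) (N.bwd P S v) (N.table P S)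

/-- The pivots of `v`. -/
noncomputable def pivotList [Nonempty V] (v : V) : List V :=
  (Proto.pivotIds P.pivots P.cutoff (N.ident v) (N.bwd P S v) (N.table P S)).map
    (Function.invFun N.ident)

/-- The test of the explorations of the main loop. -/
def test [Nonempty V] (blk : Set V) : V → V → ℕ → Prop :=
  exploreTest N.graph.Adj P.cutoff P.depth (N.pivotList P S) blk

/-- The nodes visited by explorations from `X`, and those in `X`. -/
def visited [Nonempty V] (X : Set V) : Set V :=
  {y | y ∈ X ∨ ∃ v ∈ X, ∃ d, Visits N.graph.Adj v (N.test P S ∅ v) d y}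

/-- The nodes that take part in the `j`-th iteration of the main loop. -/
def active [Nonempty V] : ℕ → Set V
  | 0 => Set.univ
  | j + 1 => N.visited P S {v | v ∈ active j ∧ u (4 + 3 * j) v = 0}

/-- The nodes that are selected in the `j`-th iteration of the main loop. -/
def selected [Nonempty V] (j : ℕ) : Set V := {v | v ∈ N.active P S u j ∧ u (4 + 3 * j) v = 0}

/-- The closed walks through `v` that are found before the `j`-th iteration of the main loop. -/
def found [Nonempty V] : ℕ → V → Set ℕ
  | 0, _ => ∅
  | j + 1, v => found j v ∪ {d | (v ∈ N.active P S u j ∧ v ∉ N.active P S u (j + 1)) ∧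
      Visits N.graph.Adj v (N.test P S (N.active P S u (j + 1)) v) d v}

/-- All closed walks through `v` that are found in the explorations. -/
def foundAll [Nonempty V] (v : V) : Set ℕ :=
  N.found P S u P.iterations v ∪ {d | v ∈ N.active P S u P.iterations ∧
    Visits N.graph.Adj v (N.test P S ∅ v) d v}

/-- The output of the algorithm. -/
noncomputable def girthOutput [Nonempty V] : ℕ∞ :=
  min (⨅ v, Proto.minOf (N.foundAll P S u v)) (tableGirth (N.table P S))

variable {N P S u}

theorem adj_comm_of_adj {x y : V} (h : N.graph.Adj x y) : N.comm.Adj x y := by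
  rw [comm, Digraph.toSimpleGraphInclusive, SimpleGraph.fromRel_adj]
  exact ⟨fun e => N.loopless x (e ▸ h), Or.inl h⟩

theorem lookup_fwd {t : V} (ht : t ∈ S) (y : V) :
    Proto.lookup P.cutoff (N.ident y) (N.fwd P S y) (N.ident t) =
      truncDist N.graph.Adj P.cutoff t y := by
  unfold Proto.lookup
  split_ifs with h
  · rw [N.ident_injective h, truncDist_self]
  · rw [← sInf_visits_eq_truncDist fun e => h (by rw [e])]
    congr 2
    ext d
    constructor
    · rintro (⟨v, -, h1, h2⟩ | h1)
      · simp only [List.cons.injEq, and_true] at h1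
        obtain rfl := N.ident_injective h1
        exact Or.inl h2
      · exact Or.inr h1
    · exact Or.imp_left fun h1 => ⟨t, ht, rfl, h1⟩

theorem lookup_bwd {t : V} (ht : t ∈ S) (y : V) :
    Proto.lookup P.cutoff (N.ident y) (N.bwd P S y) (N.ident t) =
      truncDist N.graph.Adj P.cutoff y t := by
  have hflip : truncDist N.graph.Adj P.cutoff y t =
      truncDist (fun x y => N.graph.Adj y x) P.cutoff t y := by
    simp only [truncDist, reaches_flip]
  rw [hflip]
  unfold Proto.lookup
  split_ifs with h
  · rw [N.ident_injective h, truncDist_self]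
  · rw [← sInf_visits_eq_truncDist fun e => h (by rw [e])]
    congr 2
    ext d
    constructor
    · rintro (⟨v, -, h1, h2⟩ | h1)
      · simp only [List.cons.injEq, and_true] at h1
        obtain rfl := N.ident_injective h1
        exact Or.inl h2
      · exact Or.inr h1
    · exact Or.imp_left fun h1 => ⟨t, ht, rfl, h1⟩

theorem tableDist_table {t t' : V} (ht : t ∈ S) (ht' : t' ∈ S) :
    Proto.tableDist P.cutoff (N.table P S) (N.ident t) (N.ident t') =
      truncDist N.graph.Adj P.cutoff t t' := by
  unfold Proto.tableDist
  split_ifs with h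
  · rw [N.ident_injective h, truncDist_self]
  · rw [← sInf_visits_eq_truncDist fun e => h (by rw [e])]
    congr 2
    ext d
    constructor
    · rintro (⟨v, -, v', -, d', h1, h2⟩ | h1)
      · simp only [List.cons.injEq, and_true] at h2
        obtain ⟨h2, h3, rfl⟩ := h2
        obtain rfl := N.ident_injective h2
        obtain rfl := N.ident_injective h3
        exact Or.inl h1
      · exact Or.inr h1
    · exact Or.imp_left fun h1 => ⟨t, ht, t', ht', d, h1, rfl⟩

theorem exists_of_mem_bwd {v : V} {i d : ℕ} (h : ([i], d) ∈ N.bwd P S v) :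
    ∃ t ∈ S, N.ident t = i := by
  obtain ⟨t, ht, h1, -⟩ := h
  simp only [List.cons.injEq, and_true] at h1
  exact ⟨t, ht, h1.symm⟩

theorem item_injective : Function.Injective (N.item P S) := by
  intro v v' h
  unfold item Proto.pivotItem at h
  exact N.ident_injective (List.cons.inj h).1

theorem invFun_ident [Nonempty V] (t : V) : Function.invFun N.ident (N.ident t) = t :=
  Function.leftInverse_invFun N.ident_injective t

variable [Fintype V]

theorem isPivotList (hk : Fintype.card V < 2 ^ P.pivots) (v : V) :
    Proto.IsPivotList P.pivots P.cutoff (N.ident v) (N.bwd P S v) (N.table P S)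
      (Proto.pivotIds P.pivots P.cutoff (N.ident v) (N.bwd P S v) (N.table P S)) := by
  classical
  refine Proto.isPivotList_pivotIds (Proto.exists_isPivotList (Finset.univ.image N.ident)
    (Finset.card_image_le.trans_lt hk) fun i d h => ?_)
  obtain ⟨t, -, rfl⟩ := exists_of_mem_bwd h
  exact Finset.mem_image_of_mem _ (Finset.mem_univ t)

variable [Nonempty V]

theorem mem_pivotList_iff (hk : Fintype.card V < 2 ^ P.pivots) {v t : V} :
    t ∈ N.pivotList P S v ↔ N.ident t ∈
      Proto.pivotIds P.pivots P.cutoff (N.ident v) (N.bwd P S v) (N.table P S) := by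
  unfold pivotList
  rw [List.mem_map]
  constructor
  · rintro ⟨i, hi, rfl⟩
    obtain ⟨t, -, rfl⟩ := exists_of_mem_bwd ((isPivotList hk v).2.1 i hi).2.choose_spec
    rwa [invFun_ident]
  · intro h
    exact ⟨_, h, invFun_ident t⟩

theorem mem_of_mem_pivotList (hk : Fintype.card V < 2 ^ P.pivots) {v t : V}
    (h : t ∈ N.pivotList P S v) : t ∈ S := by
  rw [mem_pivotList_iff hk] at h
  obtain ⟨t', ht', h1⟩ := exists_of_mem_bwd ((isPivotList hk v).2.1 _ h).2.choose_spec
  rwa [← N.ident_injective h1]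

theorem length_pivotList_le (hk : Fintype.card V < 2 ^ P.pivots) (v : V) :
    (N.pivotList P S v).length ≤ P.pivots := by
  rw [pivotList, List.length_map]
  exact (isPivotList hk v).1

/-- The pivots prune all sampled nodes that are close. -/
theorem exists_pivot (hk : Fintype.card V < 2 ^ P.pivots) {v s : V} (hs : s ∈ S) (hsv : s ≠ v)
    (hlt : truncDist N.graph.Adj P.cutoff v s < P.cutoff) :
    ∃ t ∈ N.pivotList P S v, Prunes N.graph.Adj P.cutoff v t s := by
  have h1 : Reaches N.graph.Adj _ v s := reaches_truncDist hlt
  have h2 : 1 ≤ truncDist N.graph.Adj P.cutoff v s := by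
    rw [Nat.one_le_iff_ne_zero]
    intro h0
    rw [h0] at h1
    exact hsv (Eq.symm h1)
  obtain ⟨d, -, hv⟩ := exists_visits_of_reaches h2 hlt.le (reaches_flip.2 h1)
  obtain ⟨i, hi, hle⟩ := (isPivotList hk v).2.2 (N.ident s) (fun e => hsv (N.ident_injective e))
    ⟨d, s, hs, rfl, hv⟩
  obtain ⟨t, ht, rfl⟩ := exists_of_mem_bwd ((isPivotList hk v).2.1 i hi).2.choose_spec
  refine ⟨t, (mem_pivotList_iff hk).2 hi, ?_⟩
  rw [lookup_bwd ht, lookup_bwd hs, tableDist_table ht hs, tableDist_table hs ht] at hle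
  exact hle

/-- The test is local: `y` knows its own distances to and from the sample, and the only foreign
quantities, the distances from `v` to its pivots, travel in the message. -/
theorem wordTest_item (hk : Fintype.card V < 2 ^ P.pivots) (v y : V) (d : ℕ) (blk : Set V) :
    Proto.wordTest P.depth P.cutoff (N.ident y) (N.fwd P S y) (N.bwd P S y) (y ∈ blk)
      (N.item P S v) d ↔ N.test P S blk v y d := by
  unfold Proto.wordTest test exploreTest item Proto.pivotItem
  refine and_congr_right fun _ => or_congr ?_ (and_congr_right fun _ => ?_)
  · simp only [List.headI_cons]
    exact ⟨fun h => (N.ident_injective h).symm, fun h => by rw [h]⟩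
  · rw [List.tail_cons, Proto.pairs_flatMap]
    constructor
    · intro h t ht
      have hS := mem_of_mem_pivotList hk ht
      have := h _ (List.mem_map_of_mem ((mem_pivotList_iff hk).1 ht))
      rwa [lookup_bwd hS, lookup_bwd hS, lookup_fwd hS] at this
    · intro h a ha
      obtain ⟨i, hi, rfl⟩ := List.mem_map.1 ha
      obtain ⟨t, hS, rfl⟩ := exists_of_mem_bwd ((isPivotList hk v).2.1 i hi).2.choose_spec
      have := h t ((mem_pivotList_iff hk).2 hi)
      rwa [lookup_bwd hS, lookup_bwd hS, lookup_fwd hS]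

end DirectedNetwork

/-! ## The program computes its global specification -/

namespace DirectedNetwork

variable {V : Type*}

/-- The conditions on the parameters under which the program can be executed. -/
structure Admissible [Fintype V] (N : DirectedNetwork V) (P : GirthParams) (u : ℕ → V → ℕ)
    (S : Set V) (w K : ℕ) : Prop where
  card_lt : Fintype.card V < 2 ^ P.pivots
  ident_lt : ∀ v, N.ident v < 2 ^ w
  cutoff_lt : P.cutoff < 2 ^ w
  delay_add_card_le : ∀ i v, u i v + Fintype.card V ≤ 2 ^ w
  delay_add_le : ∀ i v, u i v + K + P.cutoff + P.diam ≤ P.time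
  ncard_le : S.ncard ≤ K
  four_le_words : 4 ≤ P.words
  pivots_le_words : 2 * P.pivots + 2 ≤ P.words
  exists_reaches : ∀ x y, ∃ d ≤ P.diam, Reaches N.comm.Adj d x y

/-- In none of the simultaneous explorations a node is overloaded. -/
structure LoadsBounded [Fintype V] [Nonempty V] (N : DirectedNetwork V) (P : GirthParams)
    (u : ℕ → V → ℕ) (S : Set V) : Prop where
  fwd : LoadBounded N.graph.Adj (unitLen S) (u 1) (fun _ _ d => d ≤ P.cutoff) P.load
  bwd : LoadBounded (fun x y => N.graph.Adj y x) (unitLen S) (u 2) (fun _ _ d => d ≤ P.cutoff)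
    P.load
  rows : LoadBounded N.comm.Adj (fun v => (N.rowItems P S v).length) (u 3)
    (fun _ _ d => d ≤ P.diam) P.load
  selected : ∀ j < P.iterations, LoadBounded N.graph.Adj (unitLen (N.selected P S u j))
    (u (5 + 3 * j)) (N.test P S ∅) P.load
  active : ∀ j < P.iterations, LoadBounded N.graph.Adj
    (unitLen (N.active P S u j \ N.active P S u (j + 1))) (u (6 + 3 * j))
    (N.test P S (N.active P S u (j + 1))) P.load
  last : LoadBounded N.graph.Adj (unitLen (N.active P S u P.iterations))
    (u (4 + 3 * P.iterations)) (N.test P S ∅) P.load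

variable {N : DirectedNetwork V} {P : GirthParams} {u : ℕ → V → ℕ} {S : Set V} {w K : ℕ}

theorem mem_table_iff {x : List ℕ} : x ∈ N.table P S ↔ ∃ v ∈ S, x ∈ N.rows P S v := by
  constructor
  · rintro ⟨t, ht, t', ht', d, h, rfl⟩
    exact ⟨t', ht', N.ident t, d, ⟨t, ht, rfl, h⟩, rfl⟩
  · rintro ⟨t', ht', i, d, ⟨t, ht, h1, h⟩, rfl⟩
    simp only [List.cons.injEq, and_true] at h1
    exact ⟨t, ht, t', ht', d, h, by rw [h1]⟩

theorem lookup_le (H own : ℕ) (X : Set (List ℕ × ℕ)) (i : ℕ) : Proto.lookup H own X i ≤ H := by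
  unfold Proto.lookup
  split_ifs
  · exact Nat.zero_le _
  · exact Nat.sInf_le (Or.inr rfl)

theorem item_mem_sourceResult_iff [Nonempty V] (X blk : Set V) (v : V) (d : ℕ) :
    (N.item P S v, d) ∈ sourceResult N.graph.Adj X (N.item P S) (N.test P S blk) v ↔
      v ∈ X ∧ Visits N.graph.Adj v (N.test P S blk v) d v := by
  constructor
  · rintro ⟨v', hv', h1, h2⟩
    obtain rfl := item_injective h1
    exact ⟨hv', h2⟩
  · rintro ⟨h1, h2⟩
    exact ⟨v, h1, rfl, h2⟩

/-- The distance of the first visit is unique, so a row at `v` is determined by its sampled starting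
node. Hence `v` owns at most as many rows as there are sampled nodes. -/
theorem rows_mapsTo_injOn [Nonempty V] (v : V) :
    Set.MapsTo (fun x : List ℕ => Function.invFun N.ident x.headI) (N.rows P S v) S ∧
      Set.InjOn (fun x : List ℕ => Function.invFun N.ident x.headI) (N.rows P S v) := by
  have key : ∀ x ∈ N.rows P S v, ∃ t ∈ S, ∃ d, Visits N.graph.Adj t (fun _ d => d ≤ P.cutoff) d v ∧
      x = [N.ident t, N.ident v, d] := by
    rintro x ⟨i, d, ⟨t, ht, h1, h2⟩, rfl⟩
    simp only [List.cons.injEq, and_true] at h1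
    exact ⟨t, ht, d, h2, by rw [h1]⟩
  constructor
  · intro x hx
    obtain ⟨t, ht, d, -, rfl⟩ := key x hx
    simpa only [List.headI_cons, invFun_ident] using ht
  · intro x hx x' hx' heq
    obtain ⟨t, ht, d, h, rfl⟩ := key x hx
    obtain ⟨t', ht', d', h', rfl⟩ := key x' hx'
    simp only [List.headI_cons, invFun_ident] at heq
    obtain rfl := heq
    rw [h.unique h']

theorem finite_rows [Finite V] [Nonempty V] (v : V) : (N.rows P S v).Finite :=
  Set.Finite.of_injOn (rows_mapsTo_injOn v).1 (rows_mapsTo_injOn v).2 S.toFinite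

theorem mem_rowItems [Finite V] [Nonempty V] {v : V} {x : List ℕ} :
    x ∈ N.rowItems P S v ↔ v ∈ S ∧ x ∈ N.rows P S v := by
  unfold rowItems
  split_ifs with h
  · simp [Proto.mem_listOf (finite_rows v), h]
  · simp [h]

theorem length_rowItems_le [Finite V] [Nonempty V] (v : V) :
    (N.rowItems P S v).length ≤ S.ncard := by
  unfold rowItems
  split_ifs
  · rw [Proto.length_listOf (finite_rows v)]
    exact Set.ncard_le_ncard_of_injOn _ (rows_mapsTo_injOn v).1 (rows_mapsTo_injOn v).2 S.toFinite
  · simp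

/-- The node's own rows are added by hand because explorations deliver nothing at distance 0. -/
theorem iUnion_rows [Finite V] [Nonempty V]
    (hd : ∀ x y, ∃ d ≤ P.diam, Reaches N.comm.Adj d x y) (v : V) :
    {x | x ∈ N.rowItems P S v ∨ ∃ d, (x, d) ∈ exploreResult N.comm.Adj (N.rowItems P S)
      (fun _ _ d => d ≤ P.diam) v} = N.table P S := by
  ext x
  rw [mem_table_iff]
  constructor
  · rintro (h | ⟨d, t, h, -⟩)
    · exact ⟨v, mem_rowItems.1 h⟩
    · exact ⟨t, mem_rowItems.1 h⟩
  · rintro ⟨t, ht⟩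
    obtain ⟨d, hd, h⟩ := hd t v
    rcases Nat.eq_zero_or_pos d with rfl | hpos
    · cases h
      exact Or.inl (mem_rowItems.2 ht)
    · obtain ⟨e, -, hv⟩ := exists_visits_of_reaches hpos hd h
      exact Or.inr ⟨e, t, mem_rowItems.2 ht, hv⟩

variable [Fintype V] (hA : N.Admissible P u S w K)

include hA

theorem length_item_le (v : V) : (N.item P S v).length + 1 ≤ P.words := by
  have h1 := (isPivotList (N := N) (P := P) (S := S) hA.card_lt v).1
  have h2 : ∀ (l : List ℕ) (f : ℕ → ℕ), (l.flatMap fun i => [i, f i]).length = 2 * l.length := by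
    intro l f
    induction l with
    | nil => rfl
    | cons a l ih => simp only [List.flatMap_cons, List.length_append, ih, List.length_cons,
        List.length_nil]; ring
  rw [item, Proto.pivotItem, List.length_cons, h2]
  have := hA.pivots_le_words
  omega

theorem mem_item_lt (v : V) : ∀ a ∈ N.item P S v, a < 2 ^ w := by
  intro a ha
  unfold item Proto.pivotItem at ha
  rcases List.mem_cons.1 ha with rfl | ha
  · exact hA.ident_lt v
  · obtain ⟨i, hi, ha⟩ := List.mem_flatMap.1 ha
    simp only [List.mem_cons, List.not_mem_nil, or_false] at ha
    rcases ha with rfl | rfl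
    · obtain ⟨t, -, rfl⟩ :=
        exists_of_mem_bwd ((isPivotList hA.card_lt v).2.1 _ hi).2.choose_spec
      exact hA.ident_lt t
    · exact (lookup_le _ _ _ _).trans_lt hA.cutoff_lt

variable [Nonempty V] (hL : N.LoadsBounded P u S)

theorem delay_lt (i : ℕ) (v : V) : u i v < 2 ^ w := by
  have := hA.delay_add_card_le i v
  have : 0 < Fintype.card V := Fintype.card_pos
  omega

theorem runs_explore_item (X blk : Set V) (i : ℕ)
    (hload : LoadBounded N.graph.Adj (unitLen X) (u i) (N.test P S blk) P.load) :
    Runs N w (fun v => Proto.explore (N.deg v) (fun p => (N.localInput v).isOut p)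
      (Proto.itemIf (v ∈ X) (N.item P S v)) (u i v)
      (Proto.wordTest P.depth P.cutoff (N.ident v) (N.fwd P S v) (N.bwd P S v) (v ∈ blk))
      P.load P.words P.time) (P.time * ((P.load + 1) * P.words))
      (sourceResult N.graph.Adj X (N.item P S) (N.test P S blk)) := by
  refine runs_explore_source (fun _ _ => adj_comm_of_adj) ?_ X item_injective ?_ (mem_item_lt hA)
    (length_item_le hA) (delay_lt hA i) ?_ hload
  · intro v p
    simp [localInput]
  · intro v y d
    exact wordTest_item hA.card_lt v y d blk
  · intro v d y h
    have h1 : d ≤ P.depth := h.1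
    have := hA.delay_add_le i v
    have : P.cutoff = 2 * P.depth := rfl
    omega

theorem runs_explore_ident {E : V → V → Prop} (hE : ∀ u v, E u v → N.comm.Adj u v)
    {dir : V → ℕ → Prop} (hdir : ∀ v (p : Fin (N.deg v)), dir v p ↔ E v (N.neighbor v p)) (i : ℕ)
    (hload : LoadBounded E (unitLen S) (u i) (fun _ _ d => d ≤ P.cutoff) P.load) :
    Runs N w (fun v => Proto.explore (N.deg v) (dir v) (Proto.itemIf (v ∈ S) [N.ident v]) (u i v)
      (fun _ d => d ≤ P.cutoff) P.load P.words P.time) (P.time * ((P.load + 1) * P.words))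
      (sourceResult E S (fun v => [N.ident v]) fun _ _ d => d ≤ P.cutoff) := by
  refine runs_explore_source hE hdir S (fun v v' h => N.ident_injective (List.cons.inj h).1)
    (fun v y d => Iff.rfl) ?_ ?_ (delay_lt hA i) ?_ hload
  · intro v a ha
    rw [List.mem_singleton.1 ha]
    exact hA.ident_lt v
  · intro v
    have := hA.four_le_words
    simp only [List.length_cons, List.length_nil]
    omega
  · intro v d y h
    have := hA.delay_add_le i v
    omega

theorem runs_explore_rows (hload : LoadBounded N.comm.Adj (fun v => (N.rowItems P S v).length)
      (u 3) (fun _ _ d => d ≤ P.diam) P.load) :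
    Runs N w (fun v => Proto.explore (N.deg v) (fun _ => True) (N.rowItems P S v) (u 3 v)
      (fun _ d => d ≤ P.diam) P.load P.words P.time) (P.time * ((P.load + 1) * P.words))
      (exploreResult N.comm.Adj (N.rowItems P S) fun _ _ d => d ≤ P.diam) := by
  have hrow : ∀ v, ∀ x ∈ N.rowItems P S v, ∃ t d, d ≤ P.cutoff ∧ x = [N.ident t, N.ident v, d] := by
    intro v x hx
    obtain ⟨i, d, ⟨t, -, h1, h2⟩, rfl⟩ := (mem_rowItems.1 hx).2
    simp only [List.cons.injEq, and_true] at h1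
    exact ⟨t, d, h2.accepted, by rw [h1]⟩
  have hlen : ∀ v, (N.rowItems P S v).length ≤ Fintype.card V := by
    intro v
    rw [← Nat.card_eq_fintype_card]
    exact (length_rowItems_le v).trans (Set.ncard_le_card S)
  refine runs_explore (E := N.comm.Adj) (items := N.rowItems P S) (delay := u 3)
    (ok := fun _ _ d => d ≤ P.diam) (fun _ _ h => h) (fun v p => ?_) (fun v y x hx d => Iff.rfl) ?_ ?_ ?_ ?_ ?_
    hload
  · simpa using N.adj_neighbor v p
  · intro v v' x hx hx'
    obtain ⟨t, d, -, rfl⟩ := hrow v x hx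
    obtain ⟨t', d', -, heq⟩ := hrow v' _ hx'
    simp only [List.cons.injEq, and_true] at heq
    exact N.ident_injective heq.2.1
  · intro v x hx
    obtain ⟨t, d, hd, rfl⟩ := hrow v x hx
    simp only [List.mem_cons, List.not_mem_nil, or_false, forall_eq_or_imp, forall_eq]
    exact ⟨hA.ident_lt _, hA.ident_lt _, hd.trans_lt hA.cutoff_lt⟩
  · intro v x hx
    obtain ⟨t, d, hd, rfl⟩ := hrow v x hx
    exact hA.four_le_words
  · intro v i hi
    have := hA.delay_add_card_le 3 v
    have := hlen v
    omega
  · intro v i hi d y h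
    have := hA.delay_add_le 3 v
    have := length_rowItems_le (N := N) (P := P) (S := S) v
    have := hA.ncard_le
    omega

include hL

/-- A node knows whether it is blocked after the first exploration: it was selected, or something
reached it. This local criterion coincides with membership in the next active set. -/
theorem runs_girthStep (j : ℕ) (hj : j < P.iterations) :
    Runs N w (fun v => Proto.girthStep P (N.deg v) (fun p => (N.localInput v).isOut p)
        (fun i => u i v) (N.item P S v)
        (Proto.wordTest P.depth P.cutoff (N.ident v) (N.fwd P S v) (N.bwd P S v)) j
        (v ∈ N.active P S u j, N.found P S u j v))
      (2 * (P.time * ((P.load + 1) * P.words)))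
      (fun v => (v ∈ N.active P S u (j + 1), N.found P S u (j + 1) v)) := by
  have h1 := runs_explore_item hA (N.selected P S u j) ∅ (5 + 3 * j) (hL.selected j hj)
  have h2 := runs_explore_item hA (N.active P S u j \ N.active P S u (j + 1))
    (N.active P S u (j + 1)) (6 + 3 * j) (hL.active j hj)
  have hb : ∀ v, ((v ∈ N.active P S u j ∧ u (4 + 3 * j) v = 0) ∨
      (sourceResult N.graph.Adj (N.selected P S u j) (N.item P S) (N.test P S ∅) v).Nonempty) =
      (v ∈ N.active P S u (j + 1)) := by
    intro v
    refine propext (or_congr Iff.rfl ?_)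
    constructor
    · rintro ⟨a, t, ht, -, h⟩
      exact ⟨t, ht, _, h⟩
    · rintro ⟨t, ht, d, h⟩
      exact ⟨(N.item P S t, d), t, ht, rfl, h⟩
  refine (h1.bind (f := fun v Y =>
    (Proto.explore (N.deg v) (fun p => (N.localInput v).isOut p)
      (Proto.itemIf (v ∈ N.active P S u j ∧ ¬ ((v ∈ N.active P S u j ∧ u (4 + 3 * j) v = 0) ∨
        Y.Nonempty)) (N.item P S v)) (u (6 + 3 * j) v)
      (Proto.wordTest P.depth P.cutoff (N.ident v) (N.fwd P S v) (N.bwd P S v)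
        ((v ∈ N.active P S u j ∧ u (4 + 3 * j) v = 0) ∨ Y.Nonempty))
      P.load P.words P.time).bind fun Z =>
    .ret ((v ∈ N.active P S u j ∧ u (4 + 3 * j) v = 0) ∨ Y.Nonempty,
      N.found P S u j v ∪ {d | (N.item P S v, d) ∈ Z})) (t' := P.time * ((P.load + 1) * P.words))
      (r' := fun v => (v ∈ N.active P S u (j + 1), N.found P S u (j + 1) v)) ?_).congr
      (fun v => ?_) (by ring) fun v => rfl
  · simp only [hb]
    refine (h2.bind (t' := 0) (f := fun v Z => .ret (v ∈ N.active P S u (j + 1),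
      N.found P S u j v ∪ {d | (N.item P S v, d) ∈ Z})) (Runs.ret _)).congr (fun v => rfl) rfl
      fun v => ?_
    simp only [item_mem_sourceResult_iff]
    rfl
  · simp only [Set.mem_empty_iff_false]
    rfl

theorem runs_girthMain :
    Runs N w (fun v => Proto.girthMain P (N.deg v) (N.ident v)
        (fun p => (N.localInput v).isOut p) (fun i => u i v) (N.fwd P S v) (N.bwd P S v)
        (N.table P S))
      (P.iterations * (2 * (P.time * ((P.load + 1) * P.words))) +
        (P.time * ((P.load + 1) * P.words) + P.diam))
      (fun _ => N.girthOutput P S u) := by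
  have h1 := Runs.loop (N := N) (w := w) (body := fun v => Proto.girthStep P (N.deg v)
    (fun p => (N.localInput v).isOut p) (fun i => u i v) (N.item P S v)
    (Proto.wordTest P.depth P.cutoff (N.ident v) (N.fwd P S v) (N.bwd P S v)))
    (fun j v => (v ∈ N.active P S u j, N.found P S u j v)) P.iterations 0
    (fun j _ hj => runs_girthStep hA hL j (by omega))
  rw [zero_add] at h1
  have h2 := runs_explore_item hA (N.active P S u P.iterations) ∅ (4 + 3 * P.iterations) hL.last
  have h3 := runs_minFlood (N := N) (w := w) (fun v => Proto.minOf (N.foundAll P S u v)) ?_ P.diam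
    hA.exists_reaches
  · have h4 := h3.bind (t' := 0) (f := fun _ m => .ret (min m (tableGirth (N.table P S))))
      (Runs.ret _)
    have h5 := h2.bind (f := fun v Z => (Proto.minFlood (N.deg v) P.diam (Proto.minOf
      (N.found P S u P.iterations v ∪ {d | (N.item P S v, d) ∈ Z}))).bind fun m =>
      .ret (min m (tableGirth (N.table P S))))
      (h4.congr (fun v => ?_) rfl fun v => rfl)
    · refine (h1.bind (f := fun v s => (Proto.explore (N.deg v)
        (fun p => (N.localInput v).isOut p) (Proto.itemIf s.1 (N.item P S v))
        (u (4 + 3 * P.iterations) v) (Proto.wordTest P.depth P.cutoff (N.ident v) (N.fwd P S v)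
          (N.bwd P S v) False) P.load P.words P.time).bind fun Z =>
          (Proto.minFlood (N.deg v) P.diam (Proto.minOf (s.2 ∪ {d | (N.item P S v, d) ∈ Z}))).bind
            fun m => .ret (min m (tableGirth (N.table P S))))
        (h5.congr (fun v => ?_) rfl fun v => rfl)).congr (fun v => ?_) rfl fun v => rfl
      · simp only [Set.mem_empty_iff_false]
      · have h0 : ((v ∈ N.active P S u 0), N.found P S u 0 v) = (True, ∅) :=
          Prod.ext (eq_true (Set.mem_univ v)) rfl
        simp only [h0]
        rfl
    · simp only [item_mem_sourceResult_iff]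
      rfl
  · intro v m hm
    have hle : ∀ j, ∀ d ∈ N.found P S u j v, d ≤ P.depth := by
      intro j
      induction j with
      | zero => intro d hd; cases hd
      | succ j ih =>
        rintro d (hd | ⟨-, hd⟩)
        · exact ih d hd
        · exact hd.accepted.1
    have h1 : m ≤ P.depth := by
      rcases Proto.mem_of_minOf_eq hm with h | ⟨-, h⟩
      · exact hle _ _ h
      · exact h.accepted.1
    have h2 := hA.cutoff_lt
    have : P.cutoff = 2 * P.depth := rfl
    omega

theorem runs_girthProgram (hS : S = {v | u 0 v < P.threshold}) :
    Runs N w (fun v => Proto.girthProgram P (N.localInput v) fun i => u i v) P.rounds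
      (fun _ => N.girthOutput P S u) := by
  classical
  have h1 := runs_explore_ident hA (fun _ _ => adj_comm_of_adj)
    (dir := fun v p => (N.localInput v).isOut p) (by intro v p; simp [localInput]) 1 hL.fwd
  have h2 := runs_explore_ident hA (fun _ _ h => (adj_comm_of_adj h).symm)
    (dir := fun v p => (N.localInput v).isIn p) (by intro v p; simp [localInput]) 2 hL.bwd
  have h3 := runs_explore_rows hA hL.rows
  have h4 := runs_girthMain hA hL
  have hmem : ∀ v, (u 0 v < P.threshold) = (v ∈ S) := fun v => by rw [hS]; rfl
  have hitems : ∀ v, (if v ∈ S then Proto.listOf {x | ∃ i d, ([i], d) ∈ N.fwd P S v ∧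
      x = [i, (N.localInput v).ident, d]} else []) = N.rowItems P S v := fun v => rfl
  have h5 := h3.bind (f := fun v Y => Proto.girthMain P (N.localInput v).deg (N.localInput v).ident
    (fun p => (N.localInput v).isOut p) (fun i => u i v) (N.fwd P S v) (N.bwd P S v)
    {x | x ∈ N.rowItems P S v ∨ ∃ d, (x, d) ∈ Y})
    (h4.congr (fun v => by rw [iUnion_rows hA.exists_reaches v]; rfl) rfl fun v => rfl)
  have h6 := h2.bind (f := fun v X => (Proto.explore (N.localInput v).deg (fun _ => True)
    (N.rowItems P S v) (u 3 v) (fun _ d => d ≤ P.diam) P.load P.words P.time).bind fun Y =>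
    Proto.girthMain P (N.localInput v).deg (N.localInput v).ident
    (fun p => (N.localInput v).isOut p) (fun i => u i v) (N.fwd P S v) X
    {x | x ∈ N.rowItems P S v ∨ ∃ d, (x, d) ∈ Y}) h5
  refine (h1.bind (f := fun v F => (Proto.explore (N.localInput v).deg
    (fun p => (N.localInput v).isIn p) (Proto.itemIf (v ∈ S) [(N.localInput v).ident]) (u 2 v)
    (fun _ d => d ≤ P.cutoff) P.load P.words P.time).bind fun X =>
    (Proto.explore (N.localInput v).deg (fun _ => True)
    (if v ∈ S then Proto.listOf {x | ∃ i d, ([i], d) ∈ F ∧ x = [i, (N.localInput v).ident, d]}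
      else []) (u 3 v) (fun _ d => d ≤ P.diam) P.load P.words P.time).bind fun Y =>
    Proto.girthMain P (N.localInput v).deg (N.localInput v).ident
    (fun p => (N.localInput v).isOut p) (fun i => u i v) F X
    {x | x ∈ (if v ∈ S then Proto.listOf {x | ∃ i d, ([i], d) ∈ F ∧
      x = [i, (N.localInput v).ident, d]} else []) ∨ ∃ d, (x, d) ∈ Y})
    (h6.congr (fun v => ?_) rfl fun v => rfl)).congr (fun v => ?_) ?_ fun v => rfl
  · rfl
  · simp only [Proto.girthProgram, hmem]
    rfl
  · simp only [GirthParams.rounds]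
    ring

end DirectedNetwork

/-! ## Correctness of the output -/

namespace DirectedNetwork

variable {V : Type*} [Nonempty V] {N : DirectedNetwork V} {P : GirthParams} {u : ℕ → V → ℕ}
  {S : Set V}

theorem found_mono {i j : ℕ} (h : i ≤ j) (v : V) : N.found P S u i v ⊆ N.found P S u j v := by
  induction h with
  | refl => exact subset_rfl
  | step _ ih => exact ih.trans Set.subset_union_left

theorem reaches_of_mem_foundAll {v : V} {d : ℕ} (h : d ∈ N.foundAll P S u v) :
    1 ≤ d ∧ Reaches N.graph.Adj d v v := by
  have hfound : ∀ j, ∀ d ∈ N.found P S u j v, 1 ≤ d ∧ Reaches N.graph.Adj d v v := by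
    intro j
    induction j with
    | zero => intro d hd; cases hd
    | succ j ih =>
      rintro d (hd | ⟨-, hd⟩)
      · exact ih d hd
      · exact ⟨hd.1, hd.reaches⟩
  rcases h with h | ⟨-, h⟩
  · exact hfound _ d h
  · exact ⟨h.1, h.reaches⟩

theorem directedGirth_le_girthOutput : directedGirth N.graph ≤ N.girthOutput P S u := by
  refine le_min (le_iInf fun v => Proto.le_minOf fun d hd => ?_)
    (le_tableGirth N.graph N.ident_injective)
  obtain ⟨h1, h2⟩ := reaches_of_mem_foundAll hd
  exact directedGirth_le_of_reaches _ h1 h2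

theorem girthOutput_le_of_mem {v : V} {d : ℕ} (h : d ∈ N.foundAll P S u v) :
    N.girthOutput P S u ≤ d :=
  (min_le_left _ _).trans ((iInf_le _ v).trans (Proto.minOf_le h))

theorem girthOutput_le_of_windows {g w : ℕ} {c : ℕ → V} (hg : 1 ≤ g) (hw : w ≤ P.cutoff)
    (hc : ∀ i, N.graph.Adj (c i) (c (i + 1))) (hper : ∀ i, c (i + g) = c i)
    (hwin : ∀ i, ∃ j, i < j ∧ j ≤ i + w ∧ c j ∈ S) : N.girthOutput P S u ≤ g :=
  (min_le_right _ _).trans (tableGirth_le_of_windows hg hw hc hper hwin)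

/-- As long as no good bound has been found, the cycle keeps an active vertex. If none of its
vertices were active in the next iteration, then none would be blocked now, and the exploration from
the current active vertex would find a cycle of length at most g or point to a pivot on a closed
walk of length at most 2g. The last exploration has no blocked nodes at all. -/
theorem girthOutput_le_of_cycle [Fintype V] (hk : Fintype.card V < 2 ^ P.pivots) {g : ℕ} {c : ℕ → V}
    (hg : 1 ≤ g) (hgh : g < P.depth) (hc : ∀ i, N.graph.Adj (c i) (c (i + 1)))
    (hper : ∀ i, c (i + g) = c i) : N.girthOutput P S u ≤ (2 * g : ℕ) := by
  have hstep : ∀ (blk : Set V) (i : ℕ), (∀ j, c j ∉ blk) →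
      (∃ d ≤ g, Visits N.graph.Adj (c i) (N.test P S blk (c i)) d (c i)) ∨
        N.girthOutput P S u ≤ (2 * g : ℕ) := by
    intro blk i hblk
    refine (exists_visits_of_cycle (piv := N.pivotList P S) hg hgh le_rfl hc hper hblk).imp_right ?_
    rintro ⟨t, ht, d, hd, hv⟩
    refine (min_le_right _ _).trans
      ((tableGirth_le_of_visits (mem_of_mem_pivotList hk ht) hv).trans ?_)
    exact_mod_cast hd
  have hfin : ∀ v, ∀ d ≤ g, d ∈ N.foundAll P S u v → N.girthOutput P S u ≤ (2 * g : ℕ) := by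
    intro v d hd h
    refine (girthOutput_le_of_mem h).trans ?_
    exact_mod_cast (by omega : d ≤ 2 * g)
  by_contra hcon
  have hact : ∀ j ≤ P.iterations, ∃ i, c i ∈ N.active P S u j := by
    intro j
    induction j with
    | zero => exact fun _ => ⟨0, Set.mem_univ _⟩
    | succ j ih =>
      intro hj
      obtain ⟨i, hi⟩ := ih (by omega)
      by_contra hno
      push Not at hno
      obtain ⟨d, hd, hv⟩ := (hstep _ i hno).resolve_right hcon
      refine hcon (hfin (c i) d hd (Or.inl (found_mono hj _ (Or.inr ⟨⟨hi, hno i⟩, hv⟩))))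
  obtain ⟨i, hi⟩ := hact _ le_rfl
  obtain ⟨d, hd, hv⟩ := (hstep ∅ i fun j => Set.notMem_empty _).resolve_right hcon
  exact hcon (hfin (c i) d hd (Or.inr ⟨hi, hv⟩))

/-- The output is correct if the sample hits all windows of some shortest cycle that is long. -/
theorem isGirthApprox_girthOutput [Fintype V] (hk : Fintype.card V < 2 ^ P.pivots)
    (hdepth : (Fintype.card V : ℝ) ^ (2 / 3 : ℝ) ≤ P.depth) {w : ℕ} (hw : w ≤ P.cutoff)
    (hwin : ∀ g : ℕ, directedGirth N.graph = g → (Fintype.card V : ℝ) ^ (2 / 3 : ℝ) ≤ g →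
      ∃ c : ℕ → V, (∀ i, N.graph.Adj (c i) (c (i + 1))) ∧ (∀ i, c (i + g) = c i) ∧
        ∀ i, ∃ j, i < j ∧ j ≤ i + w ∧ c j ∈ S) :
    IsGirthApprox N.graph (N.girthOutput P S u) := by
  have hlow := directedGirth_le_girthOutput (N := N) (P := P) (S := S) (u := u)
  by_cases htop : directedGirth N.graph = ⊤
  · have hM : N.girthOutput P S u = ⊤ := top_le_iff.1 (htop ▸ hlow)
    refine ⟨hlow, ?_, fun _ => by rw [hM, htop]⟩
    rw [htop]
    simp
  obtain ⟨g, hg⟩ := ENat.ne_top_iff_exists.1 htop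
  have hg := hg.symm
  obtain ⟨hg1, c, hc, hper, -⟩ := exists_shortest_cycle N.graph hg
  have hlong : (Fintype.card V : ℝ) ^ (2 / 3 : ℝ) ≤ g →
      N.girthOutput P S u = directedGirth N.graph := by
    intro hle
    obtain ⟨c, hc, hper, hS⟩ := hwin g hg hle
    refine le_antisymm ?_ hlow
    rw [hg]
    exact girthOutput_le_of_windows hg1 hw hc hper hS
  refine ⟨hlow, ?_, fun h => hlong (h g hg)⟩
  by_cases hle : (Fintype.card V : ℝ) ^ (2 / 3 : ℝ) ≤ g
  · rw [hlong hle]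
    exact le_mul_of_one_le_left zero_le (by norm_num)
  · have hlt : g < P.depth := by exact_mod_cast (not_le.1 hle).trans_le hdepth
    rw [hg]
    exact_mod_cast girthOutput_le_of_cycle hk hg1 hlt hc hper

end DirectedNetwork

/-! ## The rare events -/

section Rarity

variable {V : Type*} [Fintype V] {M : ℕ}

/-- With random delays it is unlikely that a node is overloaded. -/
theorem rare_not_loadBounded {E : V → V → Prop} {len : V → ℕ} {ok : V → V → ℕ → Prop} {L T : ℕ}
    {μ : ℝ} (hM : 0 < M) (hT : ∀ v, ∀ a : Fin M, ∀ i < len v, ∀ d y, ok v y d → a + i + d ≤ T)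
    (hμ : ∀ y, ∀ W : Finset V, (∀ v ∈ W, ∃ d, Visits E v (ok v) d y) →
      (∑ v ∈ W, (len v : ℝ)) ≤ μ * M) :
    Rare (fun x : V → Fin M => ¬ LoadBounded E len (fun v => x v) ok L)
      (Fintype.card (Fin (T + 1) × V) * (Real.exp μ / 2 ^ (L + 1))) := by
  classical
  have : NeZero M := ⟨hM.ne'⟩
  have key : ∀ a : Fin (T + 1) × V, Rare (fun x : V → Fin M =>
      L + 1 ≤ (loadSet E len (fun v => x v) ok a.1 a.2).card) (Real.exp μ / 2 ^ (L + 1)) := by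
    rintro ⟨τ, y⟩
    refine (rare_ncard_ge (fun v (a : Fin M) => ∃ i < len v, ∃ d, Visits E v (ok v) d y ∧
      a + i + d = (τ : ℕ)) (μ := μ) ?_ (L + 1)).mono (fun x hx => ?_) le_rfl
    · rw [Fintype.card_fin]
      refine le_trans ?_ (hμ y (Finset.univ.filter fun v => ∃ d, Visits E v (ok v) d y)
        fun v hv => (Finset.mem_filter.1 hv).2)
      rw [Finset.sum_filter]
      refine Finset.sum_le_sum fun v _ => ?_
      split_ifs with hv
      · obtain ⟨d, hd⟩ := hv
        norm_cast
        refine le_of_le_of_eq ?_ (Set.ncard_Iio_nat (len v))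
        -- The distance `d` is fixed by source and target, so a delay counts only if this difference
        -- is the index of an item: at most `len v` of the `M` delays do.
        refine Set.ncard_le_ncard_of_injOn (fun a : Fin M => τ - d - a) ?_ ?_ (Set.finite_Iio _)
        · rintro a ⟨i, hi, d', hd', h⟩
          obtain rfl := hd.unique hd'
          simp only [Set.mem_Iio]
          omega
        · rintro a ⟨i, hi, d', hd', h⟩ b ⟨i', hi', d'', hd'', h'⟩ hab
          obtain rfl := hd.unique hd'
          obtain rfl := hd.unique hd''
          simp only at hab
          exact Fin.ext (by omega)
      · rw [show {a : Fin M | ∃ i < len v, ∃ d, Visits E v (ok v) d y ∧ a + i + d = (τ : ℕ)} = ∅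
          from Set.eq_empty_of_forall_notMem fun a ⟨i, _, d, hd, _⟩ => hv ⟨d, hd⟩]
        simp
    · rw [← Set.ncard_coe_finset] at hx
      convert hx using 2
      ext v
      simp [loadSet]
  refine (Rare.exists key).mono (fun x hx => ?_) le_rfl
  unfold LoadBounded at hx
  push Not at hx
  obtain ⟨τ, y, h⟩ := hx
  -- An overloaded step has at least one arrival, so only steps up to `T` enter the union bound.
  have hτ : τ < T + 1 := by
    obtain ⟨v, hv⟩ := Finset.card_pos.1 ((Nat.zero_le L).trans_lt h)
    obtain ⟨i, hi, d, hd, rfl⟩ := (Finset.mem_filter.1 hv).2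
    exact Nat.lt_succ_of_le (hT v (x v) i hi d y hd.accepted)
  exact ⟨(⟨τ, hτ⟩, y), h⟩

/-- An upper bound of the size of a random sample. -/
theorem rare_le_ncard (hM : 0 < M) (A : Set V) (m K : ℕ) {μ : ℝ} (hμ : (A.ncard * m : ℝ) ≤ μ * M) :
    Rare (fun x : V → Fin M => K ≤ {v | v ∈ A ∧ (x v : ℕ) < m}.ncard) (Real.exp μ / 2 ^ K) := by
  classical
  have : NeZero M := ⟨hM.ne'⟩
  refine rare_ncard_ge (fun v (a : Fin M) => v ∈ A ∧ (a : ℕ) < m) (μ := μ) ?_ K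
  rw [Fintype.card_fin]
  refine le_trans ?_ hμ
  have h1 : ∀ v, ({a : Fin M | v ∈ A ∧ (a : ℕ) < m}.ncard : ℝ) ≤ if v ∈ A then (m : ℝ) else 0 := by
    intro v
    split_ifs with hv
    · have := Fin.card_filter_val_lt (n := M) (m := m)
      rw [Set.ncard_eq_toFinset_card']
      simp only [hv, true_and, Set.toFinset_ofPred]
      exact_mod_cast (by omega)
    · simp [hv]
  refine (Finset.sum_le_sum fun v _ => h1 v).trans (le_of_eq ?_)
  rw [← Finset.sum_filter, Finset.sum_const, nsmul_eq_mul, Set.ncard_eq_toFinset_card']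
  congr 3
  ext v
  simp

/-- It is unlikely that one of few large sets is missed by a random sample. -/
theorem rare_exists_miss {ι : Type*} [Fintype ι] (hM : 0 < M) (m K : ℕ) (W : ι → Set V) :
    Rare (fun x : V → Fin M => ∃ i, K ≤ (W i).ncard ∧ ∀ v ∈ W i, m ≤ (x v : ℕ))
      (Fintype.card ι * Real.exp (-(m * K / M : ℝ))) := by
  classical
  refine Rare.exists fun i => ?_
  by_cases hK : K ≤ (W i).ncard
  · refine (rare_miss hM m (W i).toFinset).mono (fun x hx v hv => hx.2 v (by simpa using hv)) ?_
    rw [Set.ncard_eq_toFinset_card'] at hK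
    rw [Real.exp_le_exp, neg_le_neg_iff]
    gcongr
  · exact rare_false (Real.exp_pos _).le fun x hx => hK hx.1

end Rarity

theorem sum_unitLen {V : Type*} [Fintype V] (X : Set V) (W : Finset V) :
    ∑ v ∈ W, (unitLen X v : ℝ) = ((X ∩ W).ncard : ℝ) := by
  classical
  unfold unitLen
  push_cast
  rw [Finset.sum_ite, Finset.sum_const_zero, add_zero, Finset.sum_const, nsmul_eq_mul, mul_one,
    Set.ncard_eq_toFinset_card']
  congr 2
  ext v
  simp [and_comm]

namespace DirectedNetwork

variable {V : Type*} [Fintype V] (N : DirectedNetwork V) (P : GirthParams)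

/-- If there is a shortest cycle that is long, then the sample hits all windows of length `w` of
such a cycle. -/
def HitsWindows (w : ℕ) (S : Set V) : Prop :=
  ∀ g : ℕ, directedGirth N.graph = g → (Fintype.card V : ℝ) ^ (2 / 3 : ℝ) ≤ g →
    ∃ c : ℕ → V, (∀ i, N.graph.Adj (c i) (c (i + 1))) ∧ (∀ i, c (i + g) = c i) ∧
      ∀ i, ∃ j, i < j ∧ j ≤ i + w ∧ c j ∈ S

/-- The properties of the sample that are needed for correctness and speed. -/
structure GoodSample (w β K : ℕ) (S : Set V) : Prop where
  ncard_le : S.ncard ≤ K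
  hitsWindows : N.HitsWindows w S
  hitsSurvivors : ∀ v (R : List V), R.length ≤ P.pivots →
    β ≤ (survivors N.graph.Adj P.cutoff v R).ncard → ∃ s ∈ S, s ∈ survivors N.graph.Adj P.cutoff v R

variable {N P} {M : ℕ}

/-- Fix one shortest cycle. By periodicity it has only g ≤ n windows, and each consists of w
distinct vertices because w ≤ g. -/
theorem rare_not_hitsWindows (hM : 0 < M) (m : ℕ) {w : ℕ}
    (hw : (w : ℝ) ≤ (Fintype.card V : ℝ) ^ (2 / 3 : ℝ)) :
    Rare (fun x : V → Fin M => ¬ N.HitsWindows w {v | (x v : ℕ) < m})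
      (Fintype.card V * Real.exp (-(m * w / M : ℝ))) := by
  classical
  by_cases hex : ∃ g : ℕ, directedGirth N.graph = g ∧ (Fintype.card V : ℝ) ^ (2 / 3 : ℝ) ≤ g
  · obtain ⟨g, hg, hng⟩ := hex
    obtain ⟨hg1, c, hc, hper, hinj⟩ := exists_shortest_cycle N.graph hg
    have hwg : w ≤ g := by exact_mod_cast hw.trans hng
    have hgn : g ≤ Fintype.card V := by
      rw [← Fintype.card_fin g]
      refine Fintype.card_le_of_injective (fun i : Fin g => c i) fun i j hij => Fin.ext ?_
      rcases Nat.le_total i j with h | h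
      · exact hinj _ _ h (by omega) hij
      · exact (hinj _ _ h (by omega) hij.symm).symm
    refine (rare_exists_miss (ι := Fin g) hM m w
      fun i => c '' Set.Ioc (i : ℕ) (i + w)).mono (fun x hx => ?_) ?_
    · by_contra hno
      push Not at hno
      refine hx fun g' hg' _ => ?_
      obtain rfl : g' = g := by
        rw [hg] at hg'
        exact_mod_cast hg'.symm
      have hmul : ∀ k i, c (i + g' * k) = c i := by
        intro k
        induction k with
        | zero => intro i; rfl
        | succ k ih => intro i; rw [Nat.mul_succ, ← Nat.add_assoc, hper, ih]
      refine ⟨c, hc, hper, fun i => ?_⟩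
      have hcard : w ≤ (c '' Set.Ioc (i % g' : ℕ) (i % g' + w)).ncard := by
        rw [Set.InjOn.ncard_image, Set.ncard_eq_toFinset_card']
        · simp
        · intro a ha b hb hab
          simp only [Set.mem_Ioc] at ha hb
          rcases Nat.le_total a b with h | h
          · exact hinj _ _ h (by omega) hab
          · exact (hinj _ _ h (by omega) hab.symm).symm
      obtain ⟨v, ⟨j, hj, rfl⟩, hv⟩ := hno ⟨i % g', Nat.mod_lt _ hg1⟩ hcard
      simp only [Set.mem_Ioc] at hj
      have hdiv := Nat.mod_add_div i g'
      refine ⟨j + g' * (i / g'), by omega, by omega, ?_⟩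
      rw [hmul]
      exact hv
    · rw [Fintype.card_fin]
      gcongr
  · refine rare_false (by positivity) fun x hx => hx fun g hg hng => ?_
    exact absurd ⟨g, hg, hng⟩ hex

/-- The pivots depend on the sample, so survivor sets must be hit for all short pivot lists at once.
Padding a list with `none` encodes it as a function into `Option V`, which bounds the number of sets
in the union bound. -/
theorem rare_not_goodSample (hM : 0 < M) (m : ℕ) {w β K : ℕ} {μ : ℝ}
    (hw : (w : ℝ) ≤ (Fintype.card V : ℝ) ^ (2 / 3 : ℝ))
    (hμ : (Fintype.card V * m : ℝ) ≤ μ * M) :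
    Rare (fun x : V → Fin M => ¬ N.GoodSample P w β K {v | (x v : ℕ) < m})
      (Real.exp μ / 2 ^ (K + 1) + Fintype.card V * Real.exp (-(m * w / M : ℝ)) +
        Fintype.card (V × (Fin P.pivots → Option V)) * Real.exp (-(m * β / M : ℝ))) := by
  classical
  have h1 := rare_le_ncard hM (Set.univ : Set V) m (K + 1) (μ := μ) (by
    rwa [Set.ncard_univ, Nat.card_eq_fintype_card])
  have h2 := rare_not_hitsWindows (N := N) hM m hw
  have h3 := rare_exists_miss (ι := V × (Fin P.pivots → Option V)) hM m β
    fun a => survivors N.graph.Adj P.cutoff a.1 (List.ofFn a.2).reduceOption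
  refine ((h1.or h2).or h3).mono (fun x hx => ?_) le_rfl
  by_contra hno
  push Not at hno
  obtain ⟨⟨h1, h2⟩, h3⟩ := hno
  refine hx ⟨?_, h2, fun v R hR hβ => ?_⟩
  · simp only [Set.mem_univ, true_and] at h1
    omega
  · have hsur : survivors N.graph.Adj P.cutoff v
        (List.ofFn fun i : Fin P.pivots => R[(i : ℕ)]?).reduceOption =
        survivors N.graph.Adj P.cutoff v R := by
      have hmem : ∀ t, t ∈ (List.ofFn fun i : Fin P.pivots => R[(i : ℕ)]?).reduceOption ↔ t ∈ R := by
        intro t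
        rw [List.reduceOption_mem_iff, List.mem_ofFn]
        constructor
        · rintro ⟨i, hi⟩
          exact List.mem_of_getElem? hi
        · intro ht
          obtain ⟨i, hi, h⟩ := List.getElem_of_mem ht
          exact ⟨⟨i, hi.trans_le hR⟩, by simp [hi, h]⟩
      simp only [survivors, hmem]
    obtain ⟨s, hs, hlt⟩ := h3 (v, fun i => R[(i : ℕ)]?) (by rwa [hsur])
    exact ⟨s, hlt, by rwa [hsur] at hs⟩

/-! ## Sizes of the explorations -/

variable [Nonempty V] {S : Set V} {u : ℕ → V → ℕ} {w β K : ℕ}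

/-- The chosen pivots prune every sampled node nearby, so no sampled node survives; a good sample
would have hit a survivor set of size β. -/
theorem GoodSample.ncard_survivors_lt (hS : N.GoodSample P w β K S)
    (hk : Fintype.card V < 2 ^ P.pivots) (v : V) :
    (survivors N.graph.Adj P.cutoff v (N.pivotList P S v)).ncard < β := by
  by_contra hle
  obtain ⟨s, hs, hs'⟩ := hS.hitsSurvivors v _ (length_pivotList_le hk v) (not_lt.1 hle)
  exact disjoint_survivors (fun s hs hsv hlt => exists_pivot hk hs hsv hlt) s hs hs'

theorem ncard_visited_le (hS : N.GoodSample P w β K S) (hk : Fintype.card V < 2 ^ P.pivots)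
    (hdepth : 0 < P.depth) (X : Set V) : (N.visited P S X).ncard ≤ X.ncard * β := by
  classical
  have hsub : N.visited P S X ⊆ ⋃ v ∈ X.toFinset,
      insert v (survivors N.graph.Adj P.cutoff v (N.pivotList P S v)) := by
    rintro y (hy | ⟨v, hv, d, hd⟩)
    · exact Set.mem_iUnion₂.2 ⟨y, by simpa using hy, Set.mem_insert _ _⟩
    · refine Set.mem_iUnion₂.2 ⟨v, by simpa using hv, ?_⟩
      exact hd.eq_or_mem_survivors (by unfold GirthParams.cutoff; omega)
  refine (Set.ncard_le_ncard hsub (Set.toFinite _)).trans ?_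
  refine (Finset.set_ncard_biUnion_le _ _).trans ?_
  rw [Set.ncard_eq_toFinset_card', ← smul_eq_mul]
  refine Finset.sum_le_card_nsmul _ _ _ fun v _ => ?_
  have := Set.ncard_insert_le v (survivors N.graph.Adj P.cutoff v (N.pivotList P S v))
  have := hS.ncard_survivors_lt hk v
  omega

/-- The sources of `A` whose exploration visits `y`. -/
def visitors (N : DirectedNetwork V) (P : GirthParams) (S A : Set V) (y : V) : Set V :=
  {v | v ∈ A ∧ ∃ d, Visits N.graph.Adj v (N.test P S ∅ v) d y}

/-- Every node that is visited by many explorations from `A` is visited from the sample `X`. -/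
def HitsHeavy (N : DirectedNetwork V) (P : GirthParams) (S A X : Set V) (W : ℕ) : Prop :=
  ∀ y, W ≤ (N.visitors P S A y).ncard → ∃ v ∈ X, v ∈ N.visitors P S A y

theorem rare_not_hitsHeavy (hM : 0 < M) (A : Set V) (W : ℕ) :
    Rare (fun x : V → Fin M => ¬ N.HitsHeavy P S A {v | v ∈ A ∧ (x v : ℕ) = 0} W)
      (Fintype.card V * Real.exp (-(W / M : ℝ))) := by
  have := rare_exists_miss (ι := V) hM 1 W (N.visitors P S A)
  rw [Nat.cast_one, one_mul] at this
  refine this.mono (fun x hx => ?_) le_rfl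
  by_contra hno
  push Not at hno
  refine hx fun y hy => ?_
  obtain ⟨v, hv, hlt⟩ := hno y hy
  exact ⟨v, ⟨hv.1, by omega⟩, hv⟩

end DirectedNetwork

/-! ## The random numbers of all stages -/

/-- The random numbers of the nodes, extended by zero to all stages. -/
def coinValue {V : Type*} {s M : ℕ} (r : Fin s → V → Fin M) (k : ℕ) (v : V) : ℕ :=
  if h : k < s then r ⟨k, h⟩ v else 0

theorem coinValue_le {V : Type*} {s M : ℕ} (r : Fin s → V → Fin M) (k : ℕ) (v : V) :
    coinValue r k v ≤ M := by
  unfold coinValue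
  split_ifs
  · exact (r _ v).2.le
  · exact Nat.zero_le _

theorem rare_stage {V : Type*} [Finite V] {s M : ℕ} {i : ℕ} (hi : i < s)
    {E : (ℕ → V → ℕ) → Prop} {ε : ℝ}
    (h : ∀ u : ℕ → V → ℕ, Rare (fun x : V → Fin M => E (Function.update u i fun v => x v)) ε) :
    Rare (fun r : Fin s → V → Fin M => E (coinValue r)) ε := by
  refine Rare.of_update ⟨i, hi⟩ fun r => (h (coinValue r)).mono (fun x hx => ?_) le_rfl
  convert hx using 1
  funext k v
  unfold coinValue
  rcases eq_or_ne k i with rfl | hk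
  · simp [hi]
  · simp [hk]

/-- A substitute for conditioning on other stages: by `hG`, the guard cannot be created by
resampling stage `i`. Freeze the other stages; either the guard fails and the event is impossible,
or the bound `h` applies. -/
theorem rare_stage_of_guard {V : Type*} [Finite V] {s M : ℕ} {i : ℕ} (hi : i < s)
    {G E : (ℕ → V → ℕ) → Prop} {ε : ℝ} (hε : 0 ≤ ε)
    (hG : ∀ u x, G (Function.update u i x) → G u)
    (h : ∀ u, G u → Rare (fun x : V → Fin M => ¬ E (Function.update u i fun v => x v)) ε) :
    Rare (fun r : Fin s → V → Fin M => G (coinValue r) ∧ ¬ E (coinValue r)) ε := by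
  refine rare_stage hi (E := fun u => G u ∧ ¬ E u) fun u => ?_
  by_cases hu : G u
  · exact (h u hu).mono (fun _ hx => hx.2) le_rfl
  · exact rare_false hε fun _ hx => hu (hG _ _ hx.1)

namespace DirectedNetwork

variable {V : Type*} (N : DirectedNetwork V) (P : GirthParams)

/-- The nodes sampled in the first stage. -/
def sample (P : GirthParams) (u : ℕ → V → ℕ) : Set V := {v | u 0 v < P.threshold}

/-- The random numbers lead to a short run with a correct result. -/
structure GoodCoins [Fintype V] [Nonempty V] (w β K : ℕ) (u : ℕ → V → ℕ) : Prop where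
  goodSample : N.GoodSample P w β K (sample P u)
  loadsBounded : N.LoadsBounded P u (sample P u)

variable {N P}

theorem active_congr [Nonempty V] {S : Set V} {u u' : ℕ → V → ℕ} {j : ℕ}
    (h : ∀ i < j, u (4 + 3 * i) = u' (4 + 3 * i)) : N.active P S u j = N.active P S u' j := by
  induction j with
  | zero => rfl
  | succ j ih =>
    simp only [active]
    rw [ih fun i hi => h i (hi.trans j.lt_succ_self), h j j.lt_succ_self]

theorem active_update [Nonempty V] {S : Set V} (u : ℕ → V → ℕ) {i j : ℕ} (x : V → ℕ)
    (h : ∀ i' < j, 4 + 3 * i' ≠ i) :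
    N.active P S (Function.update u i x) j = N.active P S u j :=
  active_congr fun i' hi' => Function.update_of_ne (h i' hi') _ _

theorem selected_update [Nonempty V] {S : Set V} (u : ℕ → V → ℕ) {i j : ℕ} (x : V → ℕ)
    (h : ∀ i' ≤ j, 4 + 3 * i' ≠ i) :
    N.selected P S (Function.update u i x) j = N.selected P S u j := by
  unfold selected
  rw [active_update u x fun i' hi' => h i' hi'.le, Function.update_of_ne (h j le_rfl)]

theorem sample_update (u : ℕ → V → ℕ) {i : ℕ} (x : V → ℕ) (h : i ≠ 0) :
    sample P (Function.update u i x) = sample P u := by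
  unfold sample
  rw [Function.update_of_ne h.symm]

end DirectedNetwork

/-- The relations between the parameters that make bad events rare. -/
structure GirthParams.Tuned (P : GirthParams) (n M K w β W l : ℕ) (μ₀ μ ε : ℝ) : Prop where
  range_pos : 0 < M
  card_lt : n < 2 ^ P.pivots
  depth_pos : 0 < P.depth
  window_le : (w : ℝ) ≤ (n : ℝ) ^ (2 / 3 : ℝ)
  four_mul_le : 4 * β ≤ M
  range_add_le : M + K + P.cutoff + P.diam ≤ P.time
  mul_self_le : (K * K : ℝ) ≤ μ * M
  selected_le : 2 * ((n + 2 * (l + 1) * β) / M) + l + 1 ≤ μ * M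
  heavy_le : (W : ℝ) ≤ μ * M
  last_le : (n : ℝ) / 2 ^ P.iterations + 2 * (l + 1) * β ≤ μ * M
  mul_threshold_le : (n * P.threshold : ℝ) ≤ μ₀ * M
  sample_rare : Real.exp μ₀ / 2 ^ (K + 1) + n * Real.exp (-(P.threshold * w / M : ℝ)) +
    (n * (n + 1) ^ P.pivots : ℕ) * Real.exp (-(P.threshold * β / M : ℝ)) ≤ ε
  selected_rare : 1 / 2 ^ l + n * Real.exp (-(W / M : ℝ)) ≤ ε
  load_rare : ((P.time + 1) * n : ℕ) * (Real.exp μ / 2 ^ (P.load + 1)) ≤ ε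

namespace DirectedNetwork

/-! ### Failure probabilities of the individual stages -/

section Stages

variable {V : Type*} [Fintype V] {N : DirectedNetwork V} {P : GirthParams}
  {M K w β W l : ℕ} {μ₀ μ ε : ℝ}

theorem rare_load (hP : P.Tuned (Fintype.card V) M K w β W l μ₀ μ ε) {E : V → V → Prop}
    {len : V → ℕ} {ok : V → V → ℕ → Prop}
    (hT : ∀ v, ∀ i < len v, ∀ d y, ok v y d → i + d ≤ K + P.cutoff + P.diam)
    (hμ : ∀ y, ∀ W : Finset V, (∀ v ∈ W, ∃ d, Visits E v (ok v) d y) →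
      (∑ v ∈ W, (len v : ℝ)) ≤ μ * M) :
    Rare (fun x : V → Fin M => ¬ LoadBounded E len (fun v => x v) ok P.load) ε := by
  refine (rare_not_loadBounded (T := P.time) hP.range_pos (fun v a i hi d y h => ?_) hμ).mono
    (fun _ => id) ?_
  · have := hT v i hi d y h
    have := a.2
    have := hP.range_add_le
    omega
  · refine le_of_eq_of_le ?_ hP.load_rare
    simp

theorem rare_load_unit (hP : P.Tuned (Fintype.card V) M K w β W l μ₀ μ ε) {E : V → V → Prop}
    {X : Set V} {ok : V → V → ℕ → Prop} (hok : ∀ v d y, ok v y d → d ≤ P.cutoff)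
    (hX : ∀ y, ({v | v ∈ X ∧ ∃ d, Visits E v (ok v) d y}.ncard : ℝ) ≤ μ * M) :
    Rare (fun x : V → Fin M => ¬ LoadBounded E (unitLen X) (fun v => x v) ok P.load) ε := by
  refine rare_load hP (fun v i hi d y h => ?_) fun y A hA => ?_
  · have := hok v d y h
    have : unitLen X v ≤ 1 := by unfold unitLen; split_ifs <;> simp
    omega
  · rw [sum_unitLen]
    refine le_trans ?_ (hX y)
    have hsub : X ∩ A ⊆ {v | v ∈ X ∧ ∃ d, Visits E v (ok v) d y} :=
      fun v hv => ⟨hv.1, hA v hv.2⟩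
    exact_mod_cast Set.ncard_le_ncard hsub (Set.toFinite _)

theorem rare_load_of_ncard_le (hP : P.Tuned (Fintype.card V) M K w β W l μ₀ μ ε)
    {E : V → V → Prop} {X : Set V} {ok : V → V → ℕ → Prop}
    (hok : ∀ v d y, ok v y d → d ≤ P.cutoff) (hX : (X.ncard : ℝ) ≤ μ * M) :
    Rare (fun x : V → Fin M => ¬ LoadBounded E (unitLen X) (fun v => x v) ok P.load) ε :=
  rare_load_unit hP hok fun _ => le_trans
    (Nat.cast_le.2 (Set.ncard_le_ncard (Set.sep_subset X _) (Set.toFinite _))) hX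

theorem le_mul_of_le (hP : P.Tuned (Fintype.card V) M K w β W l μ₀ μ ε) {m : ℕ} (h : m ≤ K) :
    (m : ℝ) ≤ μ * M :=
  le_trans (by exact_mod_cast h.trans (Nat.le_mul_self K)) hP.mul_self_le

variable [Nonempty V]

omit [Fintype V] in
theorem test_le_cutoff {S blk : Set V} (v : V) (d : ℕ) (y : V) (h : N.test P S blk v y d) :
    d ≤ P.cutoff := by
  have := h.1
  unfold GirthParams.cutoff
  omega

omit [Fintype V] in
theorem test_mono {S blk : Set V} {v y : V} {d d' : ℕ} (hd : d' ≤ d) (h : N.test P S blk v y d) :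
    N.test P S ∅ v y d' := by
  refine ⟨hd.trans h.1, h.2.imp_right fun h' => ⟨Set.notMem_empty _, fun t ht => ?_⟩⟩
  have := h'.2 t ht
  omega

/-- At most K nodes hold at most K rows each, and K² ≤ μM. The load is therefore bounded even though
every row visits every node. -/
theorem rare_load_rows (hP : P.Tuned (Fintype.card V) M K w β W l μ₀ μ ε) {S : Set V}
    (hS : S.ncard ≤ K) :
    Rare (fun x : V → Fin M => ¬ LoadBounded N.comm.Adj (fun v => (N.rowItems P S v).length)
      (fun v => x v) (fun _ _ d => d ≤ P.diam) P.load) ε := by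
  classical
  have hlen := fun v => (length_rowItems_le (N := N) (P := P) (S := S) v).trans hS
  refine rare_load hP (fun v i hi d y h => ?_) fun y A _ => ?_
  · have := hlen v
    omega
  · refine le_trans ?_ hP.mul_self_le
    norm_cast
    have h1 : ∀ v ∈ A, (N.rowItems P S v).length ≤ if v ∈ S then K else 0 := by
      intro v _
      split_ifs with hv
      · exact hlen v
      · simp [rowItems, hv]
    refine (Finset.sum_le_sum h1).trans ?_
    rw [← Finset.sum_filter, Finset.sum_const, smul_eq_mul]
    refine Nat.mul_le_mul_right K (le_trans ?_ hS)
    rw [← Set.ncard_coe_finset]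
    exact Set.ncard_le_ncard (fun v hv => (Finset.mem_filter.1 hv).2) (Set.toFinite _)

/-- A blocked node accepts none of these explorations, since it is not a source. A node that is not
blocked is wanted by fewer than W active explorations, for otherwise the sample `X` would have
visited it; blocking only shrinks explorations. -/
theorem rare_load_active (hP : P.Tuned (Fintype.card V) M K w β W l μ₀ μ ε) {S A X : Set V}
    (hH : N.HitsHeavy P S A X W) :
    Rare (fun x : V → Fin M => ¬ LoadBounded N.graph.Adj (unitLen (A \ N.visited P S X))
      (fun v => x v) (N.test P S (N.visited P S X)) P.load) ε := by
  refine rare_load_unit hP (fun v d y => test_le_cutoff v d y) fun y => ?_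
  refine le_trans ?_ hP.heavy_le
  norm_cast
  by_cases hy : y ∈ N.visited P S X
  · refine le_of_eq_of_le ?_ (Nat.zero_le _)
    rw [Set.ncard_eq_zero (Set.toFinite _)]
    refine Set.eq_empty_of_forall_notMem fun v ⟨hv, d, hd⟩ => ?_
    rcases hd.accepted.2 with rfl | h
    · exact hv.2 hy
    · exact h.1 hy
  · by_contra hlt
    refine hy ?_
    have hsub : {v | v ∈ A \ N.visited P S X ∧ ∃ d, Visits N.graph.Adj v
        (N.test P S (N.visited P S X) v) d y} ⊆ N.visitors P S A y := by
      rintro v ⟨hv, d, hd⟩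
      obtain ⟨d', -, hd'⟩ := hd.mono (fun _ _ _ hle h => test_mono hle h)
        (ok' := N.test P S ∅ v) (fun _ _ h => test_mono le_rfl h)
      exact ⟨hv.1, d', hd'⟩
    obtain ⟨v, hv, hv'⟩ :=
      hH y ((not_le.1 hlt).le.trans (Set.ncard_le_ncard hsub (Set.toFinite _)))
    exact Or.inr ⟨v, hv, hv'.2⟩

/-- An upper bound of the number of nodes that take part in the `j`-th iteration. -/
def FewActive (N : DirectedNetwork V) (P : GirthParams) (l β : ℕ) (S : Set V) (u : ℕ → V → ℕ)
    (j : ℕ) : Prop :=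
  ((N.active P S u j).ncard : ℝ) ≤ (Fintype.card V : ℝ) / 2 ^ j + 2 * (l + 1) * β

/-- An upper bound of the number of nodes that are selected in the `j`-th iteration. -/
def FewSelected (N : DirectedNetwork V) (P : GirthParams) (l β M : ℕ) (S : Set V)
    (u : ℕ → V → ℕ) (j : ℕ) : Prop :=
  ((N.selected P S u j).ncard : ℝ) ≤
    2 * (((Fintype.card V : ℝ) / 2 ^ j + 2 * (l + 1) * β) / M) + l + 1

/-- Each selected node activates at most β nodes, and 4β ≤ M turns the bound B into B/2 + (l + 1)β.
The additive term 2(l + 1)β of `FewActive` is the fixed point of this recursion. -/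
theorem FewSelected.fewActive (hP : P.Tuned (Fintype.card V) M K w β W l μ₀ μ ε) {S : Set V}
    {u : ℕ → V → ℕ} {j : ℕ} (hS : N.GoodSample P w β K S)
    (h : N.FewSelected P l β M S u j) : N.FewActive P l β S u (j + 1) := by
  have h1 : ((N.active P S u (j + 1)).ncard : ℝ) ≤ (N.selected P S u j).ncard * β := by
    exact_mod_cast ncard_visited_le hS hP.card_lt hP.depth_pos _
  have hM : (0 : ℝ) < M := by exact_mod_cast hP.range_pos
  have h4 : (4 * β : ℝ) ≤ M := by exact_mod_cast hP.four_mul_le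
  unfold FewSelected at h
  unfold FewActive
  set B : ℝ := (Fintype.card V : ℝ) / 2 ^ j + 2 * (l + 1) * β with hB
  have hB0 : 0 ≤ B := by positivity
  have h2 : B / M * β ≤ B / 4 := by
    rw [div_mul_eq_mul_div, div_le_iff₀ hM]
    nlinarith
  calc _ ≤ _ := h1
    _ ≤ (2 * (B / M) + l + 1) * β := mul_le_mul_of_nonneg_right h (Nat.cast_nonneg _)
    _ = 2 * (B / M * β) + (l + 1) * β := by ring
    _ ≤ B / 2 + (l + 1) * β := by linarith
    _ = _ := by rw [hB, pow_succ]; ring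

theorem FewSelected.ncard_le (hP : P.Tuned (Fintype.card V) M K w β W l μ₀ μ ε) {S : Set V}
    {u : ℕ → V → ℕ} {j : ℕ} (h : N.FewSelected P l β M S u j) :
    ((N.selected P S u j).ncard : ℝ) ≤ μ * M := by
  refine h.trans (le_trans ?_ hP.selected_le)
  gcongr
  exact div_le_self (Nat.cast_nonneg _) (one_le_pow₀ one_le_two)

omit [Nonempty V] in
theorem rare_not_fewSelected (hP : P.Tuned (Fintype.card V) M K w β W l μ₀ μ ε) (A : Set V)
    {B : ℝ} (hA : (A.ncard : ℝ) ≤ B) :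
    Rare (fun x : V → Fin M => ¬ (({v | v ∈ A ∧ (x v : ℕ) = 0}.ncard : ℝ) ≤
      2 * (B / M) + l + 1)) (1 / 2 ^ l) := by
  have hM : (0 : ℝ) < M := by exact_mod_cast hP.range_pos
  have hB : 0 ≤ B / M := div_nonneg ((Nat.cast_nonneg _).trans hA) hM.le
  refine (rare_le_ncard hP.range_pos A 1 (⌈2 * (B / M)⌉₊ + l) (μ := B / M) ?_).mono
    (fun x hx => ?_) ?_
  · rw [div_mul_cancel₀ _ hM.ne']
    simpa using hA
  · by_contra hno
    refine hx ?_
    simp only [Nat.lt_one_iff, not_le] at hno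
    have h1 : (({v | v ∈ A ∧ (x v : ℕ) = 0}.ncard : ℕ) : ℝ) ≤ ⌈2 * (B / M)⌉₊ + l := by
      exact_mod_cast hno.le
    have := Nat.ceil_lt_add_one (a := 2 * (B / M)) (by positivity)
    linarith
  · rw [pow_add, ← div_div]
    refine div_le_div_of_nonneg_right ?_ (by positivity)
    rw [div_le_one (by positivity)]
    -- Since e ≤ 4, the exponential is at most 2 ^ (2B/M), which the rounded-up part of the
    -- threshold cancels; l halvings remain.
    have h2 : Real.exp (B / M) ≤ 4 ^ (B / M) := by
      rw [← Real.exp_one_rpow]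
      exact Real.rpow_le_rpow (Real.exp_pos _).le (Real.exp_one_lt_d9.le.trans (by norm_num)) hB
    refine h2.trans ?_
    rw [show (4 : ℝ) = 2 ^ (2 : ℝ) by norm_num, ← Real.rpow_mul (by norm_num),
      ← Real.rpow_natCast]
    exact Real.rpow_le_rpow_of_exponent_le (by norm_num) (Nat.le_ceil _)

theorem rare_stage_selected (hP : P.Tuned (Fintype.card V) M K w β W l μ₀ μ ε) {j : ℕ} {S : Set V}
    (u : ℕ → V → ℕ) (h : N.FewActive P l β S u j) :
    Rare (fun x : V → Fin M =>
      ¬ (N.FewSelected P l β M S (Function.update u (4 + 3 * j) fun v => x v) j ∧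
        N.HitsHeavy P S (N.active P S u j)
          (N.selected P S (Function.update u (4 + 3 * j) fun v => x v) j) W)) ε := by
  refine ((rare_not_fewSelected hP _ h).or
    (rare_not_hitsHeavy (N := N) (P := P) (S := S) hP.range_pos
      (N.active P S u j) W)).mono (fun x hx => ?_)
    hP.selected_rare
  have hsel : N.selected P S (Function.update u (4 + 3 * j) fun v => x v) j =
      {v | v ∈ N.active P S u j ∧ (x v : ℕ) = 0} := by
    unfold selected
    rw [active_update _ _ fun _ _ => by omega]
    simp
  rw [FewSelected, hsel] at hx
  exact not_and_or.1 hx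

end Stages

/-! ### Union bound over all stages -/

section Combination

variable {V : Type*} [Fintype V] [Nonempty V] {N : DirectedNetwork V} {P : GirthParams}
  {M K w β W l : ℕ} {μ₀ μ ε : ℝ}

/-- Each stage fails with probability at most ε given its guard. The guards are supplied
inductively: few active nodes make the selection small and hit all heavy nodes, and a small
selection with a good sample leaves few active nodes in the next iteration. -/
theorem rare_not_goodCoins (hP : P.Tuned (Fintype.card V) M K w β W l μ₀ μ ε) :
    Rare (fun r : Fin P.stages → V → Fin M => ¬ N.GoodCoins P w β K (coinValue r))
      (P.stages * ε) := by
  have hst : P.stages = 5 + 3 * P.iterations := rfl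
  have hε : 0 ≤ ε := le_trans (by positivity) hP.selected_rare
  have h0 : Rare (fun r : Fin P.stages → V → Fin M =>
      ¬ N.GoodSample P w β K (sample P (coinValue r))) ε := by
    refine rare_stage (i := 0) (by omega)
      (E := fun u => ¬ N.GoodSample P w β K (sample P u)) fun u => ?_
    refine (rare_not_goodSample (N := N) (P := P) (K := K) (β := β) hP.range_pos P.threshold hP.window_le
      hP.mul_threshold_le).mono (fun x hx => ?_) ?_
    · simpa [sample] using hx
    · refine le_of_eq_of_le ?_ hP.sample_rare
      simp
  have h1 := rare_stage_of_guard (V := V) (M := M) (i := 1) (s := P.stages) (by omega)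
    (G := fun u => N.GoodSample P w β K (sample P u))
    (E := fun u => LoadBounded N.graph.Adj (unitLen (sample P u)) (u 1)
      (fun _ _ d => d ≤ P.cutoff) P.load) hε
    (fun u x => by rw [sample_update u x (by omega)]; exact id) fun u hu => by
      simp only [sample_update u _ one_ne_zero, Function.update_self]
      exact rare_load_of_ncard_le hP (fun _ _ _ => id) (le_mul_of_le hP hu.ncard_le)
  have h2 := rare_stage_of_guard (V := V) (M := M) (i := 2) (s := P.stages) (by omega)
    (G := fun u => N.GoodSample P w β K (sample P u))
    (E := fun u => LoadBounded (fun x y => N.graph.Adj y x) (unitLen (sample P u)) (u 2)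
      (fun _ _ d => d ≤ P.cutoff) P.load) hε
    (fun u x => by rw [sample_update u x (by omega)]; exact id) fun u hu => by
      simp only [sample_update u _ two_ne_zero, Function.update_self]
      exact rare_load_of_ncard_le hP (fun _ _ _ => id) (le_mul_of_le hP hu.ncard_le)
  have h3 := rare_stage_of_guard (V := V) (M := M) (i := 3) (s := P.stages) (by omega)
    (G := fun u => N.GoodSample P w β K (sample P u))
    (E := fun u => LoadBounded N.comm.Adj (fun v => (N.rowItems P (sample P u) v).length) (u 3)
      (fun _ _ d => d ≤ P.diam) P.load) hε
    (fun u x => by rw [sample_update u x (by omega)]; exact id) fun u hu => by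
      simp only [sample_update u _ three_ne_zero, Function.update_self]
      exact rare_load_rows hP hu.ncard_le
  have h4 (j : Fin P.iterations) := rare_stage_of_guard (V := V) (M := M) (i := 4 + 3 * j)
    (s := P.stages) (by omega) (G := fun u => N.FewActive P l β (sample P u) u j)
    (E := fun u => N.FewSelected P l β M (sample P u) u j ∧
      N.HitsHeavy P (sample P u) (N.active P (sample P u) u j) (N.selected P (sample P u) u j) W)
    hε (fun u x => by
      unfold FewActive
      rw [sample_update u x (by omega), active_update _ _ fun _ _ => by omega]
      exact id) fun u hu => by
      have ha (x : V → ℕ) : N.active P (sample P u) (Function.update u (4 + 3 * (j : ℕ)) x) j =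
        N.active P (sample P u) u j := active_update _ _ fun _ _ => by omega
      have hs (x : V → ℕ) : sample P (Function.update u (4 + 3 * (j : ℕ)) x) = sample P u :=
        sample_update u x (by omega)
      simp only [hs, ha]
      exact rare_stage_selected hP u hu
  have h5 (j : Fin P.iterations) := rare_stage_of_guard (V := V) (M := M) (i := 5 + 3 * j)
    (s := P.stages) (by omega) (G := fun u => N.FewSelected P l β M (sample P u) u j)
    (E := fun u => LoadBounded N.graph.Adj (unitLen (N.selected P (sample P u) u j))
      (u (5 + 3 * j)) (N.test P (sample P u) ∅) P.load)
    hε (fun u x => by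
      unfold FewSelected
      rw [sample_update u x (by omega), selected_update _ _ fun _ _ => by omega]
      exact id) fun u hu => by
      have ha (x : V → ℕ) : N.selected P (sample P u) (Function.update u (5 + 3 * (j : ℕ)) x) j =
        N.selected P (sample P u) u j := selected_update _ _ fun _ _ => by omega
      have hs (x : V → ℕ) : sample P (Function.update u (5 + 3 * (j : ℕ)) x) = sample P u :=
        sample_update u x (by omega)
      simp only [hs, ha, Function.update_self]
      exact rare_load_of_ncard_le hP test_le_cutoff (hu.ncard_le hP)
  have h6 (j : Fin P.iterations) := rare_stage_of_guard (V := V) (M := M) (i := 6 + 3 * j)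
    (s := P.stages) (by omega) (G := fun u => N.HitsHeavy P (sample P u)
      (N.active P (sample P u) u j) (N.selected P (sample P u) u j) W)
    (E := fun u => LoadBounded N.graph.Adj (unitLen (N.active P (sample P u) u j \
      N.active P (sample P u) u (j + 1))) (u (6 + 3 * j))
      (N.test P (sample P u) (N.active P (sample P u) u (j + 1))) P.load)
    hε (fun u x => by
      rw [sample_update u x (by omega), selected_update _ _ fun _ _ => by omega,
        active_update _ _ fun _ _ => by omega]
      exact id) fun u hu => by
      have ha (x : V → ℕ) : N.active P (sample P u) (Function.update u (6 + 3 * (j : ℕ)) x) j =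
        N.active P (sample P u) u j := active_update _ _ fun _ _ => by omega
      have ha' (x : V → ℕ) : N.active P (sample P u) (Function.update u (6 + 3 * (j : ℕ)) x)
        (j + 1) = N.active P (sample P u) u (j + 1) := active_update _ _ fun _ _ => by omega
      have hs (x : V → ℕ) : sample P (Function.update u (6 + 3 * (j : ℕ)) x) = sample P u :=
        sample_update u x (by omega)
      simp only [hs, ha, ha', Function.update_self]
      exact rare_load_active hP hu
  have h7 := rare_stage_of_guard (V := V) (M := M) (i := 4 + 3 * P.iterations)
    (s := P.stages) (by omega) (G := fun u => N.FewActive P l β (sample P u) u P.iterations)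
    (E := fun u => LoadBounded N.graph.Adj (unitLen (N.active P (sample P u) u P.iterations))
      (u (4 + 3 * P.iterations)) (N.test P (sample P u) ∅) P.load)
    hε (fun u x => by
      unfold FewActive
      rw [sample_update u x (by omega), active_update _ _ fun _ _ => by omega]
      exact id) fun u hu => by
      have ha (x : V → ℕ) : N.active P (sample P u) (Function.update u (4 + 3 * P.iterations) x)
        P.iterations = N.active P (sample P u) u P.iterations :=
        active_update _ _ fun _ _ => by omega
      have hs (x : V → ℕ) : sample P (Function.update u (4 + 3 * P.iterations) x) = sample P u :=
        sample_update u x (by omega)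
      simp only [hs, ha, Function.update_self]
      exact rare_load_of_ncard_le hP test_le_cutoff (hu.trans hP.last_le)
  refine (((((h0.or h1).or h2).or h3).or h7).or
    (((Rare.exists h4).or (Rare.exists h5)).or (Rare.exists h6))).mono (fun r hr => ?_) ?_
  · by_contra hno
    simp only [not_or, not_exists, not_and, not_not] at hno
    obtain ⟨⟨⟨⟨⟨n0, n1⟩, n2⟩, n3⟩, n7⟩, ⟨n4, n5⟩, n6⟩ := hno
    have n4' (j : Fin P.iterations)
        (hj : N.FewActive P l β (sample P (coinValue r)) (coinValue r) j) :=
      not_not.1 (mt not_and.1 (n4 j hj))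
    have hact : ∀ j ≤ P.iterations, N.FewActive P l β (sample P (coinValue r)) (coinValue r) j := by
      intro j
      induction j with
      | zero =>
        intro _
        have : N.active P (sample P (coinValue r)) (coinValue r) 0 = Set.univ := rfl
        rw [FewActive, this, Set.ncard_univ, Nat.card_eq_fintype_card]
        simp only [pow_zero, div_one, le_add_iff_nonneg_right]
        positivity
      | succ j ih =>
        intro hj
        exact FewSelected.fewActive hP n0 (n4' ⟨j, hj⟩ (ih (by omega))).1
    refine hr ⟨n0, n1 n0, n2 n0, n3 n0, fun j hj => ?_, fun j hj => ?_, n7 (hact _ le_rfl)⟩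
    · exact n5 ⟨j, hj⟩ (n4' ⟨j, hj⟩ (hact j hj.le)).1
    · exact n6 ⟨j, hj⟩ (n4' ⟨j, hj⟩ (hact j hj.le)).2
  · rw [hst, Fintype.card_fin]
    push_cast
    linarith

end Combination

end DirectedNetwork

/-! ## The choice of the parameters -/

namespace GirthParams

/-- One third of the logarithm of the size. -/
def scale (n : ℕ) : ℕ := (Nat.clog 2 n + 2) / 3

/-- The number of bits of a random number. -/
def bits (n : ℕ) : ℕ := 2 * scale n + Nat.clog 2 (Nat.clog 2 n + 4)

/-- The parameters for networks with `n` nodes and diameter estimate `D`. -/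
def ofSize (κ b n D : ℕ) : GirthParams where
  -- Random numbers range below r² times the last factor, with r = 2 ^ `scale n`, so the sampling
  -- rate is 4κl/r². The last factor is a power of two so that the numbers are made of fair coins.
  threshold := 4 * (κ * Nat.clog 2 n) * 2 ^ Nat.clog 2 (Nat.clog 2 n + 4)
  depth := (2 ^ scale n) ^ 2
  pivots := Nat.clog 2 n + 1
  diam := b * D
  load := (162 * κ ^ 2 + 2 * κ + 2 * b + 10) * Nat.clog 2 n
  words := 2 * Nat.clog 2 n + 4
  -- The summands cover the delay, the items emitted one after another, the depth of the directed
  -- explorations and the diameter.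
  time := 2 ^ bits n + 9 * (κ * Nat.clog 2 n) * 2 ^ scale n + 2 * (2 ^ scale n) ^ 2 + b * D
  iterations := Nat.clog 2 n

end GirthParams

/-! ### Numerical estimates for the parameters -/

theorem exp_natCast_le (k : ℕ) : Real.exp k ≤ 2 ^ (2 * k) := by
  rw [← Real.exp_one_pow, pow_mul]
  gcongr
  exact Real.exp_one_lt_d9.le.trans (by norm_num)

theorem exp_neg_natCast_le (k : ℕ) : Real.exp (-(k : ℝ)) ≤ 1 / 2 ^ k := by
  rw [Real.exp_neg, one_div, ← Real.exp_one_rpow, Real.rpow_natCast]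
  gcongr
  exact (by norm_num : (2 : ℝ) ≤ 2.7182818283).trans Real.exp_one_gt_d9.le

namespace GirthParams

variable {n : ℕ}

theorem le_two_pow_clog (n : ℕ) : n ≤ 2 ^ Nat.clog 2 n := Nat.le_pow_clog one_lt_two n

theorem two_pow_clog_le (hn : 2 ≤ n) : 2 ^ Nat.clog 2 n ≤ 2 * n := by
  have h := Nat.pow_pred_clog_lt_self one_lt_two hn
  have h1 : 0 < Nat.clog 2 n := Nat.clog_pos one_lt_two hn
  obtain ⟨k, hk⟩ := Nat.exists_eq_succ_of_ne_zero h1.ne'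
  rw [hk] at h ⊢
  rw [Nat.pred_succ] at h
  rw [pow_succ]
  omega

theorem le_cube (n : ℕ) : n ≤ (2 ^ scale n) ^ 3 := by
  refine (le_two_pow_clog n).trans ?_
  rw [← pow_mul]
  refine Nat.pow_le_pow_right two_pos ?_
  unfold scale
  omega

theorem cube_le (hn : 2 ≤ n) : (2 ^ scale n) ^ 3 ≤ 8 * n := by
  have h := two_pow_clog_le hn
  calc (2 ^ scale n) ^ 3 = 2 ^ (scale n * 3) := (pow_mul _ _ _).symm
    _ ≤ 2 ^ (Nat.clog 2 n + 2) := Nat.pow_le_pow_right two_pos (by unfold scale; omega)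
    _ = 4 * 2 ^ Nat.clog 2 n := by ring
    _ ≤ _ := by omega

theorem rpow_le_sq (n : ℕ) : (n : ℝ) ^ (2 / 3 : ℝ) ≤ ((2 : ℝ) ^ scale n) ^ 2 := by
  have h : (n : ℝ) ≤ ((2 : ℝ) ^ scale n) ^ 3 := by exact_mod_cast le_cube n
  refine (Real.rpow_le_rpow (Nat.cast_nonneg _) h (by norm_num)).trans (le_of_eq ?_)
  rw [← Real.rpow_natCast _ 3, ← Real.rpow_mul (by positivity), ← Real.rpow_natCast _ 2]
  norm_num

theorem sq_le_rpow (hn : 2 ≤ n) : ((2 : ℝ) ^ scale n) ^ 2 ≤ 4 * (n : ℝ) ^ (2 / 3 : ℝ) := by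
  have h : ((2 : ℝ) ^ scale n) ^ 3 ≤ 8 * n := by exact_mod_cast cube_le hn
  have h1 := Real.rpow_le_rpow (by positivity) h (by norm_num : (0 : ℝ) ≤ 2 / 3)
  rw [← Real.rpow_natCast _ 3, ← Real.rpow_mul (by positivity),
    Real.mul_rpow (by norm_num) (Nat.cast_nonneg _), show (8 : ℝ) = 2 ^ (3 : ℝ) by norm_num,
    ← Real.rpow_mul (by norm_num)] at h1
  norm_num at h1
  rw [← Real.rpow_natCast ((2 : ℝ) ^ scale n) 2]
  norm_num
  exact h1

theorem scale_pos (hn : 2 ≤ n) : 0 < scale n := by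
  have := Nat.clog_pos one_lt_two hn
  unfold scale
  omega

theorem two_pow_bits (n : ℕ) :
    2 ^ bits n = (2 ^ scale n) ^ 2 * 2 ^ Nat.clog 2 (Nat.clog 2 n + 4) := by
  unfold bits
  rw [pow_add, ← pow_mul, mul_comm 2]

theorem bits_le (hn : 2 ≤ n) : bits n ≤ 5 * Nat.clog 2 n := by
  have h := Nat.clog_pos one_lt_two hn
  have h1 : Nat.clog 2 (Nat.clog 2 n + 4) ≤ 3 * Nat.clog 2 n := by
    refine Nat.clog_le_of_le_pow ?_
    have h2 : Nat.clog 2 n < 2 ^ Nat.clog 2 n := Nat.lt_two_pow_self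
    have h3 : 2 ^ 1 ≤ 2 ^ Nat.clog 2 n := Nat.pow_le_pow_right two_pos h
    rw [mul_comm, pow_mul]
    calc Nat.clog 2 n + 4 ≤ 2 ^ 2 * 2 ^ Nat.clog 2 n := by omega
      _ ≤ (2 ^ Nat.clog 2 n) ^ 2 * 2 ^ Nat.clog 2 n := by gcongr; simpa using h3
      _ = _ := by ring
  unfold bits scale
  omega

theorem two_pow_scale_le (hn : 2 ≤ n) : 2 ^ scale n ≤ 2 ^ Nat.clog 2 n := by
  have h := Nat.clog_pos one_lt_two hn
  refine Nat.pow_le_pow_right two_pos ?_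
  unfold scale
  omega

/-- This bounds the number of pairs of a step and a node in the union bound for overloads; only the
logarithm matters, so the estimate is crude. -/
theorem time_mul_le {κ b D : ℕ} (hn : 2 ≤ n) (hD : D ≤ b * n) :
    ((ofSize κ b n D).time + 1) * n ≤ 2 ^ ((κ + 2 * b + 10) * Nat.clog 2 n) := by
  have hl := Nat.clog_pos one_lt_two hn
  have hM : 2 ^ bits n ≤ 2 ^ (5 * Nat.clog 2 n) := Nat.pow_le_pow_right two_pos (bits_le hn)
  have hr := two_pow_scale_le hn
  have hnY := le_two_pow_clog n
  have hlY : Nat.clog 2 n < 2 ^ Nat.clog 2 n := Nat.lt_two_pow_self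
  have hY : 2 ^ 1 ≤ 2 ^ Nat.clog 2 n := Nat.pow_le_pow_right two_pos hl
  have hpow : ∀ x, x ≤ 2 ^ (x * Nat.clog 2 n) := fun x =>
    Nat.lt_two_pow_self.le.trans (Nat.pow_le_pow_right two_pos (Nat.le_mul_of_pos_right x hl))
  have hκ := hpow κ
  have hb := hpow b
  have hX : (2 ^ ((κ + 2 * b + 10) * Nat.clog 2 n)) =
      2 ^ (κ * Nat.clog 2 n) * (2 ^ (b * Nat.clog 2 n)) ^ 2 * (2 ^ Nat.clog 2 n) ^ 10 := by
    rw [← pow_mul, ← pow_mul, ← pow_add, ← pow_add]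
    congr 1
    ring
  have h1 : 1 ≤ 2 ^ (κ * Nat.clog 2 n) := Nat.one_le_two_pow
  have h2 : 1 ≤ 2 ^ (b * Nat.clog 2 n) := Nat.one_le_two_pow
  have hM' : 2 ^ (5 * Nat.clog 2 n) = (2 ^ Nat.clog 2 n) ^ 5 := by rw [mul_comm, pow_mul]
  rw [hX]
  rw [hM'] at hM
  simp only [ofSize]
  generalize 2 ^ (κ * Nat.clog 2 n) = A at *
  generalize 2 ^ (b * Nat.clog 2 n) = B at *
  generalize 2 ^ bits n = M at *
  generalize 2 ^ scale n = r at *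
  generalize 2 ^ Nat.clog 2 n = Y at *
  generalize Nat.clog 2 n = l at *
  have hAB : 1 ≤ A * B ^ 2 := Nat.mul_pos h1 (Nat.pow_pos h2)
  have t1 : M ≤ A * B ^ 2 * Y ^ 5 := hM.trans (Nat.le_mul_of_pos_left _ hAB)
  have t2 : 9 * (κ * l) * r ≤ A * B ^ 2 * (9 * Y ^ 2) := by
    calc 9 * (κ * l) * r ≤ 9 * (A * Y) * Y := by gcongr
      _ = A * 1 * (9 * Y ^ 2) := by ring
      _ ≤ _ := by gcongr; exact Nat.pow_pos h2
  have t3 : 2 * r ^ 2 ≤ A * B ^ 2 * (2 * Y ^ 2) :=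
    (by gcongr : 2 * r ^ 2 ≤ 2 * Y ^ 2).trans (Nat.le_mul_of_pos_left _ hAB)
  have t4 : b * D ≤ A * B ^ 2 * Y := by
    calc b * D ≤ B * (B * Y) := by gcongr; exact hD.trans (by gcongr)
      _ = 1 * B ^ 2 * Y := by ring
      _ ≤ _ := by gcongr
  have hY' : Y ^ 5 + 9 * Y ^ 2 + 2 * Y ^ 2 + Y + 1 ≤ Y ^ 9 := by
    have : 2 ≤ Y := hY
    have e2 : 2 * Y ≤ Y ^ 2 := by nlinarith
    have e3 : 2 * Y ^ 2 ≤ Y ^ 3 := by nlinarith [pow_pos (show 0 < Y by omega) 2]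
    have e5 : 8 * Y ^ 2 ≤ Y ^ 5 := by
      calc 8 * Y ^ 2 = 2 ^ 3 * Y ^ 2 := by norm_num
        _ ≤ Y ^ 3 * Y ^ 2 := by gcongr
        _ = _ := by ring
    have e9 : 16 * Y ^ 5 ≤ Y ^ 9 := by
      calc 16 * Y ^ 5 = 2 ^ 4 * Y ^ 5 := by norm_num
        _ ≤ Y ^ 4 * Y ^ 5 := by gcongr
        _ = _ := by ring
    omega
  calc (M + 9 * (κ * l) * r + 2 * r ^ 2 + b * D + 1) * n
      ≤ (A * B ^ 2 * Y ^ 5 + A * B ^ 2 * (9 * Y ^ 2) + A * B ^ 2 * (2 * Y ^ 2) + A * B ^ 2 * Y +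
          A * B ^ 2) * Y := by gcongr
    _ = A * B ^ 2 * (Y ^ 5 + 9 * Y ^ 2 + 2 * Y ^ 2 + Y + 1) * Y := by ring
    _ ≤ A * B ^ 2 * Y ^ 9 * Y := by gcongr
    _ = _ := by ring

theorem sample_rare_le {κ l s e K : ℕ} (hn : n ≤ 2 ^ l) (hl : 0 < l) (hκ : 0 < κ) (hs : 0 < s)
    (he : 0 < e) (hK : K = 9 * (κ * l) * (2 * s)) :
    Real.exp (4 * (κ * l) * (2 * s) : ℕ) / 2 ^ (K + 1) +
      n * Real.exp (-((4 * (κ * l) * e : ℕ) * (s ^ 2 : ℕ) / ((2 * s) ^ 2 * e : ℕ) : ℝ)) +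
      (n * (n + 1) ^ (l + 1) : ℕ) * Real.exp (-((4 * (κ * l) * e : ℕ) * (s ^ 2 * (l + 3) : ℕ) /
        ((2 * s) ^ 2 * e : ℕ) : ℝ)) ≤ 1 / 2 ^ (κ * l) * (2 ^ l) ^ 3 := by
  have hs' : (s : ℝ) ≠ 0 := by exact_mod_cast hs.ne'
  have he' : (e : ℝ) ≠ 0 := by exact_mod_cast he.ne'
  have e1 : ((4 * (κ * l) * e : ℕ) * (s ^ 2 : ℕ) / ((2 * s) ^ 2 * e : ℕ) : ℝ) = (κ * l : ℕ) := by
    push_cast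
    field_simp
    ring
  have e2 : ((4 * (κ * l) * e : ℕ) * (s ^ 2 * (l + 3) : ℕ) / ((2 * s) ^ 2 * e : ℕ) : ℝ) =
      (κ * l * (l + 3) : ℕ) := by
    push_cast
    field_simp
    ring
  rw [e1, e2]
  have hX : (0 : ℝ) < 1 / 2 ^ (κ * l) := by positivity
  have hY : (2 : ℝ) ≤ 2 ^ l := le_self_pow₀ one_le_two hl.ne'
  have t1 : Real.exp (4 * (κ * l) * (2 * s) : ℕ) / 2 ^ (K + 1) ≤ 1 / 2 ^ (κ * l) := by
    rw [div_le_div_iff₀ (by positivity) (by positivity), one_mul]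
    refine (mul_le_mul_of_nonneg_right (exp_natCast_le _) (by positivity)).trans ?_
    rw [← pow_add]
    refine pow_le_pow_right₀ one_le_two ?_
    rw [hK]
    have : κ * l * 1 ≤ κ * l * (2 * s) := Nat.mul_le_mul_left _ (by omega)
    nlinarith
  have t2 : n * Real.exp (-(κ * l : ℕ)) ≤ 2 ^ l * (1 / 2 ^ (κ * l)) := by
    gcongr
    · exact_mod_cast hn
    · exact exp_neg_natCast_le _
  -- The factor l + 3 in β is chosen for this: with up to l + 1 pivots there are about 2 ^ (l²)
  -- pivot lists, so missing a survivor set must be that much less likely.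
  have t3 : (n * (n + 1) ^ (l + 1) : ℕ) * Real.exp (-(κ * l * (l + 3) : ℕ)) ≤
      2 * 2 ^ l * (1 / 2 ^ (κ * l)) := by
    have h1 : n * (n + 1) ^ (l + 1) ≤ 2 ^ (l + (l + 1) * (l + 1)) := by
      rw [pow_add 2 l, pow_mul 2 (l + 1)]
      gcongr
      have : 0 < 2 ^ l := Nat.two_pow_pos l
      rw [pow_succ]
      omega
    calc _ ≤ (2 : ℝ) ^ (l + (l + 1) * (l + 1)) * (1 / 2 ^ (κ * l * (l + 3))) := by
          gcongr
          · exact_mod_cast h1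
          · exact exp_neg_natCast_le _
      _ ≤ _ := by
          rw [mul_one_div, mul_one_div, div_le_div_iff₀ (by positivity) (by positivity),
            ← pow_succ', ← pow_add, ← pow_add]
          refine pow_le_pow_right₀ one_le_two ?_
          have : 1 * (l * (l + 2)) ≤ κ * (l * (l + 2)) := Nat.mul_le_mul_right _ hκ
          nlinarith
  generalize (1 : ℝ) / 2 ^ (κ * l) = X at *
  generalize (2 : ℝ) ^ l = Y at *
  have h2 : 1 + 3 * Y ≤ Y ^ 3 := by nlinarith [mul_nonneg (sub_nonneg.2 hY) (sub_nonneg.2 hY)]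
  calc _ ≤ X + Y * X + 2 * Y * X := add_le_add (add_le_add t1 t2) t3
    _ = X * (1 + 3 * Y) := by ring
    _ ≤ _ := by gcongr

theorem selected_rare_le {κ l M : ℕ} (hn : n ≤ 2 ^ l) (hl : 0 < l) (hM : 0 < M) :
    1 / 2 ^ (κ * l) + n * Real.exp (-((κ * l * M : ℕ) / M : ℝ)) ≤ 1 / 2 ^ (κ * l) * (2 ^ l) ^ 3 := by
  have hM' : (M : ℝ) ≠ 0 := by exact_mod_cast hM.ne'
  have hX : (0 : ℝ) < 1 / 2 ^ (κ * l) := by positivity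
  have hY : (2 : ℝ) ≤ 2 ^ l := le_self_pow₀ one_le_two hl.ne'
  have t2 : n * Real.exp (-((κ * l * M : ℕ) / M : ℝ)) ≤ 2 ^ l * (1 / 2 ^ (κ * l)) := by
    rw [Nat.cast_mul, mul_div_cancel_right₀ _ hM']
    gcongr
    · exact_mod_cast hn
    · exact exp_neg_natCast_le _
  generalize (1 : ℝ) / 2 ^ (κ * l) = X at *
  generalize (2 : ℝ) ^ l = Y at *
  have h2 : 1 + Y ≤ Y ^ 3 := by nlinarith [mul_nonneg (sub_nonneg.2 hY) (sub_nonneg.2 hY)]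
  calc _ ≤ X + Y * X := by gcongr
    _ = X * (1 + Y) := by ring
    _ ≤ _ := by gcongr

theorem selected_le {l β M r m : ℕ} (hM : 0 < M) (hn : n ≤ r * M) (hβ : 4 * β ≤ M)
    (h : 2 * r + 2 * (l + 1) ≤ m * M) :
    2 * (((n : ℝ) + 2 * (l + 1) * β) / M) + l + 1 ≤ m * M := by
  have hM' : (0 : ℝ) < M := by exact_mod_cast hM
  have hn' : (n : ℝ) ≤ r * M := by exact_mod_cast hn
  have hβ' : (4 * β : ℝ) ≤ M := by exact_mod_cast hβ
  have h' : (2 * r + 2 * (l + 1) : ℝ) ≤ m * M := by exact_mod_cast h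
  have h1 : ((n : ℝ) + 2 * (l + 1) * β) / M ≤ r + (l + 1) / 2 := by
    rw [div_le_iff₀ hM']
    have : (l + 1 : ℝ) * (4 * β) ≤ (l + 1) * M := by gcongr
    linarith
  linarith

theorem last_le {l β M m k : ℕ} (hM : 0 < M) (hn : n ≤ 2 ^ k) (hβ : 4 * β ≤ M)
    (h : 2 + l ≤ m) : (n : ℝ) / 2 ^ k + 2 * (l + 1) * β ≤ m * M := by
  have hM' : (1 : ℝ) ≤ M := by exact_mod_cast hM
  have hn' : (n : ℝ) / 2 ^ k ≤ 1 := by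
    rw [div_le_one (by positivity)]
    exact_mod_cast hn
  have hβ' : (4 * β : ℝ) ≤ M := by exact_mod_cast hβ
  have h' : (2 + l : ℝ) * M ≤ m * M := by gcongr; exact_mod_cast h
  have : (l + 1 : ℝ) * (4 * β) ≤ (l + 1) * M := by gcongr
  have : 0 ≤ (l + 1 : ℝ) * M := by positivity
  linarith

theorem load_rare_le {A m L k g : ℕ} (hA : A ≤ 2 ^ g) (h : g + 2 * m + k ≤ L) :
    (A : ℝ) * (Real.exp m / 2 ^ L) ≤ 1 / 2 ^ k := by
  have hA' : (A : ℝ) ≤ 2 ^ g := by exact_mod_cast hA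
  calc _ ≤ (2 : ℝ) ^ g * (2 ^ (2 * m) / 2 ^ L) := by
        gcongr
        exact exp_natCast_le _
    _ ≤ _ := by
        rw [← mul_div_assoc, div_le_div_iff₀ (by positivity) (by positivity), one_mul, ← pow_add,
          ← pow_add]
        exact pow_le_pow_right₀ one_le_two h

theorem mul_self_le_cast {k l r e : ℕ} (he : l ≤ e) :
    ((9 * (k * l) * r : ℕ) * (9 * (k * l) * r : ℕ) : ℝ) ≤
      (81 * k ^ 2 * l : ℕ) * (r ^ 2 * e : ℕ) := by
  rw [← Nat.cast_mul, ← Nat.cast_mul, Nat.cast_le]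
  calc 9 * (k * l) * r * (9 * (k * l) * r) = 81 * k ^ 2 * l * (r ^ 2 * l) := by ring
    _ ≤ _ := by gcongr

theorem mul_threshold_le_cast {k r e : ℕ} (hn : n ≤ r ^ 3) :
    ((n : ℝ) * (4 * k * e : ℕ)) ≤ (4 * k * r : ℕ) * (r ^ 2 * e : ℕ) := by
  rw [← Nat.cast_mul, ← Nat.cast_mul, Nat.cast_le]
  calc n * (4 * k * e) ≤ r ^ 3 * (4 * k * e) := by gcongr
    _ = _ := by ring

theorem two_mul_add_le {k m r M : ℕ} (hk : 1 ≤ k) (hr : r ≤ M) (hM : 0 < M) (hm : 27 * k ≤ m) :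
    2 * r + 2 * (k + 1) ≤ m * M :=
  calc 2 * r + 2 * (k + 1) ≤ 2 * M + 2 * (k + 1) * M :=
        add_le_add (Nat.mul_le_mul_left 2 hr) (Nat.le_mul_of_pos_right _ hM)
    _ = (2 + 2 * (k + 1)) * M := by ring
    _ ≤ _ := by gcongr; omega

theorem le_load (q b l : ℕ) : (q + 3 + 2 * b + 10) * l + 2 * (81 * (q + 3) ^ 2 * l) + q * l ≤
    (162 * (q + 3) ^ 2 + 2 * (q + 3) + 2 * b + 10) * l + 1 := by
  ring_nf
  omega

/-- With κ = q + 3 and r = 2 ^ `scale n`, the expected sample size is at most μ₀ = 4κlr. The bound K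
= 9κlr exceeds 2μ₀, so 2 ^ K beats exp μ₀ ≤ 2 ^ (2μ₀). The value of μ comes from K² ≤ 81κ²l·M. The
windows have length (r/2)², as r² ≤ 4n^(2/3). The extra 3 in κ pays for factors up to (2 ^ l)³ from
union bounds. -/
theorem tuned_ofSize {q b D : ℕ} (hn : 2 ≤ n) (hD : D ≤ b * n) :
    (ofSize (q + 3) b n D).Tuned n (2 ^ bits n) (9 * ((q + 3) * Nat.clog 2 n) * 2 ^ scale n)
      ((2 ^ (scale n - 1)) ^ 2) ((2 ^ (scale n - 1)) ^ 2 * (Nat.clog 2 n + 3))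
      ((q + 3) * Nat.clog 2 n * 2 ^ bits n) ((q + 3) * Nat.clog 2 n)
      (4 * ((q + 3) * Nat.clog 2 n) * 2 ^ scale n : ℕ) (81 * (q + 3) ^ 2 * Nat.clog 2 n : ℕ)
      (1 / 2 ^ (q * Nat.clog 2 n)) := by
  have hl := Nat.clog_pos one_lt_two hn
  have hnY := le_two_pow_clog n
  have hn3 := le_cube n
  have htime := time_mul_le (κ := q + 3) hn hD
  have hsq := sq_le_rpow hn
  have hbits := two_pow_bits n
  have he : Nat.clog 2 n + 4 ≤ 2 ^ Nat.clog 2 (Nat.clog 2 n + 4) := Nat.le_pow_clog one_lt_two _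
  have hr : 2 ^ scale n = 2 * 2 ^ (scale n - 1) := by
    rw [← pow_succ']
    congr 1
    have := scale_pos hn
    omega
  have hr' : (2 : ℝ) ^ scale n = 2 * 2 ^ (scale n - 1) := by exact_mod_cast hr
  have hs : 0 < 2 ^ (scale n - 1) := Nat.two_pow_pos _
  have hε : (1 : ℝ) / 2 ^ (q * Nat.clog 2 n) =
      1 / 2 ^ ((q + 3) * Nat.clog 2 n) * (2 ^ Nat.clog 2 n) ^ 3 := by
    rw [one_div_mul_eq_div, ← pow_mul, div_eq_div_iff (by positivity) (by positivity), one_mul,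
      ← pow_add]
    congr 1
    ring
  have hM : 0 < 2 ^ bits n := Nat.two_pow_pos _
  have hβ : 4 * ((2 ^ (scale n - 1)) ^ 2 * (Nat.clog 2 n + 3)) ≤ 2 ^ bits n := by
    rw [hbits, hr]
    calc 4 * ((2 ^ (scale n - 1)) ^ 2 * (Nat.clog 2 n + 3))
        = (2 * 2 ^ (scale n - 1)) ^ 2 * (Nat.clog 2 n + 3) := by ring
      _ ≤ _ := by gcongr; omega
  have hrM : 2 ^ scale n * 2 ^ scale n ≤ 2 ^ bits n := by
    rw [hbits, sq]
    exact Nat.le_mul_of_pos_right _ (by omega)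
  have hκl : 3 * 1 ≤ (q + 3) * Nat.clog 2 n := Nat.mul_le_mul (by omega) hl
  have hm : 27 * ((q + 3) * Nat.clog 2 n) ≤ 81 * (q + 3) ^ 2 * Nat.clog 2 n :=
    calc _ ≤ 27 * ((q + 3) * Nat.clog 2 n) * (3 * (q + 3)) := Nat.le_mul_of_pos_right _ (by omega)
      _ = _ := by ring
  refine ⟨hM, ?_, ?_, ?_, hβ, ?_, ?_, ?_, ?_, ?_, ?_, ?_, ?_, ?_⟩
  · exact hnY.trans_lt (Nat.pow_lt_pow_right one_lt_two (Nat.lt_succ_self _))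
  · exact pow_pos (pow_pos two_pos _) 2
  · rw [hr'] at hsq
    push_cast
    linarith
  · exact le_of_eq rfl
  · rw [hbits]
    exact mul_self_le_cast (by omega)
  · refine selected_le hM (r := 2 ^ scale n) (hn3.trans ?_) hβ
      (two_mul_add_le (by omega) ((Nat.le_mul_self _).trans hrM) hM hm)
    rw [pow_succ, mul_comm, sq]
    gcongr
  · rw [Nat.cast_mul ((q + 3) * Nat.clog 2 n)]
    refine mul_le_mul_of_nonneg_right (Nat.cast_le.2 (le_trans ?_ hm)) (Nat.cast_nonneg _)
    omega
  · exact last_le (k := Nat.clog 2 n) hM hnY hβ (le_trans (by omega) hm)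
  · rw [hbits]
    exact mul_threshold_le_cast hn3
  · rw [hε, hbits, hr]
    exact sample_rare_le hnY hl (by omega) hs (by omega) rfl
  · rw [hε]
    exact selected_rare_le hnY hl hM
  · exact load_rare_le htime (le_load q b _)

end GirthParams

/-! ## The main theorem -/

/-- The distributed algorithm for the girth. -/
noncomputable def girthAlgorithm (κ b : ℕ) : CongestAlgorithm :=
  Proto.toAlgorithm (fun n => (5 + 3 * Nat.clog 2 n) * GirthParams.bits n) fun I ω =>
    Proto.girthProgram (GirthParams.ofSize κ b I.size I.diamEstimate) I fun i =>
      coinValue (fun j (_ : Unit) => coinEquiv (5 + 3 * Nat.clog 2 I.size)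
        (GirthParams.bits I.size) ω j) i ()

namespace DirectedNetwork

variable {V : Type*} [Fintype V] {N : DirectedNetwork V}

theorem hopDiam_le_card (N : DirectedNetwork V) : N.hopDiam ≤ Fintype.card V := by
  have hc : N.comm.Connected := N.connected
  have := hc.nonempty
  obtain ⟨u, v, h⟩ := N.comm.exists_dist_eq_diam
  obtain ⟨p, hp, hlen⟩ := hc.exists_path_of_dist u v
  rw [hopDiam, ← h, ← hlen]
  exact hp.length_lt.le

variable {a b q : ℕ}

/-- Identifiers need a·l bits, while times of emission and truncated distances fit into 6l bits;
hence the word size (a + 6)l. -/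
theorem admissible_ofSize (hn : 2 ≤ Fintype.card V)
    (hid : ∀ v, N.ident v < 2 ^ (a * Nat.clog 2 (Fintype.card V)))
    (hD : N.hopDiam ≤ b * N.diamEstimate) {u : ℕ → V → ℕ}
    (hu : ∀ i v, u i v ≤ 2 ^ GirthParams.bits (Fintype.card V))
    (hS : (sample (GirthParams.ofSize q b (Fintype.card V) N.diamEstimate) u).ncard ≤
      9 * (q * Nat.clog 2 (Fintype.card V)) *
      2 ^ GirthParams.scale (Fintype.card V)) :
    N.Admissible (GirthParams.ofSize q b (Fintype.card V) N.diamEstimate) u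
      (sample (GirthParams.ofSize q b (Fintype.card V) N.diamEstimate) u)
      ((a + 6) * Nat.clog 2 (Fintype.card V))
      (9 * (q * Nat.clog 2 (Fintype.card V)) * 2 ^ GirthParams.scale (Fintype.card V)) := by
  set n := Fintype.card V
  have hl := Nat.clog_pos one_lt_two hn
  have hY : 2 ≤ 2 ^ Nat.clog 2 n := Nat.le_self_pow hl.ne' 2
  have h6 : 2 ^ (6 * Nat.clog 2 n) ≤ 2 ^ ((a + 6) * Nat.clog 2 n) :=
    Nat.pow_le_pow_right two_pos (Nat.mul_le_mul_right _ (by omega))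
  rw [mul_comm 6, pow_mul] at h6
  have hbits : 2 ^ GirthParams.bits n ≤ (2 ^ Nat.clog 2 n) ^ 5 := by
    rw [← pow_mul, mul_comm _ 5]
    exact Nat.pow_le_pow_right two_pos (GirthParams.bits_le hn)
  have hr := GirthParams.two_pow_scale_le hn
  have hnY := GirthParams.le_two_pow_clog n
  refine ⟨?_, fun v => ?_, ?_, fun i v => ?_, fun i v => ?_, hS, ?_, ?_, fun x y => ?_⟩
  · exact hnY.trans_lt (Nat.pow_lt_pow_right one_lt_two (Nat.lt_succ_self _))
  · exact (hid v).trans_le (Nat.pow_le_pow_right two_pos (Nat.mul_le_mul_right _ (by omega)))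
  · refine lt_of_lt_of_le ?_ h6
    change 2 * (2 ^ GirthParams.scale n) ^ 2 < _
    generalize 2 ^ Nat.clog 2 n = Y at *
    calc 2 * (2 ^ GirthParams.scale n) ^ 2 ≤ Y * Y ^ 2 := by gcongr
      _ = Y ^ 3 := by ring
      _ < _ := Nat.pow_lt_pow_right (by omega) (by norm_num)
  · refine le_trans ?_ h6
    have := hu i v
    generalize 2 ^ Nat.clog 2 n = Y at *
    calc u i v + n ≤ Y ^ 5 + Y ^ 5 :=
          add_le_add (this.trans hbits) (hnY.trans (Nat.le_self_pow (by norm_num) _))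
      _ = 2 * Y ^ 5 := by ring
      _ ≤ Y * Y ^ 5 := by gcongr
      _ = _ := by ring
  · have := hu i v
    simp only [GirthParams.ofSize, GirthParams.cutoff]
    omega
  · simp only [GirthParams.ofSize]
    omega
  · simp only [GirthParams.ofSize]
    omega
  · obtain ⟨d, hd, h⟩ := N.exists_reaches_comm x y
    exact ⟨d, hd.trans hD, h⟩

theorem prob_girthAlgorithm_le (hn : 2 ≤ Fintype.card V)
    (hid : ∀ v, N.ident v < 2 ^ (a * Nat.clog 2 (Fintype.card V)))
    (hD : N.hopDiam ≤ b * N.diamEstimate) (hD' : N.diamEstimate ≤ b * N.hopDiam) :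
    (girthAlgorithm (q + 3) b).prob V {ω | ¬ ∃ M : ℕ∞,
        (girthAlgorithm (q + 3) b).Computes ((a + 7) * Nat.clog 2 (Fintype.card V)) N ω
          (GirthParams.ofSize (q + 3) b (Fintype.card V) N.diamEstimate).rounds M ∧
        IsGirthApprox N.graph M} ≤
      ENNReal.ofReal ((GirthParams.ofSize (q + 3) b (Fintype.card V) N.diamEstimate).stages *
        (1 / 2 ^ (q * Nat.clog 2 (Fintype.card V)))) := by
  have : Nonempty V := N.connected.nonempty
  have hl := Nat.clog_pos one_lt_two hn
  have htuned := GirthParams.tuned_ofSize (q := q) hn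
    (hD'.trans (Nat.mul_le_mul_left b N.hopDiam_le_card))
  have hrare := rare_not_goodCoins (N := N) htuned
  refine prob_le_of_rare (girthAlgorithm (q + 3) b)
    (P := (GirthParams.ofSize (q + 3) b (Fintype.card V) N.diamEstimate).stages)
    (b := GirthParams.bits (Fintype.card V)) rfl hrare (by positivity) _ fun ω hω hgood => hω ?_
  have hadm := admissible_ofSize (N := N) (q := q + 3) hn hid hD (coinValue_le _)
    hgood.goodSample.ncard_le
  have hruns := runs_girthProgram hadm hgood.loadsBounded rfl
  refine ⟨_, Runs.computes (w := (a + 6) * Nat.clog 2 (Fintype.card V)) ?_ _ _ ω hruns, ?_⟩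
  -- The encoding adds one flag bit to a word, and l ≥ 1 pays for it.
  · rw [add_mul, add_mul]
    omega
  · refine isGirthApprox_girthOutput hadm.card_lt ?_ ?_ hgood.goodSample.hitsWindows
    · refine (GirthParams.rpow_le_sq _).trans (le_of_eq ?_)
      simp only [GirthParams.ofSize]
      push_cast
      rfl
    · refine le_trans (Nat.pow_le_pow_left (Nat.pow_le_pow_right two_pos (Nat.sub_le _ _)) 2) ?_
      exact Nat.le_mul_of_pos_left _ two_pos

end DirectedNetwork

/-- There are at most (2 ^ l)⁴ stages, which the summand 4 in the exponent absorbs. -/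
theorem stages_mul_le {n : ℕ} (hn : 2 ≤ n) (c : ℝ) :
    ((5 + 3 * Nat.clog 2 n : ℕ) * (1 / 2 ^ ((⌈c⌉₊ + 4) * Nat.clog 2 n)) : ℝ) ≤ (n : ℝ) ^ (-c) := by
  have hl := Nat.clog_pos one_lt_two hn
  have hlY : Nat.clog 2 n < 2 ^ Nat.clog 2 n := Nat.lt_two_pow_self
  have hY : 2 ≤ 2 ^ Nat.clog 2 n := Nat.le_self_pow hl.ne' 2
  have h1 : 5 + 3 * Nat.clog 2 n ≤ (2 ^ Nat.clog 2 n) ^ 4 := by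
    generalize 2 ^ Nat.clog 2 n = Y at *
    calc 5 + 3 * Nat.clog 2 n ≤ 2 ^ 3 * Y := by omega
      _ ≤ Y ^ 3 * Y := by gcongr
      _ = _ := by ring
  have h1' : ((5 + 3 * Nat.clog 2 n : ℕ) : ℝ) ≤ ((2 : ℝ) ^ Nat.clog 2 n) ^ 4 := by
    exact_mod_cast h1
  have hn1 : (1 : ℝ) ≤ n := by exact_mod_cast (by omega : 1 ≤ n)
  have h2 : (n : ℝ) ^ c ≤ ((2 : ℝ) ^ Nat.clog 2 n) ^ ⌈c⌉₊ :=
    calc (n : ℝ) ^ c ≤ (n : ℝ) ^ (⌈c⌉₊ : ℝ) := Real.rpow_le_rpow_of_exponent_le hn1 (Nat.le_ceil c)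
      _ = (n : ℝ) ^ ⌈c⌉₊ := Real.rpow_natCast _ _
      _ ≤ _ := by
          gcongr
          exact_mod_cast GirthParams.le_two_pow_clog n
  rw [Real.rpow_neg (by positivity), mul_comm (⌈c⌉₊ + 4) (Nat.clog 2 n), pow_mul, pow_add, ← one_div,
    mul_one_div, div_le_div_iff₀ (by positivity) (by positivity), one_mul, mul_comm]
  exact mul_le_mul h2 h1' (by positivity) (by positivity)

theorem clog_le_logb {n : ℕ} (hn : 2 ≤ n) : (Nat.clog 2 n : ℝ) ≤ 1 + Real.logb 2 n := by
  have h : ((2 : ℝ) ^ Nat.clog 2 n) ≤ 2 * n := by exact_mod_cast GirthParams.two_pow_clog_le hn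
  have hn0 : (0 : ℝ) < n := by exact_mod_cast (by omega : 0 < n)
  have := Real.logb_le_logb_of_le one_lt_two (by positivity) h
  rwa [Real.logb_mul two_ne_zero hn0.ne', Real.logb_pow, Real.logb_self_eq_one one_lt_two,
    mul_one] at this

/-- The duration of the algorithm, up to the constant. -/
theorem exists_rounds_ofSize_le (κ b : ℕ) : ∃ K : ℝ, 0 ≤ K ∧ ∀ n D E : ℕ, 2 ≤ n → E ≤ b * D →
    ((GirthParams.ofSize κ b n E).rounds : ℝ) ≤
      K * ((n : ℝ) ^ (2 / 3 : ℝ) + D) * (1 + Real.logb 2 n) ^ 4 := by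
  refine ⟨(6 * 6 * (162 * κ ^ 2 + 2 * κ + 2 * b + 10 + 1) * (9 * κ + b ^ 2 + 12) + b ^ 2 : ℕ) * 4,
    by positivity, fun n D E hn hE => ?_⟩
  have hl := Nat.clog_pos one_lt_two hn
  have hsq := GirthParams.sq_le_rpow hn
  have hlog := clog_le_logb hn
  have he : 2 ^ Nat.clog 2 (Nat.clog 2 n + 4) ≤ 2 * (Nat.clog 2 n + 4) :=
    GirthParams.two_pow_clog_le (by omega)
  have hbE : b * E ≤ b ^ 2 * D := by
    rw [sq, mul_assoc]
    exact Nat.mul_le_mul_left b hE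
  -- The four logarithmic factors are the number of iterations, the range of the delays, the load
  -- per step and the words per token.
  have hnat : (GirthParams.ofSize κ b n E).rounds ≤
      (6 * 6 * (162 * κ ^ 2 + 2 * κ + 2 * b + 10 + 1) * (9 * κ + b ^ 2 + 12) + b ^ 2) *
        ((2 ^ GirthParams.scale n) ^ 2 + D) * Nat.clog 2 n ^ 4 := by
    simp only [GirthParams.rounds, GirthParams.ofSize, GirthParams.two_pow_bits]
    have hr : 1 ≤ 2 ^ GirthParams.scale n := Nat.one_le_two_pow
    generalize 2 ^ Nat.clog 2 (Nat.clog 2 n + 4) = e at *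
    generalize 2 ^ GirthParams.scale n = r at *
    generalize Nat.clog 2 n = l at *
    generalize 162 * κ ^ 2 + 2 * κ + 2 * b + 10 = g
    have t1 : r ^ 2 * e + 9 * (κ * l) * r + 2 * r ^ 2 + b * E ≤
        (9 * κ + b ^ 2 + 12) * (r ^ 2 + D) * l := by
      calc r ^ 2 * e + 9 * (κ * l) * r + 2 * r ^ 2 + b * E
          ≤ r ^ 2 * (10 * l) + 9 * (κ * l) * r ^ 2 + 2 * r ^ 2 * l + b ^ 2 * D * l := by
            refine add_le_add (add_le_add (add_le_add ?_ ?_) ?_) ?_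
            · exact Nat.mul_le_mul_left _ (by omega)
            · exact Nat.mul_le_mul_left _ (Nat.le_self_pow two_ne_zero r)
            · exact Nat.le_mul_of_pos_right _ hl
            · exact hbE.trans (Nat.le_mul_of_pos_right _ hl)
        _ = (9 * κ + 12) * r ^ 2 * l + b ^ 2 * D * l := by ring
        _ ≤ (9 * κ + b ^ 2 + 12) * r ^ 2 * l + (9 * κ + b ^ 2 + 12) * D * l := by
            gcongr <;> omega
        _ = _ := by ring
    have t2 : g * l + 1 ≤ (g + 1) * l := by rw [add_mul]; omega
    calc (4 + 2 * l) * ((r ^ 2 * e + 9 * (κ * l) * r + 2 * r ^ 2 + b * E) *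
          ((g * l + 1) * (2 * l + 4))) + b * E
        ≤ (6 * l) * (((9 * κ + b ^ 2 + 12) * (r ^ 2 + D) * l) * (((g + 1) * l) * (6 * l))) +
          b ^ 2 * D :=
          add_le_add (Nat.mul_le_mul (by omega) (Nat.mul_le_mul t1 (Nat.mul_le_mul t2 (by omega))))
            hbE
      _ ≤ (6 * l) * (((9 * κ + b ^ 2 + 12) * (r ^ 2 + D) * l) * (((g + 1) * l) * (6 * l))) +
          b ^ 2 * (r ^ 2 + D) * l ^ 4 := by
          refine Nat.add_le_add_left ?_ _
          exact (Nat.mul_le_mul_left _ (Nat.le_add_left _ _)).trans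
            (Nat.le_mul_of_pos_right _ (Nat.pow_pos hl))
      _ = _ := by ring
  have hcast : ((GirthParams.ofSize κ b n E).rounds : ℝ) ≤
      ((6 * 6 * (162 * κ ^ 2 + 2 * κ + 2 * b + 10 + 1) * (9 * κ + b ^ 2 + 12) + b ^ 2 : ℕ) : ℝ) *
        (((2 : ℝ) ^ GirthParams.scale n) ^ 2 + D) * (Nat.clog 2 n : ℝ) ^ 4 := by
    exact_mod_cast hnat
  refine hcast.trans ?_
  generalize (6 * 6 * (162 * κ ^ 2 + 2 * κ + 2 * b + 10 + 1) * (9 * κ + b ^ 2 + 12) + b ^ 2 : ℕ) = C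
  rw [mul_assoc (C : ℝ) 4]
  gcongr
  have : (0 : ℝ) ≤ D := Nat.cast_nonneg D
  linarith

theorem mainTheorem3 :
    ∃ k : ℕ, ∀ a b : ℕ, ∃ B : ℕ, ∀ c : ℝ, 1 ≤ c →
      ∃ (K : ℝ) (A : CongestAlgorithm),
        ∀ (V : Type*) [Fintype V] (N : DirectedNetwork V),
          (∀ v, N.ident v < 2 ^ (a * Nat.clog 2 (Fintype.card V))) →
          N.hopDiam ≤ b * N.diamEstimate → N.diamEstimate ≤ b * N.hopDiam →
          ∃ T : ℕ,
            (T : ℝ) ≤ K * ((Fintype.card V : ℝ) ^ (2 / 3 : ℝ) + N.hopDiam) *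
              (1 + Real.logb 2 (Fintype.card V)) ^ k ∧
            A.prob V {ω | ¬ ∃ M : ℕ∞,
                A.Computes (B * Nat.clog 2 (Fintype.card V)) N ω T M ∧
                  IsGirthApprox N.graph M} ≤
              ENNReal.ofReal ((Fintype.card V : ℝ) ^ (-c)) := by
  refine ⟨4, fun a b => ⟨a + 7, fun c _ => ?_⟩⟩
  -- The 4 is spent in `stages_mul_le` and the 3 in `tuned_ofSize`.
  obtain ⟨K, hK0, hK⟩ := exists_rounds_ofSize_le (⌈c⌉₊ + 4 + 3) b
  refine ⟨K, girthAlgorithm (⌈c⌉₊ + 4 + 3) b, fun V _ N hid hD hD' => ?_⟩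
  have := N.connected.nonempty
  have hpos : 0 < Fintype.card V := Fintype.card_pos
  rcases Nat.lt_or_ge (Fintype.card V) 2 with hn | hn
  -- On a single vertex the allowed failure probability is 1, so there is nothing to compute.
  · have h1 : Fintype.card V = 1 := by omega
    refine ⟨0, ?_, ?_⟩
    · rw [h1, Nat.cast_one, Nat.cast_zero, Real.logb_one, Real.one_rpow]
      positivity
    · rw [h1, Nat.cast_one, Real.one_rpow, ENNReal.ofReal_one]
      exact (MeasureTheory.measure_mono (Set.subset_univ _)).trans_eq
        ((PMF.toOuterMeasure_apply_eq_one_iff _ _).2 (Set.subset_univ _))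
  · exact ⟨_, hK _ _ _ hn hD', (N.prob_girthAlgorithm_le hn hid hD hD').trans
      (ENNReal.ofReal_le_ofReal (stages_mul_le hn c))⟩
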